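/- **Setting.** Let $f$ be a nonconstant, nonlinear meromorphic function on $\mathbb C$ with values in $\hat{\mathbb C}=\mathbb C\cup\{\infty\}$, with domain of definition $X=\mathbb C$; if $f$ is rational, one may alternatively take $X=\hat{\mathbb C}$ and regard $f$ as a self-map of the sphere. Iterates $f^n(x)$ are considered wherever they are defined, and preimages are taken in $X$. Let $S(f)\subset\hat{\mathbb C}$ be the closure of the set of critical values of $f$ and of its asymptotic values (limits of $f$ along curves tending to $\infty$; there are none if $X=\hat{\mathbb C}$), and let $P(f)=\overline{\{f^n(s): s\in S(f),\ n\ge 0\}}\subset\hat{\mathbb C}$ be the postsingular set. Write $D_r(z)$ for the open Euclidean disk of radius $r$ about $z$. For open $\Omega\subset\mathbb C$, $\operatorname{diam}_\Omega$ is the diameter in the hyperbolic (Kobayashi) distance of $\Omega$, points in different components having distance $\infty$. A point $z_0\in\mathbb C$ is *$\Delta$-regular* if there is $\delta>0$ such that, for every $n\ge 0$ and every component $U$ of $f^{-n}(D_\delta(z_0))$ with $U\cap P(f)\ne\emptyset$, the set $U$ is simply connected and $f^n:U\to D_\delta(z_0)$ is a branched covering (proper map) of degree at most $\Delta$. **Constants.**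 Let $S_0$ be a finite set of critical values of $f$, $D\ge 1$ an integer, $N:=D^{\#S_0}$. Let $N_0$ be the smallest number of disks of radius $1/3$ with centres in the unit disk $D_1(0)$ that cover $D_1(0)$. Let $C(N,2/3)<\infty$ be a constant such that, for all $z_0\in\mathbb C$, $\delta>0$, every simply connected domain $U\subset\mathbb C$ and every proper holomorphic map $g:U\to D_\delta(z_0)$ of degree at most $N$, each component of $g^{-1}(D_{2\delta/3}(z_0))$ has diameter at most $C(N,2/3)$ in the hyperbolic metric of $U$. Such a constant exists, and the result holds for every choice of it. Put $C_0:=N_0\cdot N\cdot C(N,2/3)$. **Regular sets.** A non-empty open set $\Omega\subset\mathbb C$ with $f^{-1}(\Omega)\subset\Omega$ is *$(S_0,D)$-regular* if the following holds. Let $V\subset\Omega$ be a simply connected domain and $U$ a component of $f^{-1}(V)$, and suppose there is a set $W$ with $V\subset W\subset\Omega$ and $\operatorname{diam}_\Omega(W)\le 2C_0$ such that the component of $f^{-1}(W)$ containing $U$ intersects $P(f)$. Then $f:U\to V$ is a proper map of degree at most $D$ with at most one branched value; and if $s$ is a branched value of this map, then $s\in S_0$ and $f^j(s)\notin U$ for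 all $j\ge 0$. **Theorem (general form of Mañé's theorem).** Let $\Omega$ be an $(S_0,D)$-regular set, and let $N$ and $C_0$ be as above. Then every point of $\Omega$ is $N$-regular. More precisely, let $z_0\in\Omega$ and let $\delta>0$ be so small that $D_{2\delta}(z_0)\subset\Omega$ and $\operatorname{diam}_\Omega(D_{2\delta}(z_0))\le C_0$ (this holds for all sufficiently small $\delta>0$). Set $V_0:=D_\delta(z_0)$. Let $n\ge 0$ and let $V$ be a component of $f^{-n}(V_0)$ with $V\cap P(f)\ne\emptyset$. Then 1. $V$ is simply connected and $f^n:V\to V_0$ is a proper map of degree at most $N$; 2. $V\subset\Omega$ and $\operatorname{diam}_\Omega(V)\le C_0$. -/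

import Mathlib

open Set Filter Topology
open scoped NNReal ENNReal

/-- The Riemann sphere `ℂ ∪ {∞}`, as a topological space. -/
abbrev Sphere : Type := OnePoint ℂ

/-! ### Meromorphic functions as partial self-maps of the sphere -/

/-- The map `w ↦ 1 / w` into the sphere, with `1 / 0 = ∞`. -/
noncomputable def sphereInv (w : ℂ) : Sphere :=
  open Classical in if w = 0 then OnePoint.infty else ((w⁻¹ : ℂ) : Sphere)

/-- `f : ℂ → ℂ ∪ {∞}` is meromorphic, i.e. holomorphic as a map into the Riemann sphere: near every
point it is `g` or `1 / g` for some analytic `g`. -/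
def IsMeromorphicToSphere (f : ℂ → Sphere) : Prop :=
  ∀ z : ℂ, ∃ g : ℂ → ℂ, AnalyticAt ℂ g z ∧
    ((∀ᶠ w in 𝓝 z, f w = (g w : Sphere)) ∨ (∀ᶠ w in 𝓝 z, f w = sphereInv (g w)))

/-- `f` has a limit in the sphere at `∞`. For a meromorphic `f` this says that `f` is rational. -/
def ExtendsToInfinity (f : ℂ → Sphere) : Prop :=
  ∃ y : Sphere, Tendsto f (cocompact ℂ) (𝓝 y)

/-- `X` is a domain of definition of the meromorphic function `f`: either the plane `ℂ`, or, if
`f` is rational, the whole sphere. -/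
def IsDomainOfDefinition (f : ℂ → Sphere) (X : Set Sphere) : Prop :=
  X = {OnePoint.infty}ᶜ ∨ (X = univ ∧ ExtendsToInfinity f)

/-- `f` extended to the sphere by its limit at `∞`. The value at `∞` is meaningless if there is no
limit; below it is only used at points of the domain of definition. -/
noncomputable def sphereMap (f : ℂ → Sphere) : Sphere → Sphere
  | OnePoint.infty => limUnder (cocompact ℂ) f
  | OnePoint.some z => f z

/-- `f^n(x)` is defined: `x, f(x), …, f^{n-1}(x)` all lie in the domain of definition `X`. -/
def IterDefined (f : ℂ → Sphere) (X : Set Sphere) (n : ℕ) (x : Sphere) : Prop :=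
  ∀ k < n, (sphereMap f)^[k] x ∈ X

/-- The preimage `f^{-n}(A)`. -/
def iterPreimage (f : ℂ → Sphere) (X : Set Sphere) (n : ℕ) (A : Set Sphere) : Set Sphere :=
  {x | IterDefined f X n x ∧ (sphereMap f)^[n] x ∈ A}

/-- A subset of the plane, regarded as a subset of the sphere. -/
def toSphere (A : Set ℂ) : Set Sphere := (fun z : ℂ => (z : Sphere)) '' A

/-- `U` is a connected component of the set `A`. -/
def IsComponentOf {Y : Type*} [TopologicalSpace Y] (U A : Set Y) : Prop :=
  ∃ x ∈ A, U = connectedComponentIn A x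

/-! ### Singular values and the postsingular set -/

/-- Critical points (multiple poles included): points of the domain of definition near which `f`
is not injective. -/
def IsCriticalPoint (f : ℂ → Sphere) (X : Set Sphere) (c : Sphere) : Prop :=
  c ∈ X ∧ ¬ ∃ O ∈ 𝓝 c, InjOn (sphereMap f) O

/-- The critical values of the restriction of `f` to `U`. -/
def branchedValues (f : ℂ → Sphere) (X U : Set Sphere) : Set Sphere :=
  {v | ∃ c ∈ U, IsCriticalPoint f X c ∧ sphereMap f c = v}

/-- The critical values of `f`. -/
def criticalValues (f : ℂ → Sphere) (X : Set Sphere) : Set Sphere :=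
  branchedValues f X univ

/-- The asymptotic values of `f`: limits of `f` along curves that leave the domain of definition,
i.e. tend to `∞`. There are none if `f` is rational and regarded as a self-map of the sphere. -/
def asymptoticValues (f : ℂ → Sphere) (X : Set Sphere) : Set Sphere :=
  {a | OnePoint.infty ∉ X ∧ ∃ γ : ℝ → ℂ, Continuous γ ∧ Tendsto γ atTop (cocompact ℂ) ∧
    Tendsto (fun t => f (γ t)) atTop (𝓝 a)}

/-- The set `S(f)` of singular values. -/
def singularValues (f : ℂ → Sphere) (X : Set Sphere) : Set Sphere :=
  closure (criticalValues f X ∪ asymptoticValues f X)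

/-- The postsingular set `P(f)`. -/
def postsingularSet (f : ℂ → Sphere) (X : Set Sphere) : Set Sphere :=
  closure {y | ∃ s ∈ singularValues f X, ∃ n : ℕ,
    IterDefined f X n s ∧ (sphereMap f)^[n] s = y}

/-! ### Proper maps and their degree -/

/-- `g : U → V` is a proper map of degree at most `d`. For the holomorphic maps considered below,
the degree is the number of preimages of a generic point, which is the maximal number of preimages
of a point; and the proper maps are the branched coverings of finite degree. -/
def IsProperOfDegreeLE {Y Z : Type*} [TopologicalSpace Y] [TopologicalSpace Z]
    (g : Y → Z) (U : Set Y) (V : Set Z) (d : ℕ) : Prop :=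
  (∃ h : MapsTo g U V, IsProperMap (h.restrict g U V)) ∧
    ∀ y ∈ V, (U ∩ g ⁻¹' {y}).encard ≤ d

/-! ### The hyperbolic distance -/

/-- The infimum of the hyperbolic distances (in the upper half-plane, with curvature `-1`) between
points `a`, `b` that some holomorphic map from the half-plane to `Ω` sends to `z`, `w`. -/
noncomputable def halfPlaneDist (Ω : Set ℂ) (z w : ℂ) : ℝ≥0∞ :=
  ⨅ (φ : ℂ → ℂ) (_ : DifferentiableOn ℂ φ {ζ : ℂ | 0 < ζ.im})
    (_ : MapsTo φ {ζ : ℂ | 0 < ζ.im} Ω)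
    (a : UpperHalfPlane) (b : UpperHalfPlane) (_ : φ (a : ℂ) = z) (_ : φ (b : ℂ) = w), edist a b

/-- The hyperbolic distance of the open set `Ω ⊆ ℂ`, in Kobayashi's description: the largest
pseudodistance for which holomorphic maps from the hyperbolic plane to `Ω` do not increase
distances. It is the distance of the complete metric of curvature `-1` on each component of
`Ω` if `ℂ ∖ Ω` has at least two points (the covering maps from the hyperbolic plane are then
local isometries), and points in different components have distance `∞`. -/
noncomputable def hypDist (Ω : Set ℂ) (z w : ℂ) : ℝ≥0∞ :=
  ⨅ (n : ℕ) (p : ℕ → ℂ) (_ : p 0 = z) (_ : p n = w),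
    ∑ i ∈ Finset.range n, halfPlaneDist Ω (p i) (p (i + 1))

/-- The diameter `diam_Ω(A)` of `A ⊆ Ω` in the hyperbolic metric of `Ω`. -/
noncomputable def hypDiam (Ω A : Set ℂ) : ℝ≥0∞ :=
  ⨆ (z ∈ A) (w ∈ A), hypDist Ω z w

/-! ### The constants -/

/-- `C` is an admissible value of the constant `C(N, η)`: for every holomorphic proper map
`g : U → D_δ(z₀)` of degree at most `N` on a simply connected domain `U ⊆ ℂ`, the components of
`g⁻¹(D_{ηδ}(z₀))` have diameter at most `C` in the hyperbolic metric of `U`. -/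
def IsPreimageDiamBound (N : ℕ) (η : ℝ) (C : ℝ≥0) : Prop :=
  ∀ (z₀ : ℂ) (δ : ℝ) (U : Set ℂ) (g : ℂ → ℂ), 0 < δ → IsOpen U → IsSimplyConnected U →
    DifferentiableOn ℂ g U → IsProperOfDegreeLE g U (Metric.ball z₀ δ) N →
    ∀ A : Set ℂ, IsComponentOf A (U ∩ g ⁻¹' Metric.ball z₀ (η * δ)) → hypDiam U A ≤ C

/-- The smallest number of disks of radius `1/3` with centres in the unit disk that cover the unit
disk. -/
noncomputable def diskCoverNumber : ℕ :=
  sInf {n | ∃ s : Finset ℂ, s.card = n ∧ (s : Set ℂ) ⊆ Metric.ball 0 1 ∧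
    Metric.ball (0 : ℂ) 1 ⊆ ⋃ c ∈ s, Metric.ball c (1 / 3)}

/-- The constant `C₀ = N₀ · N · C`. -/
noncomputable def maneConst (N : ℕ) (C : ℝ≥0) : ℝ≥0 := diskCoverNumber * N * C

/-! ### Regular points and regular sets -/

/-- `z₀` is a `Δ`-regular point of `f`. -/
def IsRegularPoint (f : ℂ → Sphere) (X : Set Sphere) (Δ : ℕ) (z₀ : ℂ) : Prop :=
  ∃ δ : ℝ, 0 < δ ∧ ∀ (n : ℕ) (U : Set Sphere),
    IsComponentOf U (iterPreimage f X n (toSphere (Metric.ball z₀ δ))) →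
    (U ∩ postsingularSet f X).Nonempty →
    IsSimplyConnected U ∧
      IsProperOfDegreeLE ((sphereMap f)^[n]) U (toSphere (Metric.ball z₀ δ)) Δ

/-- `Ω` is an `(S₀, D)`-regular set of `f`, where `C` is the value of the constant `C(N, 2/3)`,
`N = D ^ #S₀`. -/
structure IsRegularSet (f : ℂ → Sphere) (X : Set Sphere) (S₀ : Finset Sphere) (D : ℕ)
    (C : ℝ≥0) (Ω : Set ℂ) : Prop where
  subset_criticalValues : (S₀ : Set Sphere) ⊆ criticalValues f X
  isOpen : IsOpen Ω
  nonempty : Ω.Nonempty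
  backward_invariant : iterPreimage f X 1 (toSphere Ω) ⊆ toSphere Ω
  controlled : ∀ V : Set ℂ, IsOpen V → IsSimplyConnected V → V ⊆ Ω →
    ∀ U : Set Sphere, IsComponentOf U (iterPreimage f X 1 (toSphere V)) →
    (∃ W : Set ℂ, W ⊆ Ω ∧ V ⊆ W ∧ hypDiam Ω W ≤ ↑(2 * maneConst (D ^ S₀.card) C) ∧
      ∃ E : Set Sphere, IsComponentOf E (iterPreimage f X 1 (toSphere W)) ∧ U ⊆ E ∧
        (E ∩ postsingularSet f X).Nonempty) →
    IsProperOfDegreeLE (sphereMap f) U (toSphere V) D ∧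
      (branchedValues f X U).Subsingleton ∧
      ∀ s ∈ branchedValues f X U, s ∈ S₀ ∧
        ∀ j : ℕ, IterDefined f X j s → (sphereMap f)^[j] s ∉ U

/-! The proof is a strong induction on `n`, made for all disks `D_δ(z₀)` with `D_{2δ}(z₀)` small at
once (`HasSmallPullbacks`). Suppose a component `V` of `f^{-(n+1)}(D_δ(z₀))` meets `P(f)`. Since
`P(f)` is forward invariant at finite points, the component `V₁` of `f^{-n}(D_δ(z₀))` that contains
`f(V)` meets `P(f)` too. By induction `V₁` is simply connected of diameter at most `C₀`, so
regularity applies to `f : V → V₁`, with `W = V₁`.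

Topology and degree. The map `f : V → V₁` is proper with at most one branched value. Without
branching it is a homeomorphism onto a simply connected set. With one branched value, a Riemann map
of `V₁` and the lifted radial flow of the disk contract `V` to a point
(`contractibleSpace_of_isLocalHomeomorphOn`). For the degree one carries along a set `T ⊆ S₀` of the
branched values already used, whose orbits avoid the current pullback. A new branched value lies in
`V₁`, hence is not in `T`. So each element of `S₀` costs a factor `D` at most once, and the degree
never exceeds `D ^ #T ≤ N` (`IsRegularSet.isControlledPreimage_succ`).

Diameter. The bound must not deteriorate with `n`, so it is obtained afresh from the degree. For `w`
in `D_δ(z₀)`, a component `V'` of the preimage of `D_{δ/2}(w)` that meets `V` is again simply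
connected, of degree at most `N`. To see this one pulls back step by step. If the current image of
`V'` misses `P(f)`, the next pullback is univalent. If it meets `P(f)`, the induction hypothesis
bounds its diameter by `C₀`, and its union with the image of `V` is a set `W` of diameter at most
`2C₀` whose preimage component contains a set meeting `P(f)`; this is why regularity is required for
sets `W` larger than the one being pulled back (`IsRegularSet.isControlledPreimage_half`). Now
`D_δ(z₀)` is covered by `N₀` disks of radius `δ/3`. Their pullbacks that are needed to cover `V`
number at most `N₀ · N`, and each has diameter at most `C(N, 2/3)`. As `V` is connected, its
diameter is at most `N₀ · N · C(N, 2/3) = C₀` (`hypDiam_le_maneConst`).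

Existence of `C(N, 2/3)`. After a Riemann map, `g` is a proper self-map of the disk. It is compared
with the Blaschke product over a small regular value, which shows that `|g| ≤ 2/3` only within a
bounded hyperbolic distance of at most `N` points (`exists_norm_diskAut_lt`).

Finally, `Ω` lies in the plane and is backward invariant, so no relevant orbit passes through `∞`,
and all arguments take place in the plane. -/

/-! ### The Riemann mapping theorem -/

section RiemannMapping

open Metric Complex

/-- Montel's theorem: along an ultrafilter, a uniformly bounded family of holomorphic functions
converges locally uniformly. -/
theorem exists_tendstoLocallyUniformlyOn_of_bounded {ι : Type*} {U : Set ℂ} (hU : IsOpen U)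
    {h : ι → ℂ → ℂ} (hd : ∀ n, DifferentiableOn ℂ (h n) U)
    (hm : ∀ n, MapsTo (h n) U (ball 0 1)) (𝒰 : Ultrafilter ι) :
    ∃ H : ℂ → ℂ, TendstoLocallyUniformlyOn h H (𝒰 : Filter ι) U := by
  have hlim : ∀ z ∈ U, ∃ w, Tendsto (fun n => h n z) 𝒰 (𝓝 w) := fun z hz => by
    obtain ⟨w, -, hw⟩ := (isCompact_closedBall (0 : ℂ) 1).ultrafilter_le_nhds
      (𝒰.map fun n => h n z) (le_principal_iff.2 (mem_map.2
        (Eventually.of_forall fun n : ι => ball_subset_closedBall (hm n hz))))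
    exact ⟨w, hw⟩
  choose! H hH using hlim
  refine ⟨H, Metric.tendstoLocallyUniformlyOn_iff.2 fun ε hε x hx => ?_⟩
  obtain ⟨r, hr, hrU⟩ := Metric.isOpen_iff.1 hU x hx
  -- The Schwarz lemma gives a Lipschitz constant near `x` that does not depend on `n`;
  -- equicontinuity then upgrades pointwise convergence along the ultrafilter to locally uniform
  -- convergence.
  have hlip : ∀ n, ∀ y ∈ ball x r, dist (h n y) (h n x) ≤ 2 / r * dist y x := fun n y hy =>
    dist_le_div_mul_dist_of_mapsTo_ball ((hd n).mono hrU) (fun z hz => by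
      have h1 := mem_ball_zero_iff.1 (hm n (hrU hz))
      have h2 := mem_ball_zero_iff.1 (hm n hx)
      rw [mem_closedBall, dist_eq_norm]
      exact (norm_sub_le _ _).trans (by linarith)) hy
  have hlipH : ∀ y ∈ ball x r, dist (H y) (H x) ≤ 2 / r * dist y x := fun y hy =>
    le_of_tendsto ((hH y (hrU hy)).dist (hH x hx)) (Eventually.of_forall fun n => hlip n y hy)
  have hs : 0 < min r (ε * r / 6) := by positivity
  refine ⟨ball x (min r (ε * r / 6)), mem_nhdsWithin_of_mem_nhds (ball_mem_nhds x hs), ?_⟩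
  filter_upwards [Metric.tendsto_nhds.1 (hH x hx) (ε / 3) (by positivity)] with n hn y hy
  have hyr : y ∈ ball x r := ball_subset_ball (min_le_left _ _) hy
  have h3 : 2 / r * dist y x < ε / 3 := by
    have : dist y x < ε * r / 6 := (mem_ball.1 hy).trans_le (min_le_right _ _)
    calc 2 / r * dist y x < 2 / r * (ε * r / 6) := by gcongr
      _ = ε / 3 := by field_simp; norm_num
  have h1 := hlip n y hyr
  have h2 := hlipH y hyr
  have h4 := dist_triangle4 (H y) (H x) (h n x) (h n y)
  rw [dist_comm (H x), dist_comm (h n x) (h n y)] at h4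
  linarith

/-- Hurwitz's theorem: a nonconstant locally uniform limit of injective holomorphic functions is
injective. -/
theorem injOn_of_tendstoLocallyUniformlyOn {ι : Type*} {l : Filter ι} [l.NeBot] {U : Set ℂ}
    (hU : IsOpen U) (hUc : IsPreconnected U) {h : ι → ℂ → ℂ} {H : ℂ → ℂ}
    (hlim : TendstoLocallyUniformlyOn h H l U) (hd : ∀ n, DifferentiableOn ℂ (h n) U)
    (hinj : ∀ n, InjOn (h n) U) {a b : ℂ} (ha : a ∈ U) (hb : b ∈ U) (hab : H a ≠ H b) :
    InjOn H U := by
  intro p hp q hq hpq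
  by_contra hne
  have hHd : DifferentiableOn ℂ H U := hlim.differentiableOn (Eventually.of_forall hd) hU
  have hHa : AnalyticOnNhd ℂ H U := hHd.analyticOnNhd hU
  rcases (hHa q hq).eventually_eq_or_eventually_ne (analyticAt_const (v := H q)) with hc | hc
  · have := hHa.eqOn_of_preconnected_of_eventuallyEq analyticOnNhd_const hUc hq hc
    exact hab ((this ha).trans (this hb).symm)
  · have hev : ∀ᶠ z in 𝓝 q, (z ≠ q → H z ≠ H q) ∧ z ∈ U ∧ z ≠ p :=
      (eventually_nhdsWithin_iff.1 hc).and ((hU.eventually_mem hq).and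
        (isOpen_ne.eventually_mem (Ne.symm hne)))
    obtain ⟨r, hr, hrs⟩ := Metric.eventually_nhds_iff_ball.1 hev
    have hcb : closedBall q (r / 2) ⊆ ball q r := closedBall_subset_ball (by linarith)
    obtain ⟨z₁, hz₁, hmin⟩ := (isCompact_sphere q (r / 2)).exists_isMinOn
      (NormedSpace.sphere_nonempty.2 (by positivity)) (f := fun z => ‖H z - H q‖)
      ((hHd.continuousOn.mono fun z hz =>
        (hrs z (hcb (sphere_subset_closedBall hz))).2.1).sub continuousOn_const).norm
    set ε := ‖H z₁ - H q‖ with hε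
    have hε0 : 0 < ε := by
      rw [hε, norm_pos_iff, sub_ne_zero]
      refine (hrs z₁ (hcb (sphere_subset_closedBall hz₁))).1 ?_
      rintro rfl
      simp at hz₁; linarith
    have hK : IsCompact (insert p (closedBall q (r / 2))) :=
      (isCompact_closedBall q (r / 2)).insert p
    have hKU : insert p (closedBall q (r / 2)) ⊆ U :=
      insert_subset hp fun z hz => (hrs z (hcb hz)).2.1
    have hun := (tendstoLocallyUniformlyOn_iff_forall_isCompact hU).1 hlim _ hKU hK
    obtain ⟨n, hn⟩ := (Metric.tendstoUniformlyOn_iff.1 hun (ε / 8) (by positivity)).exists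
    have hqn := hn q (mem_insert_of_mem _ (mem_closedBall_self (by positivity)))
    have hpn := hn p (mem_insert _ _)
    -- On the circle `|H - H q| ≥ ε`, and the two errors of `ε / 8` leave `|h n - h n q| ≥ 3ε/4`;
    -- the quantitative open mapping theorem gives a disk of radius `3ε/8`. As `H p = H q`, the
    -- value `h n p` lies in it, so it is also taken near `q`, away from `p`.
    have hsub : ball (h n q) (3 * ε / 4 / 2) ⊆ h n '' closedBall q (r / 2) := by
      refine DiffContOnCl.ball_subset_image_closedBall (DifferentiableOn.diffContOnCl ?_)
        (by positivity) (fun z hz => ?_) ?_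
      · rw [closure_ball _ (by positivity)]
        exact (hd n).mono fun z hz => (hrs z (hcb hz)).2.1
      · have h1 := hn z (mem_insert_of_mem _ (sphere_subset_closedBall hz))
        have h2 : ε ≤ ‖H z - H q‖ := hmin hz
        rw [dist_eq_norm] at h1 hqn
        have h3 : H z - H q = (H z - h n z) + (h n z - h n q) - (H q - h n q) := by ring
        have h4 := norm_sub_le ((H z - h n z) + (h n z - h n q)) (H q - h n q)
        have h5 := norm_add_le (H z - h n z) (h n z - h n q)
        rw [h3] at h2
        linarith
      · have : ∀ᶠ z in 𝓝[≠] q, h n z ≠ h n q := by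
          filter_upwards [self_mem_nhdsWithin, nhdsWithin_le_nhds (hU.mem_nhds hq)] with z hz hzU
          exact fun h' => hz (hinj n hzU hq h')
        exact this.frequently.filter_mono nhdsWithin_le_nhds
    have hmem : h n p ∈ ball (h n q) (3 * ε / 4 / 2) := by
      rw [dist_comm] at hpn
      have := dist_triangle (h n p) (H p) (h n q)
      rw [hpq] at this hpn
      rw [mem_ball]
      linarith
    obtain ⟨y, hy, hyp⟩ := hsub hmem
    exact (hrs y (hcb hy)).2.2 (hinj n (hKU (mem_insert_of_mem _ hy)) hp hyp)

/-- The disk automorphism `z ↦ (z - a) / (1 - conj a * z)`. -/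
noncomputable def diskAut (a z : ℂ) : ℂ := (z - a) / (1 - (starRingEnd ℂ) a * z)

theorem one_sub_conj_mul_ne_zero {a z : ℂ} (ha : a ∈ ball (0 : ℂ) 1) (hz : z ∈ ball (0 : ℂ) 1) :
    1 - (starRingEnd ℂ) a * z ≠ 0 := by
  rw [mem_ball_zero_iff] at ha hz
  intro h
  have h1 : ‖(starRingEnd ℂ) a * z‖ = 1 := by rw [← sub_eq_zero.1 h, norm_one]
  rw [norm_mul, RCLike.norm_conj] at h1
  nlinarith [norm_nonneg a, norm_nonneg z]

theorem one_sub_norm_diskAut_sq {a z : ℂ} (h : 1 - (starRingEnd ℂ) a * z ≠ 0) :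
    1 - ‖diskAut a z‖ ^ 2 =
      (1 - ‖a‖ ^ 2) * (1 - ‖z‖ ^ 2) / ‖1 - (starRingEnd ℂ) a * z‖ ^ 2 := by
  have h0 : ‖1 - (starRingEnd ℂ) a * z‖ ^ 2 ≠ 0 := by positivity
  rw [diskAut, norm_div, div_pow, eq_div_iff h0, sub_mul, div_mul_cancel₀ _ h0]
  simp only [← Complex.normSq_eq_norm_sq, Complex.normSq_apply]
  simp
  ring

theorem diskAut_mem_ball {a z : ℂ} (ha : a ∈ ball (0 : ℂ) 1) (hz : z ∈ ball (0 : ℂ) 1) :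
    diskAut a z ∈ ball (0 : ℂ) 1 := by
  have h := one_sub_conj_mul_ne_zero ha hz
  have h1 := one_sub_norm_diskAut_sq h
  rw [mem_ball_zero_iff] at *
  have h2 : 0 < 1 - ‖diskAut a z‖ ^ 2 := by
    rw [h1]
    have : 0 < ‖1 - (starRingEnd ℂ) a * z‖ := norm_pos_iff.2 h
    have h3 : 0 < 1 - ‖a‖ ^ 2 := by nlinarith [norm_nonneg a]
    have h4 : 0 < 1 - ‖z‖ ^ 2 := by nlinarith [norm_nonneg z]
    positivity
  nlinarith [norm_nonneg (diskAut a z)]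

theorem diskAut_neg_diskAut {a z : ℂ} (ha : a ∈ ball (0 : ℂ) 1) (hz : z ∈ ball (0 : ℂ) 1) :
    diskAut (-a) (diskAut a z) = z := by
  have h := one_sub_conj_mul_ne_zero ha hz
  have h' := one_sub_conj_mul_ne_zero ha ha
  rw [diskAut, diskAut, map_neg]
  generalize (starRingEnd ℂ) a = c at h h'
  have h2 : 1 - -c * ((z - a) / (1 - c * z)) = (1 - c * a) / (1 - c * z) := by
    rw [eq_div_iff h, sub_mul, mul_assoc, div_mul_cancel₀ _ h]
    ring
  have h3 : (z - a) / (1 - c * z) - -a = z * (1 - c * a) / (1 - c * z) := by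
    rw [eq_div_iff h, sub_mul, div_mul_cancel₀ _ h]
    ring
  rw [h2, h3, div_div_div_cancel_right₀ h, mul_div_cancel_right₀ _ h']

theorem neg_mem_unitBall {a : ℂ} (ha : a ∈ ball (0 : ℂ) 1) : -a ∈ ball (0 : ℂ) 1 := by
  simpa using ha

theorem diskAut_diskAut_neg {a z : ℂ} (ha : a ∈ ball (0 : ℂ) 1) (hz : z ∈ ball (0 : ℂ) 1) :
    diskAut a (diskAut (-a) z) = z := by
  simpa using diskAut_neg_diskAut (neg_mem_unitBall ha) hz

theorem diskAut_injOn {a : ℂ} (ha : a ∈ ball (0 : ℂ) 1) : InjOn (diskAut a) (ball 0 1) :=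
  fun x hx y hy h => by
    rw [← diskAut_neg_diskAut ha hx, h, diskAut_neg_diskAut ha hy]

theorem differentiableOn_diskAut {a : ℂ} (ha : a ∈ ball (0 : ℂ) 1) :
    DifferentiableOn ℂ (diskAut a) (ball 0 1) := fun z hz => by
  have h := one_sub_conj_mul_ne_zero ha hz
  unfold diskAut
  exact DifferentiableAt.differentiableWithinAt (by fun_prop (disch := exact h))

@[simp] theorem diskAut_self (a : ℂ) : diskAut a a = 0 := by simp [diskAut]

theorem diskAut_eq_zero_iff {a z : ℂ} (ha : a ∈ ball (0 : ℂ) 1) (hz : z ∈ ball (0 : ℂ) 1) :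
    diskAut a z = 0 ↔ z = a := by
  rw [diskAut, div_eq_zero_iff, or_iff_left (one_sub_conj_mul_ne_zero ha hz), sub_eq_zero]

/-- A continuous square root of a nonvanishing holomorphic function is holomorphic. -/
theorem differentiableOn_of_sq {U : Set ℂ} (hU : IsOpen U) {s k : ℂ → ℂ}
    (hk : DifferentiableOn ℂ k U) (hs : ContinuousOn s U) (hsk : ∀ z ∈ U, s z ^ 2 = k z)
    (h0 : ∀ z ∈ U, k z ≠ 0) : DifferentiableOn ℂ s U := fun z hz => by
  have hkz := (hk.differentiableAt (hU.mem_nhds hz)).hasDerivAt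
  have hs0 : s z ≠ 0 := fun h => h0 z hz (by rw [← hsk z hz, h]; simp)
  have hsc : Tendsto s (𝓝[≠] z) (𝓝 (s z)) :=
    (hs.continuousAt (hU.mem_nhds hz)).tendsto.mono_left nhdsWithin_le_nhds
  have h2 : s z + s z ≠ 0 := by simpa [← two_mul] using hs0
  refine (DifferentiableAt.differentiableWithinAt
    (HasDerivAt.differentiableAt (f' := deriv k z / (s z + s z)) ?_))
  rw [hasDerivAt_iff_tendsto_slope] at hkz ⊢
  have hsum : Tendsto (fun w => s w + s z) (𝓝[≠] z) (𝓝 (s z + s z)) := hsc.add_const _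
  refine (hkz.div hsum h2).congr' ?_
  filter_upwards [nhdsWithin_le_nhds (hU.mem_nhds hz), hsum.eventually_ne h2] with w hw hne
  rw [Pi.div_apply, slope_def_field, slope_def_field, ← hsk w hw, ← hsk z hz, div_eq_iff hne]
  ring

/-- The inverse of an injective holomorphic function is holomorphic. -/
theorem differentiableOn_of_leftInvOn {U V : Set ℂ} (hU : IsOpen U) (hV : IsOpen V) {φ ψ : ℂ → ℂ}
    (hφ : DifferentiableOn ℂ φ U) (hψ : MapsTo ψ V U) (h1 : ∀ z ∈ U, ψ (φ z) = z)
    (h2 : ∀ w ∈ V, φ (ψ w) = w) : DifferentiableOn ℂ ψ V := by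
  have hφa := hφ.analyticOnNhd hU
  have hinj : InjOn φ U := fun x hx y hy h => by rw [← h1 x hx, h, h1 y hy]
  have hnc : ∀ z ∈ U, ¬ ∀ᶠ w in 𝓝 z, φ w = φ z := fun z hz h => by
    have : ∀ᶠ w in 𝓝[≠] z, False := by
      filter_upwards [nhdsWithin_le_nhds h, nhdsWithin_le_nhds (hU.mem_nhds hz),
        self_mem_nhdsWithin] with w hw hwU hne
      exact hne (hinj hwU hz hw)
    exact this.exists.elim fun _ h => h
  have hcont : ∀ w ∈ V, ContinuousAt ψ w := fun w hw => by
    have hopen := ((hφa _ (hψ hw)).eventually_constant_or_nhds_le_map_nhds).resolve_left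
      (hnc _ (hψ hw))
    rw [h2 w hw] at hopen
    intro N hN
    have := hopen (image_mem_map (inter_mem hN (hU.mem_nhds (hψ hw))))
    rw [mem_map]
    filter_upwards [this] with x hx
    obtain ⟨y, ⟨hyN, hyU⟩, rfl⟩ := hx
    rwa [mem_preimage, h1 y hyU]
  have hder : ∀ w ∈ V, deriv φ (ψ w) ≠ 0 → DifferentiableAt ℂ ψ w := fun w hw hd =>
    (HasDerivAt.of_local_left_inverse (hcont w hw)
      (hφ.differentiableAt (hU.mem_nhds (hψ hw))).hasDerivAt hd
      (by filter_upwards [hV.mem_nhds hw] with x hx using h2 x hx)).differentiableAt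
  intro w hw
  -- The zeros of `φ'` are isolated, since `φ` is not locally constant. So `ψ` is continuous, and
  -- differentiable off isolated points, which are removable singularities.
  refine (Complex.analyticAt_of_differentiable_on_punctured_nhds_of_continuousAt ?_
    (hcont w hw)).differentiableAt.differentiableWithinAt
  rcases ((hφa _ (hψ hw)).deriv).eventually_eq_zero_or_eventually_ne_zero with h | h
  · refine absurd ?_ (hnc _ (hψ hw))
    obtain ⟨r, hr, hb⟩ := Metric.eventually_nhds_iff_ball.1
      (h.and (hU.eventually_mem (hψ hw)))
    filter_upwards [ball_mem_nhds _ hr] with y hy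
    exact (convex_ball (ψ w) r).is_const_of_fderivWithin_eq_zero (𝕜 := ℂ)
      (hφ.mono fun x hx => (hb x hx).2)
      (fun x hx => by
        rw [fderivWithin_of_isOpen isOpen_ball hx]
        ext
        simpa using (hb x hx).1) hy (mem_ball_self hr)
  · have ht : Tendsto ψ (𝓝[≠] w) (𝓝[≠] (ψ w)) := by
      refine tendsto_nhdsWithin_iff.2 ⟨(hcont w hw).tendsto.mono_left nhdsWithin_le_nhds, ?_⟩
      filter_upwards [nhdsWithin_le_nhds (hV.mem_nhds hw), self_mem_nhdsWithin] with x hx hne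
      exact fun h' => hne (by rw [mem_singleton_iff, ← h2 x hx, h', h2 w hw])
    filter_upwards [ht.eventually h, nhdsWithin_le_nhds (hV.mem_nhds hw)] with x hx hxV
    exact hder x hxV hx

/-- The square root trick: an injective holomorphic map to the disk that is not onto can be
replaced by one that moves `z₁` further away from `0`. -/
theorem exists_norm_lt_of_not_surjOn {U : Set ℂ} (hU : IsOpen U) (hUc : IsSimplyConnected U)
    {h : ℂ → ℂ} (hd : DifferentiableOn ℂ h U) (hm : MapsTo h U (ball 0 1)) (hi : InjOn h U)
    {z₀ z₁ a : ℂ} (hz₀ : z₀ ∈ U) (hz₁ : z₁ ∈ U) (hne : z₁ ≠ z₀) (h0 : h z₀ = 0)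
    (ha : a ∈ ball (0 : ℂ) 1) (haU : a ∉ h '' U) :
    ∃ F : ℂ → ℂ, DifferentiableOn ℂ F U ∧ MapsTo F U (ball 0 1) ∧ InjOn F U ∧ F z₀ = 0 ∧
      ‖h z₁‖ < ‖F z₁‖ := by
  set k : ℂ → ℂ := fun z => diskAut a (h z) with hk
  have hkd : DifferentiableOn ℂ k U := (differentiableOn_diskAut ha).comp hd hm
  have hk0 : ∀ z ∈ U, k z ≠ 0 := fun z hz h' =>
    haU ⟨z, hz, (diskAut_eq_zero_iff ha (hm hz)).1 h'⟩
  obtain ⟨s, hsc, hs⟩ := Complex.exists_continuousOn_pow_eq hUc hU hkd.continuousOn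
    (by rintro ⟨z, hz, h'⟩; exact hk0 z hz h') two_ne_zero
  have hsd : DifferentiableOn ℂ s U := differentiableOn_of_sq hU hkd hsc (fun z _ => hs z) hk0
  have hsm : MapsTo s U (ball 0 1) := fun z hz => by
    have := diskAut_mem_ball ha (hm hz)
    rw [mem_ball_zero_iff] at this ⊢
    change ‖k z‖ < 1 at this
    rw [← hs z, norm_pow] at this
    exact (pow_lt_one_iff_of_nonneg (norm_nonneg _) two_ne_zero).1 this
  have hsi : InjOn s U := fun x hx y hy h' => by
    have : k x = k y := by rw [← hs x, ← hs y, h']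
    exact hi hx hy (diskAut_injOn ha (hm hx) (hm hy) this)
  set c := s z₀ with hc
  have hcb : c ∈ ball (0 : ℂ) 1 := hsm hz₀
  have hca : c ^ 2 = -a := by
    rw [hc, hs z₀, hk]
    simp [h0, diskAut]
  refine ⟨fun z => diskAut c (s z), (differentiableOn_diskAut hcb).comp hsd hsm,
    fun z hz => diskAut_mem_ball hcb (hsm hz), (diskAut_injOn hcb).comp hsi hsm, diskAut_self c, ?_⟩
  have hF0 : diskAut c (s z₁) ≠ 0 := fun h' =>
    hne (hsi hz₁ hz₀ ((diskAut_eq_zero_iff hcb (hsm hz₁)).1 h'))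
  -- Since `c ^ 2 = -a`, the map `u ↦ diskAut (-a) (u ^ 2)` that recovers `h` from its square root
  -- `s` factors as a Blaschke product with zeros `c` and `-c`.
  have hfac : h z₁ = diskAut c (s z₁) * diskAut (-c) (s z₁) := by
    have e1 : h z₁ = diskAut (-a) (k z₁) := (diskAut_neg_diskAut ha (hm hz₁)).symm
    have n1 := one_sub_conj_mul_ne_zero hcb (hsm hz₁)
    have n2 := one_sub_conj_mul_ne_zero (neg_mem_unitBall hcb) (hsm hz₁)
    rw [e1, ← hs z₁, ← hca, diskAut, diskAut, diskAut, div_mul_div_comm, map_pow]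
    rw [map_neg] at n2 ⊢
    congr 1 <;> ring
  rw [hfac, norm_mul]
  have := diskAut_mem_ball (neg_mem_unitBall hcb) (hsm hz₁)
  rw [mem_ball_zero_iff] at this
  exact mul_lt_of_lt_one_right (norm_pos_iff.2 hF0) this

/-- A simply connected proper open subset of the plane admits an injective holomorphic map to the
unit disk. -/
theorem exists_injOn_mapsTo_unitBall {U : Set ℂ} (hU : IsOpen U) (hUc : IsSimplyConnected U)
    (hne : U ≠ univ) :
    ∃ f : ℂ → ℂ, DifferentiableOn ℂ f U ∧ MapsTo f U (ball 0 1) ∧ InjOn f U := by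
  obtain ⟨a, ha⟩ := (ne_univ_iff_exists_notMem U).1 hne
  have hk0 : ∀ z ∈ U, z - a ≠ 0 := fun z hz h => ha (by rwa [← sub_eq_zero.1 h])
  obtain ⟨s, hsc, hs⟩ := Complex.exists_continuousOn_pow_eq hUc hU
    (g := fun z => z - a) (by fun_prop) (by rintro ⟨z, hz, h⟩; exact hk0 z hz h) two_ne_zero
  have hsd : DifferentiableOn ℂ s U :=
    differentiableOn_of_sq hU (by fun_prop) hsc (fun z _ => hs z) hk0
  have hsi : ∀ x y, s x ^ 2 = s y ^ 2 → x = y := fun x y h => by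
    rw [hs, hs] at h; exact sub_left_inj.1 h
  obtain ⟨x, hx⟩ := hUc.nonempty
  have hopen : IsOpen (s '' U) := by
    rcases (hsd.analyticOnNhd hU).is_constant_or_isOpen
      hUc.isPathConnected.isConnected.isPreconnected with ⟨w, hw⟩ | ho
    · exfalso
      have : ∀ᶠ z in 𝓝[≠] x, z ∈ U ∧ z ≠ x :=
        (eventually_nhdsWithin_of_eventually_nhds (hU.eventually_mem hx)).and self_mem_nhdsWithin
      obtain ⟨z, hz, hzx⟩ := this.exists
      exact hzx (hsi z x (by rw [hw z hz, hw x hx]))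
    · exact ho U subset_rfl hU
  obtain ⟨ε, hε, hb⟩ := Metric.isOpen_iff.1 hopen _ (mem_image_of_mem s hx)
  -- The function `s` never takes both `w` and `-w`, because `s ^ 2` is injective and has no zeros.
  -- As the image contains a disk about `s x`, it omits the opposite disk about `-s x`.
  have hfar : ∀ z ∈ U, ε ≤ ‖s z + s x‖ := fun z hz => by
    by_contra! h
    have : -s z ∈ ball (s x) ε := by
      rwa [mem_ball, dist_eq_norm, ← norm_neg, show -(-s z - s x) = s z + s x by ring]
    obtain ⟨y, hy, hyz⟩ := hb this
    obtain rfl : y = z := hsi y z (by rw [hyz]; ring)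
    have h0 : s y = 0 := by
      have : s y + s y = 0 := by nth_rewrite 1 [hyz]; ring
      simpa [← two_mul] using this
    exact hk0 y hy (by rw [← hs y, h0]; ring)
  have hne0 : ∀ z ∈ U, s z + s x ≠ 0 := fun z hz => norm_pos_iff.1 (hε.trans_le (hfar z hz))
  refine ⟨fun z => (ε / 2 : ℝ) / (s z + s x), fun z hz => ?_, fun z hz => ?_, ?_⟩
  · exact (differentiableWithinAt_const _).div ((hsd z hz).add_const _) (hne0 z hz)
  · rw [mem_ball_zero_iff, norm_div, div_lt_one (norm_pos_iff.2 (hne0 z hz)),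
      Complex.norm_real, Real.norm_of_nonneg (by positivity)]
    exact (by linarith : ε / 2 < ε).trans_le (hfar z hz)
  · intro z hz w hw h
    have hc : ((ε / 2 : ℝ) : ℂ) ≠ 0 := by exact_mod_cast (by positivity : ε / 2 ≠ 0)
    have h' := (div_eq_div_iff (hne0 z hz) (hne0 w hw)).1 h
    exact hsi z w (by rw [← add_right_cancel (mul_left_cancel₀ hc h')])

/-- The Riemann mapping theorem. -/
theorem exists_riemannMap {U : Set ℂ} (hU : IsOpen U) (hUc : IsSimplyConnected U)
    (hne : U ≠ univ) {z₀ : ℂ} (hz₀ : z₀ ∈ U) :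
    ∃ φ ψ : ℂ → ℂ, DifferentiableOn ℂ φ U ∧ MapsTo φ U (ball 0 1) ∧
      DifferentiableOn ℂ ψ (ball 0 1) ∧ MapsTo ψ (ball 0 1) U ∧ (∀ z ∈ U, ψ (φ z) = z) ∧
      (∀ w ∈ ball (0 : ℂ) 1, φ (ψ w) = w) ∧ φ z₀ = 0 := by
  set 𝓕 : Set (ℂ → ℂ) := {h | DifferentiableOn ℂ h U ∧ MapsTo h U (ball 0 1) ∧ InjOn h U ∧
    h z₀ = 0} with h𝓕
  obtain ⟨f₀, hf₀⟩ : 𝓕.Nonempty := by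
    obtain ⟨f, hfd, hfm, hfi⟩ := exists_injOn_mapsTo_unitBall hU hUc hne
    have hfb := hfm hz₀
    exact ⟨fun z => diskAut (f z₀) (f z), (differentiableOn_diskAut hfb).comp hfd hfm,
      fun z hz => diskAut_mem_ball hfb (hfm hz), (diskAut_injOn hfb).comp hfi hfm,
      diskAut_self _⟩
  obtain ⟨z₁, hz₁, hz₁₀⟩ : ∃ z₁ ∈ U, z₁ ≠ z₀ := by
    have : ∀ᶠ z in 𝓝[≠] z₀, z ∈ U ∧ z ≠ z₀ :=
      (eventually_nhdsWithin_of_eventually_nhds (hU.eventually_mem hz₀)).and self_mem_nhdsWithin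
    exact this.exists
  -- The extremal problem maximises `|h z₁|` at a second point instead of `|h' z₀|`. A positive
  -- maximum also shows at once that the limit function is not constant.
  set S : Set ℝ := (fun h : ℂ → ℂ => ‖h z₁‖) '' 𝓕 with hS
  have hSne : S.Nonempty := ⟨_, f₀, hf₀, rfl⟩
  have hSb : BddAbove S := ⟨1, by
    rintro _ ⟨h, hh, rfl⟩
    exact (mem_ball_zero_iff.1 (hh.2.1 hz₁)).le⟩
  obtain ⟨u, -, hulim, huS⟩ := exists_seq_tendsto_sSup hSne hSb
  choose h hh hhu using huS
  obtain ⟨H, hH⟩ := exists_tendstoLocallyUniformlyOn_of_bounded hU (fun n => (hh n).1)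
    (fun n => (hh n).2.1) (Ultrafilter.of atTop)
  have hpt : ∀ z ∈ U, Tendsto (fun n => h n z) ((Ultrafilter.of atTop : Ultrafilter ℕ) : Filter ℕ)
      (𝓝 (H z)) :=
    fun z hz => TendstoLocallyUniformlyOn.tendsto_at hH hz
  have hH0 : H z₀ = 0 := tendsto_nhds_unique (hpt z₀ hz₀)
    (by simp only [(hh _).2.2.2]; exact tendsto_const_nhds)
  have hH1 : ‖H z₁‖ = sSup S := tendsto_nhds_unique (hpt z₁ hz₁).norm
    ((hulim.congr fun n => (hhu n).symm).mono_left (Ultrafilter.of_le _))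
  have hpos : 0 < ‖H z₁‖ := by
    rw [hH1]
    refine (norm_pos_iff.2 fun h' => hz₁₀ ?_).trans_le (le_csSup hSb ⟨f₀, hf₀, rfl⟩)
    exact hf₀.2.2.1 hz₁ hz₀ (h'.trans hf₀.2.2.2.symm)
  have hHd : DifferentiableOn ℂ H U :=
    hH.differentiableOn (Eventually.of_forall fun n => (hh n).1) hU
  have hUpc : IsPreconnected U := hUc.isPathConnected.isConnected.isPreconnected
  have hHi : InjOn H U := injOn_of_tendstoLocallyUniformlyOn hU hUpc hH (fun n => (hh n).1)
    (fun n => (hh n).2.2.1) hz₁ hz₀ (by rw [hH0]; exact norm_pos_iff.1 hpos)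
  have hHle : ∀ z ∈ U, ‖H z‖ ≤ 1 := fun z hz => le_of_tendsto (hpt z hz).norm
    (Eventually.of_forall fun n => (mem_ball_zero_iff.1 ((hh n).2.1 hz)).le)
  have hHm : MapsTo H U (ball 0 1) := fun z hz => by
    rcases (hHd.analyticOnNhd hU).is_constant_or_isOpen hUpc with ⟨w, hw⟩ | ho
    · exact absurd ((hw z₁ hz₁).trans (hw z₀ hz₀).symm) fun h' => hz₁₀ (hHi hz₁ hz₀ h')
    · have h1 : H '' U ⊆ interior (closedBall 0 1) :=
        interior_maximal (by rintro _ ⟨x, hx, rfl⟩; simpa using hHle x hx) (ho U subset_rfl hU)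
      rw [interior_closedBall _ one_ne_zero] at h1
      exact h1 (mem_image_of_mem H hz)
  have hHs : SurjOn H U (ball 0 1) := by
    by_contra hns
    obtain ⟨a, ha, haU⟩ := not_subset.1 hns
    obtain ⟨F, hF1, hF2, hF3, hF4, hF5⟩ :=
      exists_norm_lt_of_not_surjOn hU hUc hHd hHm hHi hz₀ hz₁ hz₁₀ hH0 ha haU
    exact (hF5.trans_le (le_csSup hSb ⟨F, ⟨hF1, hF2, hF3, hF4⟩, rfl⟩)).ne hH1
  have hbij : BijOn H U (ball 0 1) := ⟨hHm, hHi, hHs⟩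
  have hinv := hbij.invOn_invFunOn
  have hψm : MapsTo (Function.invFunOn H U) (ball 0 1) U := hHs.mapsTo_invFunOn
  exact ⟨H, Function.invFunOn H U, hHd, hHm,
    differentiableOn_of_leftInvOn hU isOpen_ball hHd hψm (fun z hz => hinv.1 hz)
      (fun w hw => hinv.2 hw), hψm, fun z hz => hinv.1 hz, fun w hw => hinv.2 hw, hH0⟩

end RiemannMapping

/-! ### The hyperbolic distance -/

section Hyperbolic

open Metric

theorem halfPlaneDist_le_swap (Ω : Set ℂ) (z w : ℂ) :
    halfPlaneDist Ω z w ≤ halfPlaneDist Ω w z := by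
  refine le_iInf fun φ => le_iInf fun hd => le_iInf fun hm => le_iInf fun a => le_iInf fun b =>
    le_iInf fun ha => le_iInf fun hb => ?_
  rw [edist_comm]
  exact iInf_le_of_le φ <| iInf_le_of_le hd <| iInf_le_of_le hm <| iInf_le_of_le b <|
    iInf_le_of_le a <| iInf_le_of_le hb <| iInf_le_of_le ha le_rfl

theorem halfPlaneDist_comm (Ω : Set ℂ) (z w : ℂ) : halfPlaneDist Ω z w = halfPlaneDist Ω w z :=
  le_antisymm (halfPlaneDist_le_swap Ω z w) (halfPlaneDist_le_swap Ω w z)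

theorem halfPlaneDist_anti {Ω Ω' : Set ℂ} (h : Ω ⊆ Ω') (z w : ℂ) :
    halfPlaneDist Ω' z w ≤ halfPlaneDist Ω z w :=
  le_iInf fun φ => le_iInf fun hd => le_iInf fun hm => iInf_le_of_le φ <| iInf_le_of_le hd <|
    iInf_le_of_le (hm.mono_right h) le_rfl

theorem hypDist_le_sum {Ω : Set ℂ} {z w : ℂ} (n : ℕ) (p : ℕ → ℂ) (h0 : p 0 = z) (hn : p n = w) :
    hypDist Ω z w ≤ ∑ i ∈ Finset.range n, halfPlaneDist Ω (p i) (p (i + 1)) :=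
  iInf_le_of_le n <| iInf_le_of_le p <| iInf_le_of_le h0 <| iInf_le_of_le hn le_rfl

theorem hypDist_le_halfPlaneDist (Ω : Set ℂ) (z w : ℂ) : hypDist Ω z w ≤ halfPlaneDist Ω z w := by
  simpa using hypDist_le_sum (Ω := Ω) 1 (fun i => if i = 0 then z else w) rfl rfl

theorem hypDist_anti {Ω Ω' : Set ℂ} (h : Ω ⊆ Ω') (z w : ℂ) : hypDist Ω' z w ≤ hypDist Ω z w :=
  le_iInf fun n => le_iInf fun p => le_iInf fun h0 => le_iInf fun hn =>
    (hypDist_le_sum n p h0 hn).trans (Finset.sum_le_sum fun _ _ => halfPlaneDist_anti h _ _)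

theorem hypDist_le_swap (Ω : Set ℂ) (z w : ℂ) : hypDist Ω z w ≤ hypDist Ω w z := by
  refine le_iInf fun n => le_iInf fun p => le_iInf fun h0 => le_iInf fun hn => ?_
  refine (hypDist_le_sum n (fun i => p (n - i)) (by simpa using hn) (by simpa using h0)).trans ?_
  rw [← Finset.sum_range_reflect]
  refine (Finset.sum_congr rfl fun i hi => ?_).le
  have := Finset.mem_range.1 hi
  rw [halfPlaneDist_comm]
  congr 2 <;> omega

theorem hypDist_comm (Ω : Set ℂ) (z w : ℂ) : hypDist Ω z w = hypDist Ω w z :=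
  le_antisymm (hypDist_le_swap Ω z w) (hypDist_le_swap Ω w z)

theorem hypDist_triangle (Ω : Set ℂ) (x y z : ℂ) :
    hypDist Ω x z ≤ hypDist Ω x y + hypDist Ω y z := by
  conv_rhs => unfold hypDist
  simp only [ENNReal.iInf_add, ENNReal.add_iInf]
  refine le_iInf fun n => le_iInf fun p => le_iInf fun h0 => le_iInf fun hn =>
    le_iInf fun m => le_iInf fun q => le_iInf fun k0 => le_iInf fun km => ?_
  refine (hypDist_le_sum (m + n) (fun i => if i ≤ m then q i else p (i - m)) (by simpa using k0)
    ?_).trans_eq ?_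
  · by_cases h : n = 0
    · subst h; simp [km, ← h0, hn]
    · simp [h, hn]
  · rw [Finset.sum_range_add]
    congr 1
    · refine Finset.sum_congr rfl fun i hi => ?_
      have := Finset.mem_range.1 hi
      simp [this, this.le]
    · refine Finset.sum_congr rfl fun i _ => ?_
      by_cases h : i = 0
      · subst h; simp [km, ← h0]
      · simp [h, add_assoc]

theorem hypDist_le_hypDiam {Ω A : Set ℂ} {z w : ℂ} (hz : z ∈ A) (hw : w ∈ A) :
    hypDist Ω z w ≤ hypDiam Ω A :=
  le_iSup₂_of_le z hz (le_iSup₂_of_le w hw le_rfl)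

theorem hypDiam_le_iff {Ω A : Set ℂ} {c : ℝ≥0∞} :
    hypDiam Ω A ≤ c ↔ ∀ z ∈ A, ∀ w ∈ A, hypDist Ω z w ≤ c := by
  simp [hypDiam, iSup_le_iff]

theorem hypDiam_mono {Ω A B : Set ℂ} (h : A ⊆ B) : hypDiam Ω A ≤ hypDiam Ω B :=
  hypDiam_le_iff.2 fun _ hz _ hw => hypDist_le_hypDiam (h hz) (h hw)

theorem hypDiam_anti {Ω Ω' : Set ℂ} (h : Ω ⊆ Ω') (A : Set ℂ) : hypDiam Ω' A ≤ hypDiam Ω A :=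
  hypDiam_le_iff.2 fun z hz w hw => (hypDist_anti h z w).trans (hypDist_le_hypDiam hz hw)

theorem hypDiam_union_le {Ω A B : Set ℂ} (h : (A ∩ B).Nonempty) :
    hypDiam Ω (A ∪ B) ≤ hypDiam Ω A + hypDiam Ω B := by
  obtain ⟨x, hxA, hxB⟩ := h
  refine hypDiam_le_iff.2 ?_
  rintro z (hz | hz) w (hw | hw)
  · exact le_add_right (hypDist_le_hypDiam hz hw)
  · exact (hypDist_triangle Ω z x w).trans
      (add_le_add (hypDist_le_hypDiam hz hxA) (hypDist_le_hypDiam hxB hw))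
  · rw [add_comm]
    exact (hypDist_triangle Ω z x w).trans
      (add_le_add (hypDist_le_hypDiam hz hxB) (hypDist_le_hypDiam hxA hw))
  · exact le_add_left (hypDist_le_hypDiam hz hw)

/-- A connected set that is covered by `m` open sets of diameter at most `c` has diameter at
most `m * c`. -/
theorem hypDiam_le_card_mul {ι : Type*} [Fintype ι] {Ω V : Set ℂ} {c : ℝ≥0∞}
    (hV : IsPreconnected V) (O : ι → Set ℂ) (hO : ∀ i, IsOpen (O i))
    (hd : ∀ i, hypDiam Ω (O i) ≤ c) (hcov : V ⊆ ⋃ i, O i) :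
    hypDiam Ω V ≤ Fintype.card ι * c := by
  classical
  -- Two of the sets are adjacent if they meet inside `V`. Connectedness of `V` puts any two sets
  -- that meet `V` in the same component of this graph.
  let G : SimpleGraph ι := SimpleGraph.fromRel fun i j => (V ∩ (O i ∩ O j)).Nonempty
  have hwalk : ∀ (i j : ι) (p : G.Walk i j), ∀ z ∈ O i, ∀ w ∈ O j,
      hypDist Ω z w ≤ (p.length + 1 : ℕ) * c := by
    intro i j p
    induction p with
    | nil => intro z hz w hw; simpa using (hypDist_le_hypDiam hz hw).trans (hd _)
    | @cons i k j hadj p ih =>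
      intro z hz w hw
      obtain ⟨x, -, hxi, hxk⟩ : (V ∩ (O i ∩ O k)).Nonempty := by
        rcases ((SimpleGraph.fromRel_adj _ _ _).1 hadj).2 with h | h
        · exact h
        · rwa [inter_comm (O k)] at h
      refine (hypDist_triangle Ω z x w).trans ((add_le_add
        ((hypDist_le_hypDiam hz hxi).trans (hd i)) (ih x hxk w hw)).trans_eq ?_)
      rw [SimpleGraph.Walk.length_cons]
      push_cast
      ring
  refine hypDiam_le_iff.2 fun z hz w hw => ?_
  obtain ⟨i, hi⟩ := mem_iUnion.1 (hcov hz)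
  obtain ⟨j, hj⟩ := mem_iUnion.1 (hcov hw)
  have hreach : G.Reachable i j := by
    by_contra hnr
    obtain ⟨x, hxV, hx1, hx2⟩ := hV (⋃ k ∈ {k | G.Reachable i k}, O k)
      (⋃ k ∈ {k | ¬ G.Reachable i k}, O k) (isOpen_biUnion fun k _ => hO k)
      (isOpen_biUnion fun k _ => hO k)
      (fun x hx => by
        obtain ⟨k, hk⟩ := mem_iUnion.1 (hcov hx)
        by_cases h : G.Reachable i k
        · exact Or.inl (mem_biUnion (show k ∈ {k | G.Reachable i k} from h) hk)
        · exact Or.inr (mem_biUnion (show k ∈ {k | ¬ G.Reachable i k} from h) hk))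
      ⟨z, hz, mem_biUnion (show i ∈ {k | G.Reachable i k} from SimpleGraph.Reachable.refl i) hi⟩
      ⟨w, hw, mem_biUnion (show j ∈ {k | ¬ G.Reachable i k} from hnr) hj⟩
    obtain ⟨k, hk, hxk⟩ := mem_iUnion₂.1 hx1
    obtain ⟨l, hl, hxl⟩ := mem_iUnion₂.1 hx2
    have hkl : k ≠ l := by rintro rfl; exact hl hk
    exact hl (SimpleGraph.Reachable.trans hk (SimpleGraph.Adj.reachable
      ((SimpleGraph.fromRel_adj _ _ _).2 ⟨hkl, Or.inl ⟨x, hxV, hxk, hxl⟩⟩)))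
  -- A path repeats no vertex, so the number of sets it visits, its length plus one, is at most
  -- `card ι`.
  obtain ⟨p, hp⟩ := hreach.exists_isPath
  refine (hwalk i j p z hi w hj).trans ?_
  gcongr
  exact hp.length_lt

/-! ### Comparison with the unit disk -/

/-- The hyperbolic distance in the unit disk of `0` and a point of modulus `ρ`. -/
noncomputable def unitDiscDist (ρ : ℝ) : ℝ := Real.log ((1 + ρ) / (1 - ρ))

theorem unitDiscDist_mono {ρ σ : ℝ} (h0 : 0 ≤ ρ) (h : ρ ≤ σ) (h1 : σ < 1) :
    unitDiscDist ρ ≤ unitDiscDist σ := by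
  unfold unitDiscDist
  have : 0 < 1 - σ := by linarith
  have : 0 < 1 - ρ := by linarith
  have : 0 ≤ 1 + σ := by linarith
  apply Real.log_le_log (by positivity)
  gcongr

/-- A Cayley transform followed by a rotation sends `i` to `0` and `t i` to `ζ`, where `t = (1 +
|ζ|) / (1 - |ζ|)`. The half-plane distance of `i` and `t i` is `log t`. -/
theorem halfPlaneDist_le_unitDiscDist {Ω : Set ℂ} {χ : ℂ → ℂ}
    (hd : DifferentiableOn ℂ χ (ball 0 1)) (hm : MapsTo χ (ball 0 1) Ω) {ζ : ℂ} (hζ : ‖ζ‖ < 1) :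
    halfPlaneDist Ω (χ 0) (χ ζ) ≤ ENNReal.ofReal (unitDiscDist ‖ζ‖) := by
  obtain ⟨u, hu, huζ⟩ : ∃ u : ℂ, ‖u‖ = 1 ∧ u * ‖ζ‖ = ζ := by
    by_cases h : ζ = 0
    · exact ⟨1, by simp, by simp [h]⟩
    · have : (‖ζ‖ : ℂ) ≠ 0 := by exact_mod_cast norm_ne_zero_iff.2 h
      exact ⟨ζ / ‖ζ‖, by simp [h], by field_simp⟩
  have hden : ∀ τ : ℂ, 0 < τ.im → τ + Complex.I ≠ 0 := fun τ hτ h => by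
    have := congrArg Complex.im h
    simp at this
    linarith
  have hball : MapsTo (fun τ : ℂ => u * ((τ - Complex.I) / (τ + Complex.I))) {τ | 0 < τ.im}
      (ball 0 1) := fun τ (hτ : 0 < τ.im) => by
    rw [mem_ball_zero_iff, norm_mul, hu, one_mul, norm_div, div_lt_one (norm_pos_iff.2 (hden τ hτ))]
    refine lt_of_pow_lt_pow_left₀ 2 (norm_nonneg _) ?_
    simp only [← Complex.normSq_eq_norm_sq, Complex.normSq_apply]
    simp
    nlinarith
  set t := (1 + ‖ζ‖) / (1 - ‖ζ‖) with ht
  have h1 : 0 < 1 - ‖ζ‖ := by linarith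
  have ht1 : 1 ≤ t := by rw [ht, le_div_iff₀ h1]; linarith [norm_nonneg ζ]
  have ht0 : 0 < t := by linarith
  refine iInf_le_of_le (fun τ => χ (u * ((τ - Complex.I) / (τ + Complex.I)))) <|
    iInf_le_of_le (hd.comp (fun τ hτ => ?_) hball) <| iInf_le_of_le (hm.comp hball) <|
    iInf_le_of_le UpperHalfPlane.I <| iInf_le_of_le (UpperHalfPlane.mk (t * Complex.I) (by simpa))
      <| iInf_le_of_le ?_ <| iInf_le_of_le ?_ ?_
  · have := hden τ hτ
    exact DifferentiableAt.differentiableWithinAt (by fun_prop (disch := exact this))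
  · simp
  · simp only
    congr 1
    have e : (t * Complex.I - Complex.I) / (t * Complex.I + Complex.I) = (‖ζ‖ : ℂ) := by
      have h2 : (t : ℂ) + 1 ≠ 0 := by exact_mod_cast (by positivity : t + 1 ≠ 0)
      have h3 : ((t - 1) / (t + 1) : ℝ) = ‖ζ‖ := by rw [ht]; field_simp; ring
      rw [← h3, ← sub_one_mul, ← add_one_mul, mul_div_mul_right _ _ Complex.I_ne_zero]
      push_cast
      rfl
    exact (congrArg (u * ·) e).trans huζ
  · rw [edist_dist]
    apply ENNReal.ofReal_le_ofReal
    rw [UpperHalfPlane.dist_of_re_eq (by simp [UpperHalfPlane.re])]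
    have h2 : (UpperHalfPlane.mk (t * Complex.I) (by simpa)).im = t := by
      simp [UpperHalfPlane.im]
    rw [h2, UpperHalfPlane.I_im, Real.log_one, dist_comm, dist_zero_right, Real.norm_of_nonneg
      (Real.log_nonneg ht1)]
    rfl

theorem tanh_le_self {x : ℝ} (hx : 0 ≤ x) : Real.tanh x ≤ x := by
  have h1 := Real.tanh_lt_one x
  have h0 : 0 ≤ Real.tanh x := by
    rw [Real.tanh_eq_sinh_div_cosh]
    exact div_nonneg (Real.sinh_nonneg_iff.2 hx) (Real.cosh_pos x).le
  have h2 := Real.artanh_tanh x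
  rw [Real.artanh_eq_half_log ⟨by linarith, h1.le⟩] at h2
  set t := Real.tanh x
  have h3 : 0 < 1 - t := by linarith
  have h4 := Real.le_log_one_add_of_nonneg (x := 2 * t / (1 - t)) (by positivity)
  have h5 : 1 + 2 * t / (1 - t) = (1 + t) / (1 - t) := by field_simp; ring
  have h6 : 2 * (2 * t / (1 - t)) / (2 * t / (1 - t) + 2) = 2 * t := by field_simp; ring
  rw [h5, h6] at h4
  linarith

/-- A crude Schwarz–Pick estimate: precomposing with a conformal map of the disk that sends `0` to
`a`, the Schwarz lemma gives `|w - z| ≤ 2 tanh(d/2) ≤ d`, where `d` is the distance of `a` and `b`.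
It serves only to show that the hyperbolic distance does not degenerate. -/
theorem edist_le_halfPlaneDist_unitBall (z w : ℂ) : edist z w ≤ halfPlaneDist (ball 0 1) z w := by
  refine le_iInf fun φ => le_iInf fun hd => le_iInf fun hm => le_iInf fun a => le_iInf fun b =>
    le_iInf fun ha => le_iInf fun hb => ?_
  have hden : ∀ ζ ∈ ball (0 : ℂ) 1, 1 - ζ ≠ 0 := fun ζ hζ h => by
    rw [← sub_eq_zero.1 h] at hζ
    simp at hζ
  have hkm : MapsTo (fun ζ : ℂ => (a - (starRingEnd ℂ) (a : ℂ) * ζ) / (1 - ζ)) (ball 0 1)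
      {τ | 0 < τ.im} := fun ζ hζ => by
    have h0 : 0 < Complex.normSq (1 - ζ) := Complex.normSq_pos.2 (hden ζ hζ)
    have h1 : ζ.re * ζ.re + ζ.im * ζ.im < 1 := by
      rw [← Complex.normSq_apply, Complex.normSq_eq_norm_sq]
      rw [mem_ball_zero_iff] at hζ
      nlinarith [norm_nonneg ζ]
    have h2 := a.im_pos
    have h3 : ((a - (starRingEnd ℂ) (a : ℂ) * ζ) / (1 - ζ)).im =
        a.im * (1 - (ζ.re * ζ.re + ζ.im * ζ.im)) / Complex.normSq (1 - ζ) := by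
      rw [Complex.div_im]
      simp
      field_simp
      ring
    rw [mem_ofPred_eq, h3]
    have : 0 < 1 - (ζ.re * ζ.re + ζ.im * ζ.im) := by linarith
    positivity
  set F : ℂ → ℂ := fun ζ => φ ((a - (starRingEnd ℂ) (a : ℂ) * ζ) / (1 - ζ)) with hF
  have hFd : DifferentiableOn ℂ F (ball 0 1) := hd.comp (fun ζ hζ => by
    have := hden ζ hζ
    exact DifferentiableAt.differentiableWithinAt (by fun_prop (disch := exact this))) hkm
  have hFm : MapsTo F (ball 0 1) (ball 0 1) := hm.comp hkm
  have hFm2 : MapsTo F (ball 0 1) (closedBall (F 0) 2) := fun ζ hζ => by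
    have h1 := mem_ball_zero_iff.1 (hFm hζ)
    have h2 := mem_ball_zero_iff.1 (hFm (mem_ball_self one_pos))
    rw [mem_closedBall, dist_eq_norm]
    exact (norm_sub_le _ _).trans (by linarith)
  have hba : (b : ℂ) - (starRingEnd ℂ) (a : ℂ) ≠ 0 := fun h => by
    have := congrArg Complex.im h
    simp at this
    linarith [a.im_pos, b.im_pos]
  have hζn : ‖((b : ℂ) - a) / (b - (starRingEnd ℂ) (a : ℂ))‖ = Real.tanh (dist b a / 2) := by
    rw [UpperHalfPlane.tanh_half_dist, norm_div, dist_eq_norm, dist_eq_norm]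
  have hζb : ((b : ℂ) - a) / (b - (starRingEnd ℂ) (a : ℂ)) ∈ ball (0 : ℂ) 1 := by
    rw [mem_ball_zero_iff, hζn]
    exact Real.tanh_lt_one _
  have h1 := Complex.dist_le_div_mul_dist_of_mapsTo_ball hFd hFm2 hζb
  have hF0 : F 0 = z := by simp [hF, ha]
  have haa : (a : ℂ) - (starRingEnd ℂ) (a : ℂ) ≠ 0 := fun h => by
    have := congrArg Complex.im h
    simp at this
    linarith [a.im_pos]
  have hFb : F (((b : ℂ) - a) / (b - (starRingEnd ℂ) (a : ℂ))) = w := by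
    rw [hF, ← hb]
    simp only
    congr 1
    have h2 := hden _ hζb
    rw [div_eq_iff h2]
    generalize (starRingEnd ℂ) (a : ℂ) = c at hba
    field_simp
    ring
  rw [hF0, hFb, dist_zero_right, hζn, div_one] at h1
  rw [edist_dist, edist_dist, dist_comm z, dist_comm a]
  refine ENNReal.ofReal_le_ofReal (h1.trans ?_)
  have := tanh_le_self (x := dist b a / 2) (by positivity)
  linarith

theorem edist_le_hypDist_unitBall (z w : ℂ) : edist z w ≤ hypDist (ball 0 1) z w := by
  refine le_iInf fun n => le_iInf fun p => le_iInf fun h0 => le_iInf fun hn => ?_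
  rw [← h0, ← hn]
  exact (edist_le_range_sum_edist p n).trans
    (Finset.sum_le_sum fun _ _ => edist_le_halfPlaneDist_unitBall _ _)

/-- If `D_R(z₀) ⊆ Ω`, then points of `D_r(z₀)` have distance at most `log ((R + r) / (R - r))` from
`z₀`, and this tends to `0` with `r`. -/
theorem eventually_hypDiam_ball_le {Ω : Set ℂ} (hΩ : IsOpen Ω) {z₀ : ℂ} (hz₀ : z₀ ∈ Ω)
    {ε : ℝ≥0∞} (hε : ε ≠ 0) :
    ∀ᶠ r : ℝ in 𝓝[>] 0, ball z₀ r ⊆ Ω ∧ hypDiam Ω (ball z₀ r) ≤ ε := by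
  obtain ⟨R, hR, hRΩ⟩ := Metric.isOpen_iff.1 hΩ z₀ hz₀
  have hd : DifferentiableOn ℂ (fun ζ : ℂ => z₀ + R * ζ) (ball 0 1) := by fun_prop
  have hm : MapsTo (fun ζ : ℂ => z₀ + R * ζ) (ball 0 1) Ω := fun ζ hζ => hRΩ (by
    rw [mem_ball_zero_iff] at hζ
    rw [mem_ball, dist_eq_norm, add_sub_cancel_left, norm_mul, Complex.norm_real,
      Real.norm_of_nonneg hR.le]
    nlinarith)
  have hlim : Tendsto (fun r : ℝ => ENNReal.ofReal (unitDiscDist (r / R)) +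
      ENNReal.ofReal (unitDiscDist (r / R))) (𝓝[>] 0) (𝓝 0) := by
    have : Tendsto (fun r : ℝ => unitDiscDist (r / R)) (𝓝 0) (𝓝 0) := by
      have hc : ContinuousAt (fun r : ℝ => unitDiscDist (r / R)) 0 := by
        unfold unitDiscDist
        exact ContinuousAt.log (by
          apply ContinuousAt.div <;> first | fun_prop | simp) (by simp)
      simpa [unitDiscDist] using hc.tendsto
    have h2 := (ENNReal.tendsto_ofReal this).mono_left (nhdsWithin_le_nhds (s := Ioi (0 : ℝ)))
    simpa using h2.add h2
  filter_upwards [hlim.eventually (ge_mem_nhds (pos_iff_ne_zero.2 hε)),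
    nhdsWithin_le_nhds (gt_mem_nhds hR), self_mem_nhdsWithin] with r hr hrR hr0
  refine ⟨(ball_subset_ball hrR.le).trans hRΩ, hypDiam_le_iff.2 fun z hz w hw => ?_⟩
  have key : ∀ z ∈ ball z₀ r, hypDist Ω z₀ z ≤ ENNReal.ofReal (unitDiscDist (r / R)) := by
    intro z hz
    have hn : ‖(z - z₀) / R‖ ≤ r / R := by
      rw [norm_div, Complex.norm_real, Real.norm_of_nonneg hR.le, ← dist_eq_norm]
      gcongr
      exact (mem_ball.1 hz).le
    have h1 : r / R < 1 := (div_lt_one hR).2 hrR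
    have h := halfPlaneDist_le_unitDiscDist hd hm (hn.trans_lt h1)
    have hRc : (R : ℂ) ≠ 0 := by exact_mod_cast hR.ne'
    rw [mul_zero, add_zero, mul_div_cancel₀ _ hRc, add_sub_cancel] at h
    exact (hypDist_le_halfPlaneDist Ω z₀ z).trans (h.trans
      (ENNReal.ofReal_le_ofReal (unitDiscDist_mono (norm_nonneg _) hn h1)))
  refine (hypDist_triangle Ω z z₀ w).trans (le_trans (add_le_add ?_ (key w hw)) hr)
  rw [hypDist_comm]
  exact key z hz

/-! ### Positivity of the constants -/

theorem isProperOfDegreeLE_id {Y : Type*} [TopologicalSpace Y] (U : Set Y) {d : ℕ} (hd : 1 ≤ d) :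
    IsProperOfDegreeLE id U U d := by
  refine ⟨⟨mapsTo_id U, ?_⟩, fun y _ => ?_⟩
  · have : (mapsTo_id U).restrict id U U = id := by ext; rfl
    rw [this]
    exact (Homeomorph.refl U).isProperMap
  · refine (encard_le_encard (inter_subset_right (s := U))).trans ?_
    rw [preimage_id, encard_singleton]
    exact_mod_cast hd

theorem isSimplyConnected_ball (z : ℂ) {r : ℝ} (hr : 0 < r) : IsSimplyConnected (ball z r) :=
  have := (convex_ball z r).contractibleSpace (nonempty_ball.2 hr)
  SimplyConnectedSpace.ofContractible _

/-- The identity of the unit disk is a test map: the component then contains `0` and `1/2`, which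
have positive distance. Positivity of `C₀` is what makes every sufficiently small `δ` admissible. -/
theorem IsPreimageDiamBound.pos {N : ℕ} (hN : 1 ≤ N) {C : ℝ≥0}
    (hC : IsPreimageDiamBound N (2 / 3) C) : 0 < C := by
  rw [pos_iff_ne_zero]
  rintro rfl
  have h := hC 0 1 (ball 0 1) id one_pos isOpen_ball (isSimplyConnected_ball 0 one_pos)
    differentiableOn_id (isProperOfDegreeLE_id _ hN)
    (connectedComponentIn (ball 0 1 ∩ id ⁻¹' ball 0 (2 / 3 * 1)) 0) ⟨0, by simp, rfl⟩
  have hsub : ball (0 : ℂ) (2 / 3) ⊆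
      connectedComponentIn (ball 0 1 ∩ id ⁻¹' ball (0 : ℂ) (2 / 3 * 1)) 0 :=
    (convex_ball (0 : ℂ) (2 / 3)).isPreconnected.subset_connectedComponentIn (by simp)
      fun z hz => ⟨ball_subset_ball (by norm_num) hz, by simpa using hz⟩
  have h2 := ((edist_le_hypDist_unitBall 0 (1 / 2)).trans (hypDist_le_hypDiam (hsub (by simp))
    (hsub (by rw [mem_ball_zero_iff]; norm_num)))).trans h
  simp at h2

theorem exists_diskCover : ∃ s : Finset ℂ, s.card = diskCoverNumber ∧
    (s : Set ℂ) ⊆ ball 0 1 ∧ ball (0 : ℂ) 1 ⊆ ⋃ c ∈ s, ball c (1 / 3) := by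
  refine Nat.sInf_mem (s := {n | ∃ s : Finset ℂ, s.card = n ∧ (s : Set ℂ) ⊆ ball 0 1 ∧
    ball (0 : ℂ) 1 ⊆ ⋃ c ∈ s, ball c (1 / 3)}) ?_
  obtain ⟨t, hts, htf, ht⟩ := finite_approx_of_totallyBounded
    ((isCompact_closedBall (0 : ℂ) 1).totallyBounded.subset ball_subset_closedBall) (1 / 3)
    (by norm_num)
  exact ⟨_, htf.toFinset, rfl, by simpa using hts, by simpa using ht⟩

theorem diskCoverNumber_pos : 0 < diskCoverNumber := by
  obtain ⟨s, hs, -, hcov⟩ := exists_diskCover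
  rw [← hs, Finset.card_pos]
  obtain ⟨c, hc⟩ := mem_iUnion.1 (hcov (mem_ball_self one_pos))
  exact ⟨c, (mem_iUnion.1 hc).1⟩

end Hyperbolic

/-! ### Preimages of disks under proper maps: existence of the diameter bound -/

section DiamBound

open Metric

theorem IsProperOfDegreeLE.mapsTo {Y Z : Type*} [TopologicalSpace Y] [TopologicalSpace Z]
    {g : Y → Z} {U : Set Y} {V : Set Z} {d : ℕ} (h : IsProperOfDegreeLE g U V d) : MapsTo g U V :=
  h.1.1

theorem IsProperOfDegreeLE.isCompact_inter_preimage {Y Z : Type*} [TopologicalSpace Y]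
    [TopologicalSpace Z] {g : Y → Z} {U : Set Y} {V K : Set Z} {d : ℕ}
    (h : IsProperOfDegreeLE g U V d) (hKV : K ⊆ V) (hK : IsCompact K) :
    IsCompact (U ∩ g ⁻¹' K) := by
  obtain ⟨⟨hm, hp⟩, -⟩ := h
  have hK' : IsCompact ((↑) ⁻¹' K : Set V) :=
    Topology.IsInducing.subtypeVal.isCompact_preimage' hK (by simpa using hKV)
  have h1 := (hp.isCompact_preimage hK').image continuous_subtype_val
  convert h1 using 1
  ext x
  constructor
  · rintro ⟨hx, hxK⟩
    exact ⟨⟨x, hx⟩, hxK, rfl⟩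
  · rintro ⟨⟨x, hx⟩, hxK, rfl⟩
    exact ⟨hx, hxK⟩

theorem IsProperOfDegreeLE.finite_fiber {Y Z : Type*} [TopologicalSpace Y]
    [TopologicalSpace Z] {g : Y → Z} {U : Set Y} {V : Set Z} {d : ℕ}
    (h : IsProperOfDegreeLE g U V d) {y : Z} (hy : y ∈ V) : (U ∩ g ⁻¹' {y}).Finite :=
  Set.finite_of_encard_le_coe (h.2 y hy)

/-- A holomorphic map with finite fibres is nowhere locally constant. -/
theorem not_eventually_eq_of_finite_fiber {U : Set ℂ} (hU : IsOpen U) {g : ℂ → ℂ} {z : ℂ}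
    (hz : z ∈ U) (hfin : (U ∩ g ⁻¹' {g z}).Finite) : ¬ ∀ᶠ w in 𝓝 z, g w = g z := fun h => by
  have h1 : U ∩ g ⁻¹' {g z} ∈ 𝓝 z := by
    filter_upwards [h, hU.mem_nhds hz] with w hw hwU using ⟨hwU, hw⟩
  exact (infinite_of_mem_nhds z h1) hfin

theorem nhds_le_map_of_finite_fiber {U : Set ℂ} (hU : IsOpen U) {g : ℂ → ℂ}
    (hg : DifferentiableOn ℂ g U) {z : ℂ} (hz : z ∈ U) (hfin : (U ∩ g ⁻¹' {g z}).Finite) :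
    𝓝 (g z) ≤ map g (𝓝 z) :=
  ((hg.analyticOnNhd hU z hz).eventually_constant_or_nhds_le_map_nhds).resolve_left
    (not_eventually_eq_of_finite_fiber hU hz hfin)

/-- By Liouville's theorem a bounded map on the whole plane is constant, which finite fibres
exclude. This provides the hypothesis of the Riemann mapping theorem. -/
theorem IsProperOfDegreeLE.ne_univ {g : ℂ → ℂ} {U V : Set ℂ} {d : ℕ} (hne : U.Nonempty)
    (hd : DifferentiableOn ℂ g U) (hV : Bornology.IsBounded V)
    (h : IsProperOfDegreeLE g U V d) : U ≠ univ := by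
  rintro rfl
  obtain ⟨z, hz⟩ := hne
  have hb : Bornology.IsBounded (range g) :=
    hV.subset (by rintro _ ⟨x, rfl⟩; exact h.mapsTo (mem_univ x))
  refine not_eventually_eq_of_finite_fiber isOpen_univ (mem_univ z)
    (h.finite_fiber (h.mapsTo (mem_univ z))) (Eventually.of_forall fun w => ?_)
  exact (differentiableOn_univ.1 hd).apply_eq_apply_of_bounded hb w z

/-! ### Proper self-maps of the disk and Blaschke products -/

/-- A holomorphic function on a domain that vanishes on a finite set is divisible by the
corresponding product of linear factors. -/
theorem exists_eq_prod_sub_mul {U : Set ℂ} (hU : IsOpen U) (Z : Finset ℂ) (hZ : ↑Z ⊆ U) :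
    ∀ {M : ℂ → ℂ}, DifferentiableOn ℂ M U → (∀ a ∈ Z, M a = 0) →
      ∃ M₁ : ℂ → ℂ, DifferentiableOn ℂ M₁ U ∧ ∀ z, M z = (∏ a ∈ Z, (z - a)) * M₁ z := by
  classical
  induction Z using Finset.induction_on with
  | empty => exact fun {M} hM _ => ⟨M, hM, fun z => by simp⟩
  | insert a Z ha ih =>
    intro M hM h0
    obtain ⟨M₁, hM₁, hfac⟩ := ih (fun x hx => hZ (by simp [Finset.mem_coe.1 hx])) hM
      fun x hx => h0 x (Finset.mem_insert_of_mem hx)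
    have haU : a ∈ U := hZ (by simp)
    have hM₁a : M₁ a = 0 := by
      have h1 := hfac a
      rw [h0 a (Finset.mem_insert_self _ _)] at h1
      refine (mul_eq_zero.1 h1.symm).resolve_left (Finset.prod_ne_zero_iff.2 fun b hb h => ?_)
      exact ha (by rwa [sub_eq_zero.1 h])
    refine ⟨dslope M₁ a, (Complex.differentiableOn_dslope (hU.mem_nhds haU)).2 hM₁, fun z => ?_⟩
    have h2 := sub_smul_dslope M₁ a z
    rw [hM₁a, sub_zero, smul_eq_mul] at h2
    rw [Finset.prod_insert ha, hfac z, ← h2]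
    ring

/-- A proper holomorphic self-map of the disk with simple zeros dominates the Blaschke product
with the same zeros. -/
theorem prod_norm_diskAut_le {M : ℂ → ℂ} (hd : DifferentiableOn ℂ M (ball 0 1))
    (hK : ∀ s < 1, IsCompact (ball 0 1 ∩ M ⁻¹' closedBall 0 s)) (Z : Finset ℂ)
    (hZ : ∀ z, z ∈ Z ↔ z ∈ ball (0 : ℂ) 1 ∧ M z = 0) (hs : ∀ z ∈ Z, deriv M z ≠ 0) {z : ℂ}
    (hz : z ∈ ball (0 : ℂ) 1) : ∏ a ∈ Z, ‖diskAut a z‖ ≤ ‖M z‖ := by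
  obtain ⟨M₁, hM₁, hfac⟩ := exists_eq_prod_sub_mul isOpen_ball Z (fun a ha => ((hZ a).1 ha).1) hd
    fun a ha => ((hZ a).1 ha).2
  -- A zero of `M₁` would be a zero of `M` of order at least two.
  have hM₁0 : ∀ w ∈ ball (0 : ℂ) 1, M₁ w ≠ 0 := fun w hw h0 => by
    have hMw : M w = 0 := by rw [hfac, h0, mul_zero]
    have hwZ : w ∈ Z := (hZ w).2 ⟨hw, hMw⟩
    have hM₁d := (hM₁.differentiableAt (isOpen_ball.mem_nhds hw)).hasDerivAt
    have hpd : DifferentiableAt ℂ (fun z => ∏ a ∈ Z, (z - a)) w := by fun_prop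
    have h1 := hpd.hasDerivAt.mul hM₁d
    have h2 : M = (fun z => ∏ a ∈ Z, (z - a)) * M₁ := funext hfac
    have h3 : ∏ a ∈ Z, (w - a) = 0 := Finset.prod_eq_zero hwZ (sub_self w)
    refine hs w hwZ ?_
    rw [h2, h1.deriv, h0, h3]
    simp
  have hden : ∀ a ∈ Z, ∀ w ∈ ball (0 : ℂ) 1, 1 - (starRingEnd ℂ) a * w ≠ 0 := fun a ha w hw =>
    one_sub_conj_mul_ne_zero ((hZ a).1 ha).1 hw
  -- This is the Blaschke product divided by `M` with the common zeros cancelled, so it is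
  -- holomorphic on the whole disk.
  set q : ℂ → ℂ := fun w => (∏ a ∈ Z, (1 - (starRingEnd ℂ) a * w))⁻¹ * (M₁ w)⁻¹ with hq
  have hqd : DifferentiableOn ℂ q (ball 0 1) := by
    refine DifferentiableOn.mul (DifferentiableOn.inv ?_ fun w hw => ?_) (hM₁.inv hM₁0)
    · exact Differentiable.differentiableOn (by fun_prop)
    · exact Finset.prod_ne_zero_iff.2 fun a ha => hden a ha w hw
  have hqM : ∀ w ∈ ball (0 : ℂ) 1, ∏ a ∈ Z, diskAut a w = q w * M w := fun w hw => by
    have h1 : ∏ a ∈ Z, (1 - (starRingEnd ℂ) a * w) ≠ 0 :=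
      Finset.prod_ne_zero_iff.2 fun a ha => hden a ha w hw
    have h2 := hM₁0 w hw
    rw [hfac w, hq]
    simp only [diskAut, Finset.prod_div_distrib]
    field_simp
  have hprod : ∀ w ∈ ball (0 : ℂ) 1, ∏ a ∈ Z, ‖diskAut a w‖ ≤ 1 := fun w hw =>
    Finset.prod_le_one (fun a _ => norm_nonneg _) fun a ha =>
      (mem_ball_zero_iff.1 (diskAut_mem_ball ((hZ a).1 ha).1 hw)).le
  -- Properness gives `|M| > s` on circles close enough to the unit circle, where the Blaschke
  -- product is at most `1`. The maximum principle yields `|q z| ≤ 1 / s`, and then `s → 1`.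
  have hbound : ∀ s < 1, 0 < s → ‖q z‖ ≤ s⁻¹ := fun s hs1 hs0 => by
    obtain ⟨r, hr1, hzr, hr⟩ : ∃ r < 1, ‖z‖ < r ∧
        ∀ w ∈ ball (0 : ℂ) 1, ‖M w‖ ≤ s → ‖w‖ < r := by
      obtain ⟨r₀, hr₀1, hr₀⟩ : ∃ r < 1, ∀ w ∈ ball (0 : ℂ) 1 ∩ M ⁻¹' closedBall 0 s, ‖w‖ < r := by
        rcases (ball (0 : ℂ) 1 ∩ M ⁻¹' closedBall 0 s).eq_empty_or_nonempty with he | hne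
        · exact ⟨0, one_pos, by simp [he]⟩
        · obtain ⟨x, hx, hmax⟩ := (hK s hs1).exists_isMaxOn hne continuous_norm.continuousOn
          have hx1 := mem_ball_zero_iff.1 hx.1
          exact ⟨(‖x‖ + 1) / 2, by linarith, fun w hw => by
            have : ‖w‖ ≤ ‖x‖ := hmax hw
            linarith⟩
      have hz1 := mem_ball_zero_iff.1 hz
      refine ⟨max r₀ ((‖z‖ + 1) / 2), max_lt hr₀1 (by linarith),
        lt_max_of_lt_right (by linarith), fun w hw hws => lt_max_of_lt_left (hr₀ w ⟨hw, ?_⟩)⟩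
      simpa using hws
    have hr0 : 0 < r := (norm_nonneg z).trans_lt hzr
    have hcb : closedBall (0 : ℂ) r ⊆ ball 0 1 := closedBall_subset_ball hr1
    refine Complex.norm_le_of_forall_mem_frontier_norm_le (U := ball (0 : ℂ) r) isBounded_ball
      (DifferentiableOn.diffContOnCl ?_) (fun w hw => ?_)
      (subset_closure (mem_ball_zero_iff.2 hzr))
    · rw [closure_ball _ hr0.ne']
      exact hqd.mono hcb
    · rw [frontier_ball _ hr0.ne'] at hw
      have hw1 := hcb (sphere_subset_closedBall hw)
      have hMw : s < ‖M w‖ := by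
        by_contra! h
        have := hr w hw1 h
        rw [mem_sphere_zero_iff_norm.1 hw] at this
        exact lt_irrefl _ this
      have h1 := hprod w hw1
      rw [← norm_prod, hqM w hw1, norm_mul] at h1
      rw [← one_div, le_div_iff₀ hs0]
      exact (mul_le_mul_of_nonneg_left hMw.le (norm_nonneg _)).trans h1
  have hq1 : ‖q z‖ ≤ 1 := by
    refine le_of_tendsto_of_tendsto (b := 𝓝[<] (1 : ℝ)) tendsto_const_nhds
      (g := fun s : ℝ => s⁻¹) ?_ ?_
    · have := (tendsto_inv₀ (one_ne_zero (α := ℝ))).mono_left (nhdsWithin_le_nhds (s := Iio 1))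
      simpa using this
    · filter_upwards [self_mem_nhdsWithin, nhdsWithin_le_nhds (lt_mem_nhds one_pos)] with s h1 h0
      exact hbound s h1 h0
  rw [← norm_prod, hqM z hz, norm_mul]
  exact mul_le_of_le_one_left (norm_nonneg _) hq1

/-- The critical points are isolated, hence countable, so the critical values form a countable set,
whose complement is dense. -/
theorem exists_regular_value {G : ℂ → ℂ} (hd : DifferentiableOn ℂ G (ball 0 1))
    (hfin : ∀ z ∈ ball (0 : ℂ) 1, (ball 0 1 ∩ G ⁻¹' {G z}).Finite) {ε : ℝ} (hε : 0 < ε) :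
    ∃ v : ℂ, ‖v‖ < ε ∧ ∀ z ∈ ball (0 : ℂ) 1, G z = v → deriv G z ≠ 0 := by
  set S : Set ℂ := {z ∈ ball (0 : ℂ) 1 | deriv G z = 0} with hS
  have hiso : ∀ z ∈ S, {z} ∈ 𝓝[S] z := fun z hz => by
    rcases ((hd.analyticOnNhd isOpen_ball _ hz.1).deriv).eventually_eq_zero_or_eventually_ne_zero
      with h | h
    · refine absurd ?_ (not_eventually_eq_of_finite_fiber isOpen_ball hz.1 (hfin z hz.1))
      obtain ⟨r, hr, hb⟩ := Metric.eventually_nhds_iff_ball.1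
        (h.and (isOpen_ball.eventually_mem hz.1))
      filter_upwards [ball_mem_nhds _ hr] with y hy
      exact (convex_ball z r).is_const_of_fderivWithin_eq_zero (𝕜 := ℂ)
        (hd.mono fun x hx => (hb x hx).2)
        (fun x hx => by
          rw [fderivWithin_of_isOpen isOpen_ball hx]
          ext
          simpa using (hb x hx).1) hy (mem_ball_self hr)
    · rw [mem_nhdsWithin_iff_eventually]
      filter_upwards [eventually_nhdsWithin_iff.1 h] with y hy hyS
      by_contra hne
      exact hy hne hyS.2
  obtain ⟨t, -, htc, ht⟩ := TopologicalSpace.countable_cover_nhdsWithin hiso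
  have hSc : S.Countable := htc.mono (by simpa using ht)
  obtain ⟨v, hv, hvS⟩ := ((hSc.image G).dense_compl ℂ).exists_dist_lt 0 hε
  refine ⟨v, by simpa [dist_eq_norm] using hvS, fun z hz hzv h0 => hv ⟨z, ⟨hz, h0⟩, hzv⟩⟩

/-- The quotient is at most `(23/30) / (14/15) = 23/28`. What matters is that the bound lies below
`11/12`, the value that Bernoulli's inequality produces for the Blaschke product. -/
theorem norm_diskAut_le {v w : ℂ} (hv : ‖v‖ ≤ 1 / 10) (hw : ‖w‖ ≤ 2 / 3) :
    ‖diskAut v w‖ ≤ 5 / 6 := by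
  rw [diskAut, norm_div]
  have h1 := norm_sub_le w v
  have h2 : 14 / 15 ≤ ‖1 - (starRingEnd ℂ) v * w‖ := by
    have h3 := norm_sub_norm_le 1 ((starRingEnd ℂ) v * w)
    rw [norm_one, norm_mul, RCLike.norm_conj] at h3
    have h4 : ‖v‖ * ‖w‖ ≤ 1 / 10 * (2 / 3) := by gcongr
    linarith
  rw [div_le_iff₀ (by linarith)]
  linarith

/-- If `M = diskAut v ∘ G` for a proper holomorphic `G : 𝔻 → 𝔻` with at most `N` points in each
fibre, where `v` is a small regular value, then `|G| ≤ 2 / 3` only close to `G⁻¹(v)`. -/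
theorem exists_norm_diskAut_lt {N : ℕ} (hN : 1 ≤ N) {G : ℂ → ℂ}
    (hd : DifferentiableOn ℂ G (ball 0 1)) (hm : MapsTo G (ball 0 1) (ball 0 1))
    (hK : ∀ K ⊆ ball (0 : ℂ) 1, IsCompact K → IsCompact (ball 0 1 ∩ G ⁻¹' K))
    (hfib : ∀ w ∈ ball (0 : ℂ) 1, (ball (0 : ℂ) 1 ∩ G ⁻¹' {w}).encard ≤ N) :
    ∃ Z : Finset ℂ, Z.card ≤ N ∧ (Z : Set ℂ) ⊆ ball 0 1 ∧
      ∀ z ∈ ball (0 : ℂ) 1, ‖G z‖ ≤ 2 / 3 → ∃ a ∈ Z, ‖diskAut a z‖ < 1 - 1 / (12 * N) := by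
  obtain ⟨v, hv, hreg⟩ := exists_regular_value hd
    (fun z hz => Set.finite_of_encard_le_coe (hfib _ (hm hz))) (ε := 1 / 10) (by norm_num)
  have hvb : v ∈ ball (0 : ℂ) 1 := by rw [mem_ball_zero_iff]; linarith
  have hfin := Set.finite_of_encard_le_coe (hfib v hvb)
  have hmemZ : ∀ z, z ∈ hfin.toFinset ↔ z ∈ ball (0 : ℂ) 1 ∧ G z = v := fun z => by simp
  have hcard : hfin.toFinset.card ≤ N := by
    have := hfib v hvb
    rw [hfin.encard_eq_coe_toFinset_card] at this
    exact_mod_cast this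
  refine ⟨hfin.toFinset, hcard, fun z hz => ((hmemZ z).1 hz).1, fun z hz hGz => ?_⟩
  have hMd : DifferentiableOn ℂ (fun z => diskAut v (G z)) (ball 0 1) :=
    (differentiableOn_diskAut hvb).comp hd hm
  have hprod := prod_norm_diskAut_le hMd (fun s hs => ?_) hfin.toFinset (fun z => ?_) ?_ hz
  -- If all of the at most `N` factors were at least `1 - 1/(12N)`, their product would be at least
  -- `11/12` by Bernoulli, contradicting `|diskAut v (G z)| ≤ 5/6`.
  · by_contra! hall
    have hN' : (1 : ℝ) ≤ N := by exact_mod_cast hN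
    have hsmall : 1 / (12 * (N : ℝ)) ≤ 1 / 12 := by
      apply one_div_le_one_div_of_le <;> linarith
    have hbern : 1 - 1 / 12 ≤ (1 - 1 / (12 * (N : ℝ))) ^ N := by
      have h1 := one_add_mul_le_pow (a := -(1 / (12 * (N : ℝ)))) (by linarith) N
      have h2 : 1 + (N : ℝ) * -(1 / (12 * N)) = 1 - 1 / 12 := by field_simp; norm_num
      rw [h2] at h1
      simpa [sub_eq_add_neg] using h1
    have h3 : (1 - 1 / (12 * (N : ℝ))) ^ N ≤ (1 - 1 / (12 * (N : ℝ))) ^ hfin.toFinset.card :=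
      pow_le_pow_of_le_one (by linarith) (by linarith [one_div_pos.2 (by positivity :
        (0 : ℝ) < 12 * N)]) hcard
    have h4 : (1 - 1 / (12 * (N : ℝ))) ^ hfin.toFinset.card ≤
        ∏ a ∈ hfin.toFinset, ‖diskAut a z‖ := by
      rw [← Finset.prod_const]
      exact Finset.prod_le_prod (fun _ _ => by linarith) hall
    have h5 := norm_diskAut_le hv.le hGz
    linarith
  · have himg : diskAut (-v) '' closedBall 0 s ⊆ ball 0 1 := by
      rintro _ ⟨x, hx, rfl⟩
      exact diskAut_mem_ball (neg_mem_unitBall hvb) (closedBall_subset_ball hs hx)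
    convert hK _ himg ((isCompact_closedBall 0 s).image_of_continuousOn
      ((differentiableOn_diskAut (neg_mem_unitBall hvb)).continuousOn.mono
        (closedBall_subset_ball hs))) using 1
    ext x
    refine and_congr_right fun hx => ?_
    constructor
    · exact fun h => ⟨_, h, diskAut_neg_diskAut hvb (hm hx)⟩
    · rintro ⟨y, hy, hyx⟩
      rw [mem_preimage, ← hyx, diskAut_diskAut_neg hvb (closedBall_subset_ball hs hy)]
      exact hy
  · rw [hmemZ]
    exact and_congr_right fun hx => (diskAut_eq_zero_iff hvb (hm hx)).symm
  · intro a ha h0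
    obtain ⟨hab, hGa⟩ := (hmemZ a).1 ha
    have hGd := hd.differentiableAt (isOpen_ball.mem_nhds hab)
    refine hreg a hab hGa ?_
    have hcomp : G =ᶠ[𝓝 a] fun z => diskAut (-v) (diskAut v (G z)) := by
      filter_upwards [isOpen_ball.mem_nhds hab] with x hx
      exact (diskAut_neg_diskAut hvb (hm hx)).symm
    rw [hcomp.deriv_eq]
    have hd2 : DifferentiableAt ℂ (diskAut (-v)) (diskAut v (G a)) :=
      (differentiableOn_diskAut (neg_mem_unitBall hvb)).differentiableAt
        (isOpen_ball.mem_nhds (diskAut_mem_ball hvb (hm hab)))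
    have hd3 := hMd.differentiableAt (isOpen_ball.mem_nhds hab)
    have h6 := hd2.hasDerivAt.comp a hd3.hasDerivAt
    have h7 := h6.deriv
    rw [h0, mul_zero] at h7
    exact h7

/-- The constants `C(N, 2 / 3)` exist. -/
theorem exists_isPreimageDiamBound {N : ℕ} (hN : 1 ≤ N) :
    ∃ C : ℝ≥0, IsPreimageDiamBound N (2 / 3) C := by
  have hN' : (1 : ℝ) ≤ N := by exact_mod_cast hN
  set ρ : ℝ := 1 - 1 / (12 * N) with hρ
  have hρ1 : ρ < 1 := by rw [hρ]; linarith [one_div_pos.2 (by positivity : (0 : ℝ) < 12 * N)]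
  set L := unitDiscDist ρ with hL
  refine ⟨N * (L.toNNReal + L.toNNReal), ?_⟩
  intro z₀ δ U g hδ hU hUc hgd hg A hA
  obtain ⟨x, ⟨hxU, hxg⟩, rfl⟩ := hA
  have hUne : U ≠ univ := hg.ne_univ ⟨x, hxU⟩ hgd isBounded_ball
  -- The Riemann map of `U` and the affine normalisation of the target turn `g` into a proper
  -- self-map `G` of the unit disk.
  obtain ⟨φ, ψ, hφd, hφm, hψd, hψm, hψφ, hφψ, -⟩ := exists_riemannMap hU hUc hUne hxU
  have hδc : (δ : ℂ) ≠ 0 := by exact_mod_cast hδ.ne'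
  have hnorm : ∀ w, ‖(w - z₀) / δ‖ = dist w z₀ / δ := fun w => by
    rw [norm_div, Complex.norm_real, Real.norm_of_nonneg hδ.le, dist_eq_norm]
  set G : ℂ → ℂ := fun ζ => (g (ψ ζ) - z₀) / δ with hG
  have hGiff : ∀ ζ w, G ζ = w ↔ g (ψ ζ) = z₀ + δ * w := fun ζ w => by
    rw [hG, div_eq_iff hδc, sub_eq_iff_eq_add, mul_comm w, add_comm]
  have hball : ∀ w ∈ ball (0 : ℂ) 1, z₀ + δ * w ∈ ball z₀ δ := fun w hw => by
    rw [mem_ball_zero_iff] at hw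
    rw [mem_ball, dist_eq_norm, add_sub_cancel_left, norm_mul, Complex.norm_real,
      Real.norm_of_nonneg hδ.le]
    nlinarith
  have hGd : DifferentiableOn ℂ G (ball 0 1) :=
    ((hgd.comp hψd hψm).sub_const z₀).div_const _
  have hGm : MapsTo G (ball 0 1) (ball 0 1) := fun ζ hζ => by
    rw [mem_ball_zero_iff, hnorm, div_lt_one hδ]
    exact hg.mapsTo (hψm hζ)
  have himage : ∀ K : Set ℂ, ball 0 1 ∩ G ⁻¹' K =
      φ '' (U ∩ g ⁻¹' ((fun w => z₀ + δ * w) '' K)) := fun K => by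
    ext ζ
    constructor
    · rintro ⟨hζ, hζK⟩
      exact ⟨ψ ζ, ⟨hψm hζ, G ζ, hζK, ((hGiff ζ _).1 rfl).symm⟩, hφψ ζ hζ⟩
    · rintro ⟨y, ⟨hy, w, hw, hwy⟩, rfl⟩
      refine ⟨hφm hy, ?_⟩
      have : G (φ y) = w := (hGiff _ _).2 (by rw [hψφ y hy, ← hwy])
      rwa [mem_preimage, this]
  obtain ⟨Z, hZN, hZb, hZ⟩ := exists_norm_diskAut_lt hN hGd hGm
    (fun K hKb hK => by
      rw [himage]
      refine (hg.isCompact_inter_preimage ?_ (hK.image (by fun_prop))).image_of_continuousOn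
        (hφd.continuousOn.mono inter_subset_left)
      rintro _ ⟨w, hw, rfl⟩
      exact hball w (hKb hw))
    (fun w hw => by
      rw [himage, image_singleton]
      exact (encard_image_le _ _).trans (hg.2 _ (hball w hw)))
  -- In the coordinate `φ` these are hyperbolic disks about the at most `N` points of `Z`. Their
  -- radius is at most `L` in `U`, so `2L` bounds each diameter and `N · 2L` that of the connected
  -- set they cover.
  have hO : ∀ a : Z, IsOpen (U ∩ φ ⁻¹' {ζ | ζ ∈ ball (0 : ℂ) 1 ∧ ‖diskAut a ζ‖ < ρ}) := fun a => by
    refine hφd.continuousOn.isOpen_inter_preimage hU ?_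
    exact (differentiableOn_diskAut (hZb a.2)).continuousOn.norm.isOpen_inter_preimage isOpen_ball
      isOpen_Iio
  have hdiam : ∀ a : Z, hypDiam U (U ∩ φ ⁻¹' {ζ | ζ ∈ ball (0 : ℂ) 1 ∧ ‖diskAut a ζ‖ < ρ}) ≤
      ENNReal.ofReal L + ENNReal.ofReal L := fun a => by
    have hab := hZb a.2
    have key : ∀ z ∈ U ∩ φ ⁻¹' {ζ | ζ ∈ ball (0 : ℂ) 1 ∧ ‖diskAut a ζ‖ < ρ},
        hypDist U (ψ a) z ≤ ENNReal.ofReal L := by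
      rintro z ⟨hz, hz1, hz2⟩
      have h := halfPlaneDist_le_unitDiscDist (χ := fun ζ => ψ (diskAut (-a) ζ))
        (hψd.comp (differentiableOn_diskAut (neg_mem_unitBall hab))
          fun ζ hζ => diskAut_mem_ball (neg_mem_unitBall hab) hζ)
        (fun ζ hζ => hψm (diskAut_mem_ball (neg_mem_unitBall hab) hζ)) (hz2.trans hρ1)
      have h0 : diskAut (-a) 0 = (a : ℂ) := by simp [diskAut]
      rw [h0, diskAut_neg_diskAut hab hz1, hψφ z hz] at h
      exact (hypDist_le_halfPlaneDist _ _ _).trans (h.trans (ENNReal.ofReal_le_ofReal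
        (unitDiscDist_mono (norm_nonneg _) hz2.le hρ1)))
    refine hypDiam_le_iff.2 fun z hz w hw => (hypDist_triangle U z (ψ a) w).trans
      (add_le_add ?_ (key w hw))
    rw [hypDist_comm]
    exact key z hz
  have hcov := hypDiam_le_card_mul (Ω := U)
    (isPreconnected_connectedComponentIn (x := x) (F := U ∩ g ⁻¹' ball z₀ (2 / 3 * δ))) _ hO hdiam
    (fun z hz => by
      obtain ⟨hzU, hzg⟩ := connectedComponentIn_subset _ _ hz
      obtain ⟨a, ha, haz⟩ := hZ (φ z) (hφm hzU) (by
        rw [hG]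
        simp only
        rw [hψφ z hzU, hnorm, div_le_iff₀ hδ]
        exact (mem_ball.1 hzg).le)
      exact mem_iUnion.2 ⟨⟨a, ha⟩, hzU, hφm hzU, haz⟩)
  refine hcov.trans ?_
  rw [Fintype.card_coe]
  push_cast
  change _ ≤ (N : ℝ≥0∞) * (ENNReal.ofReal L + ENNReal.ofReal L)
  gcongr

end DiamBound

/-! ### Path lifting for local homeomorphisms -/

section PathLifting

variable {E X : Type*} [TopologicalSpace E]

/-- `Γ` lifts the restriction of `γ` to `[0, t]` and starts at `e`. -/
structure IsLiftOn (p : E → X) (γ : ℝ → X) (e : E) (t : ℝ) (Γ : ℝ → E) : Prop where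
  cont : ContinuousOn Γ (Icc 0 t)
  zero : Γ 0 = e
  lifts : ∀ s ∈ Icc 0 t, p (Γ s) = γ s

theorem IsLiftOn.mono {p : E → X} {γ : ℝ → X} {e : E} {t t' : ℝ} {Γ : ℝ → E}
    (h : IsLiftOn p γ e t Γ) (ht : t' ≤ t) : IsLiftOn p γ e t' Γ :=
  ⟨h.cont.mono (Icc_subset_Icc_right ht), h.zero, fun s hs => h.lifts s ⟨hs.1, hs.2.trans ht⟩⟩

variable [TopologicalSpace X]

theorem IsLiftOn.eq [T2Space E] {p : E → X} (hp : IsLocalHomeomorph p) {γ : ℝ → X} {e : E}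
    {t t' s : ℝ} {Γ Γ' : ℝ → E} (h : IsLiftOn p γ e t Γ) (h' : IsLiftOn p γ e t' Γ')
    (hs : 0 ≤ s) (hst : s ≤ t) (hst' : s ≤ t') : Γ s = Γ' s := by
  have h1 := h.mono hst
  have h2 := h'.mono hst'
  exact (T2Space.isSeparatedMap p).eqOn_of_comp_eqOn hp.isLocallyInjective isPreconnected_Icc
    h1.cont h2.cont (fun x hx => (h1.lifts x hx).trans (h2.lifts x hx).symm)
    (left_mem_Icc.2 hs) (h1.zero.trans h2.zero.symm) (right_mem_Icc.2 hs)

theorem exists_isLiftOn_glue [T2Space E] {p : E → X} (hp : IsLocalHomeomorph p) {γ : ℝ → X}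
    {e : E} {J : Set ℝ} (hJ : ∀ t ∈ J, Icc 0 t ⊆ J) (h : ∀ t ∈ J, ∃ Γ, IsLiftOn p γ e t Γ) :
    ∃ Γ, ∀ t ∈ J, 0 ≤ t → IsLiftOn p γ e t Γ := by
  have : Nonempty E := ⟨e⟩
  choose! G hG using h
  -- By uniqueness of lifts, the diagonal of the chosen partial lifts agrees on `[0, t]` with the
  -- lift chosen for `t`.
  refine ⟨fun s => G s s, fun t ht h0 => ?_⟩
  have heq : ∀ s ∈ Icc 0 t, G s s = G t s := fun s hs =>
    (hG s (hJ t ht hs)).eq hp (hG t ht) hs.1 le_rfl hs.2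
  refine ⟨(hG t ht).cont.congr heq, ?_, fun s hs => ?_⟩
  · exact (hG 0 (hJ t ht (left_mem_Icc.2 h0))).zero
  · rw [heq s hs]
    exact (hG t ht).lifts s hs

theorem IsLiftOn.extend {p : E → X} {γ : ℝ → X} (hγ : Continuous γ) {e : E} {t₁ t₂ : ℝ}
    {Γ : ℝ → E} (h : IsLiftOn p γ e t₁ Γ) (h0 : 0 ≤ t₁) (h12 : t₁ ≤ t₂)
    (q : OpenPartialHomeomorph E X) (hq : p = q) (hsrc : Γ t₁ ∈ q.source)
    (htgt : ∀ s ∈ Icc t₁ t₂, γ s ∈ q.target) : ∃ Γ', IsLiftOn p γ e t₂ Γ' := by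
  have h1 : EqOn (fun s => if s ≤ t₁ then Γ s else q.symm (γ s)) Γ (Icc 0 t₁) :=
    fun s hs => if_pos hs.2
  have h2 : EqOn (fun s => if s ≤ t₁ then Γ s else q.symm (γ s)) (q.symm ∘ γ) (Icc t₁ t₂) := by
    intro s hs
    rcases hs.1.eq_or_lt with rfl | hlt
    · simp only [le_refl, if_true, Function.comp]
      rw [← h.lifts _ (right_mem_Icc.2 h0), hq, q.left_inv hsrc]
    · exact if_neg hlt.not_ge
  refine ⟨fun s => if s ≤ t₁ then Γ s else q.symm (γ s), ?_, ?_, ?_⟩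
  · rw [← Icc_union_Icc_eq_Icc h0 h12]
    exact (h.cont.congr h1).union_of_isClosed
      ((q.continuousOn_symm.comp hγ.continuousOn htgt).congr h2) isClosed_Icc isClosed_Icc
  · exact (if_pos h0).trans h.zero
  · intro s hs
    rcases le_total s t₁ with hst | hst
    · refine (congrArg p (h1 ⟨hs.1, hst⟩)).trans ?_
      exact h.lifts s ⟨hs.1, hst⟩
    · refine (congrArg p (h2 ⟨hst, hs.2⟩)).trans ?_
      rw [hq]
      exact q.right_inv (htgt s ⟨hst, hs.2⟩)

/-- A local homeomorphism lifts paths if partial lifts do not escape. -/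
theorem exists_isLiftOn [T2Space E] [T2Space X] {p : E → X} (hp : IsLocalHomeomorph p)
    {γ : ℝ → X} (hγ : Continuous γ) {e : E} (he : p e = γ 0) {T : ℝ} (hT : 0 ≤ T)
    (hcl : ∀ τ ∈ Ioc 0 T, ∀ Γ : ℝ → E, ContinuousOn Γ (Ico 0 τ) →
      (∀ s ∈ Ico 0 τ, p (Γ s) = γ s) → ∃ x, MapClusterPt x (𝓝[<] τ) Γ) :
    ∃ Γ, IsLiftOn p γ e T Γ := by
  set S : Set ℝ := {t | t ∈ Icc 0 T ∧ ∃ Γ, IsLiftOn p γ e t Γ} with hS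
  have h0S : (0 : ℝ) ∈ S := ⟨left_mem_Icc.2 hT, fun _ => e, continuousOn_const, rfl, fun s hs => by
    rw [le_antisymm hs.2 hs.1, he]⟩
  have hSb : BddAbove S := ⟨T, fun t ht => ht.1.2⟩
  have hdown : ∀ t ∈ S, Icc 0 t ⊆ S := fun t ht s hs =>
    ⟨⟨hs.1, hs.2.trans ht.1.2⟩, ht.2.imp fun Γ hΓ => hΓ.mono hs.2⟩
  set τ := sSup S with hτ
  have hτ0 : 0 ≤ τ := le_csSup hSb h0S
  have hτT : τ ≤ T := csSup_le ⟨0, h0S⟩ fun t ht => ht.1.2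
  have hnhds : ∀ q : OpenPartialHomeomorph E X, γ τ ∈ q.target →
      ∃ ε > 0, ∀ s, dist s τ < ε → γ s ∈ q.target := fun q hq =>
    Metric.eventually_nhds_iff.1 (hγ.continuousAt.eventually_mem (q.open_target.mem_nhds hq))
  have hτS : τ ∈ S := by
    rcases hτ0.eq_or_lt with h | hpos
    · rwa [← h]
    obtain ⟨Γ, hΓ⟩ := exists_isLiftOn_glue hp (J := Iio τ ∩ S)
      (fun t ht s hs => ⟨hs.2.trans_lt ht.1, hdown t ht.2 hs⟩) (fun t ht => ht.2.2)
    have hΓ' : ∀ t ∈ Ico 0 τ, IsLiftOn p γ e t Γ := fun t ht => by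
      obtain ⟨t', ht', htt'⟩ := exists_lt_of_lt_csSup ⟨0, h0S⟩ ht.2
      exact hΓ t ⟨ht.2, hdown t' ht' ⟨ht.1, htt'.le⟩⟩ ht.1
    have hlift : ∀ s ∈ Ico 0 τ, p (Γ s) = γ s := fun s hs =>
      (hΓ' s hs).lifts s (right_mem_Icc.2 hs.1)
    have hcont : ContinuousOn Γ (Ico 0 τ) := fun s hs => by
      obtain ⟨t, hst, htτ⟩ := exists_between hs.2
      refine ((hΓ' t ⟨hs.1.trans hst.le, htτ⟩).cont s ⟨hs.1, hst.le⟩).mono_of_mem_nhdsWithin ?_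
      filter_upwards [self_mem_nhdsWithin, nhdsWithin_le_nhds (gt_mem_nhds hst)] with x hx hxt
        using ⟨hx.1, hxt.le⟩
    obtain ⟨x, hx⟩ := hcl τ ⟨hpos, hτT⟩ Γ hcont hlift
    have hev : ∀ᶠ s in 𝓝[<] τ, s ∈ Ico 0 τ := Ico_mem_nhdsLT hpos
    have hpx : p x = γ τ := by
      have h1 : MapClusterPt (p x) (𝓝[<] τ) (p ∘ Γ) := hx.continuousAt_comp hp.continuous.continuousAt
      have h2 : Tendsto (p ∘ Γ) (𝓝[<] τ) (𝓝 (γ τ)) :=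
        (hγ.continuousAt.tendsto.mono_left nhdsWithin_le_nhds).congr'
          (hev.mono fun s hs => (hlift s hs).symm)
      exact eq_of_nhds_neBot (h1.neBot.mono (inf_le_inf_left _ h2))
    -- The lift returns to a chart about the cluster point at times `t₁` arbitrarily close to `τ`.
    -- From such a time on, the local inverse continues it up to `τ`.
    obtain ⟨q, hxq, hq⟩ := hp x
    obtain ⟨ε, hε, hball⟩ := hnhds q (by rw [← hpx, hq]; exact q.map_source hxq)
    have hfr := hx.frequently (q.open_source.eventually_mem hxq)
    obtain ⟨t₁, ht₁q, ht₁, ht₁ε⟩ := (hfr.and_eventually (hev.and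
      (nhdsWithin_le_nhds (Metric.ball_mem_nhds τ hε)))).exists
    refine ⟨⟨hτ0, hτT⟩, (hΓ' t₁ ht₁).extend hγ ht₁.1 ht₁.2.le q hq ht₁q fun s hs => hball s ?_⟩
    rw [Real.dist_eq, abs_lt] at ht₁ε
    rw [Real.dist_eq, abs_lt]
    constructor <;> linarith [hs.1, hs.2]
  obtain ⟨-, Γ, hΓ⟩ := hτS
  rcases hτT.eq_or_lt with h | hlt
  · exact ⟨Γ, h ▸ hΓ⟩
  · exfalso
    obtain ⟨q, hxq, hq⟩ := hp (Γ τ)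
    obtain ⟨ε, hε, hball⟩ := hnhds q (by
      rw [← hΓ.lifts τ (right_mem_Icc.2 hτ0), hq]; exact q.map_source hxq)
    have hmin : τ < min (τ + ε / 2) T := lt_min (by linarith) hlt
    have hmem : min (τ + ε / 2) T ∈ S := by
      refine ⟨⟨hτ0.trans hmin.le, min_le_right _ _⟩,
        hΓ.extend hγ hτ0 hmin.le q hq hxq fun s hs => hball s ?_⟩
      have := hs.2.trans (min_le_left _ _)
      rw [Real.dist_eq, abs_lt]
      constructor <;> linarith [hs.1]
    exact absurd (le_csSup hSb hmem) hmin.not_ge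

/-- A local homeomorphism with the path lifting property over a simply connected set, with path
connected total space, is a bijection. -/
theorem injective_and_range_eq_of_isLiftOn [T2Space E] [PathConnectedSpace E] {p : E → X}
    (hp : IsLocalHomeomorph p) {V : Set X} (hV : IsSimplyConnected V) (hpV : ∀ x, p x ∈ V)
    (hlift : ∀ γ : ℝ → X, Continuous γ → (∀ t, γ t ∈ V) → ∀ e, p e = γ 0 →
      ∃ Γ, IsLiftOn p γ e 1 Γ) : Function.Injective p ∧ range p = V := by
  constructor
  · intro x y hxy
    -- The image of a path from `x` to `y` is a loop. A null-homotopy of it lifts with starting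
    -- point `x`, and the endpoints of the lifts agree by monodromy: they are `y` for the loop and
    -- `x` for the constant path.
    let α : Path x y := PathConnectedSpace.somePath x y
    let β : Path (p x) (p x) := (α.map hp.continuous).cast rfl hxy
    obtain ⟨F, hF⟩ := (isSimplyConnected_iff_exists_homotopy_refl_forall_mem.1 hV).2 (p x) β
      fun t => hpV _
    have hF0 : ∀ t, F (t, 0) = p x := fun t => by
      simp
    have hex : ∀ t : unitInterval, ∃ Γ, IsLiftOn p
        (fun s : ℝ => F (t, projIcc 0 1 zero_le_one s)) x 1 Γ := fun t =>
      hlift _ (F.continuous.comp (by fun_prop)) (fun s => hF _) x (by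
        simp)
    choose Γ hΓ using hex
    let Γ' : unitInterval → C(unitInterval, E) := fun t =>
      ⟨fun s => Γ t s, (hΓ t).cont.comp_continuous continuous_subtype_val fun s => s.2⟩
    have hΓl : ∀ t s, p (Γ' t s) = F (t, s) := fun t s => by
      have := (hΓ t).lifts s s.2
      rw [projIcc_val] at this
      exact this
    have hΓ0 : ∀ t, Γ' t 0 = x := fun t => by simpa [Γ'] using (hΓ t).zero
    have sep := T2Space.isSeparatedMap p
    have h10 := hp.monodromy_theorem sep F Γ' hΓl (fun t => (hΓ0 t).trans (hΓ0 0).symm) 1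
    have e0 : ⇑(Γ' 0) = α := sep.eq_of_comp_eq hp.isLocallyInjective (Γ' 0).continuous α.continuous
      (by
        ext s
        rw [Function.comp_apply, hΓl]
        simp [β]) 0 (by rw [hΓ0]; exact α.source.symm)
    have e1 : ⇑(Γ' 1) = fun _ => x := sep.eq_of_comp_eq hp.isLocallyInjective (Γ' 1).continuous
      continuous_const (by
        ext s
        rw [Function.comp_apply, hΓl]
        simp) 0 (hΓ0 1)
    rw [e0, e1] at h10
    exact Eq.trans h10 α.target
  · refine Subset.antisymm (range_subset_iff.2 hpV) fun v hv => ?_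
    obtain ⟨x⟩ := (inferInstance : Nonempty E)
    obtain ⟨γ, hγ⟩ := hV.isPathConnected.joinedIn (p x) (hpV x) v hv
    obtain ⟨Γ, hΓ⟩ := hlift (fun s => γ (projIcc 0 1 zero_le_one s))
      (γ.continuous.comp continuous_projIcc) (fun t => hγ _) x (by simp)
    exact ⟨Γ 1, by simpa using hΓ.lifts 1 (by simp)⟩

end PathLifting

/-! ### Branched coverings of the disk with one branched value -/

section Contraction

variable {E : Type*} [TopologicalSpace E] {h : E → ℂ}

/-- On the compact set where `|h| ≤ 1/2` outside the neighbourhoods `O z`, the function `|h|` has no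
zeros and hence a positive minimum. -/
theorem exists_subset_iUnion_of_norm_lt (hh : Continuous h)
    (hK : ∀ K ⊆ Metric.ball (0 : ℂ) 1, IsCompact K → IsCompact (h ⁻¹' K)) {O : E → Set E}
    (hO : ∀ z, h z = 0 → IsOpen (O z) ∧ z ∈ O z) :
    ∃ ε > 0, ∀ x, ‖h x‖ < ε → ∃ z, h z = 0 ∧ x ∈ O z := by
  set C : Set E := h ⁻¹' Metric.closedBall 0 (1 / 2) \ ⋃ z ∈ {z | h z = 0}, O z with hC
  have hCc : IsCompact C := (hK _ (Metric.closedBall_subset_ball (by norm_num))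
    (isCompact_closedBall _ _)).diff (isOpen_biUnion fun z hz => (hO z hz).1)
  have hcase : ∀ x, ‖h x‖ ≤ 1 / 2 → x ∉ C → ∃ z, h z = 0 ∧ x ∈ O z := fun x hx hxC => by
    by_contra! hno
    exact hxC ⟨by simpa using hx, fun hm => by
      obtain ⟨z, hz, hxz⟩ := mem_iUnion₂.1 hm
      exact hno z hz hxz⟩
  rcases C.eq_empty_or_nonempty with he | hne
  · exact ⟨1 / 2, by norm_num, fun x hx => hcase x hx.le (by simp [he])⟩
  · obtain ⟨x₀, hx₀, hmin⟩ := hCc.exists_isMinOn hne hh.norm.continuousOn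
    have h0 : h x₀ ≠ 0 := fun h0 =>
      hx₀.2 (mem_biUnion (show x₀ ∈ {z | h z = 0} from h0) (hO x₀ h0).2)
    refine ⟨min (1 / 2) ‖h x₀‖, lt_min (by norm_num) (norm_pos_iff.2 h0), fun x hx =>
      hcase x (hx.le.trans (min_le_left _ _)) fun hxC => ?_⟩
    exact absurd (hmin hxC) (hx.trans_le (min_le_right _ _)).not_ge

/-- The radial flow on the disk lifts to the complement of the fibre over `0`. -/
theorem exists_radial_flow [T2Space E] (hh : Continuous h) (hb : ∀ x, h x ∈ Metric.ball (0 : ℂ) 1)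
    (hK : ∀ K ⊆ Metric.ball (0 : ℂ) 1, IsCompact K → IsCompact (h ⁻¹' K))
    (hloc : IsLocalHomeomorphOn h {x | h x ≠ 0}) :
    ∃ Φ : ℝ → E → E, (∀ x, Φ 0 x = x) ∧ (∀ s x, h x = 0 → Φ s x = x) ∧
      (∀ s x, 0 ≤ s → h (Φ s x) = Real.exp (-s) * h x) ∧
      ContinuousOn (fun y : ℝ × E => Φ y.1 y.2) (Ici 0 ×ˢ {x | h x ≠ 0}) := by
  classical
  have hopen : IsOpen {x | h x ≠ 0} := isOpen_ne_fun hh continuous_const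
  set p : {x | h x ≠ 0} → ℂ := fun x => h x with hp
  have hpl : IsLocalHomeomorph p := by
    rw [isLocalHomeomorph_iff_isLocalHomeomorphOn_univ]
    exact hloc.comp (hopen.isOpenEmbedding_subtypeVal.isLocalHomeomorph.isLocalHomeomorphOn)
      fun x _ => x.2
  have hlift : ∀ (x : {x | h x ≠ 0}) (T : ℝ), 0 ≤ T →
      ∃ Γ, IsLiftOn p (fun s => Real.exp (-s) * p x) x T Γ := fun x T hT => by
    refine exists_isLiftOn hpl (by fun_prop) (by simp) hT fun τ hτ Γ hΓ hΓl => ?_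
    -- Up to time `τ` the radial path stays in this closed annulus, which avoids both `0` and the
    -- unit circle; its preimage is compact, so partial lifts cannot escape.
    set K : Set ℂ := Metric.closedBall 0 ‖h x‖ \ Metric.ball 0 (Real.exp (-τ) * ‖h x‖) with hKdef
    have hKc : IsCompact K := (isCompact_closedBall _ _).diff Metric.isOpen_ball
    have hKb : K ⊆ Metric.ball 0 1 := sdiff_subset.trans
      (Metric.closedBall_subset_ball (mem_ball_zero_iff.1 (hb x)))
    have hcomp : IsCompact (p ⁻¹' K) := by
      refine Topology.IsInducing.subtypeVal.isCompact_preimage' (hK K hKb hKc) fun y hy => ?_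
      refine ⟨⟨y, fun h0 => hy.2 ?_⟩, rfl⟩
      rw [h0, Metric.mem_ball, dist_self]
      have := norm_pos_iff.2 x.2
      positivity
    have hev : ∀ᶠ s in 𝓝[<] τ, Γ s ∈ p ⁻¹' K := by
      filter_upwards [Ico_mem_nhdsLT hτ.1] with s hs
      have hn : ‖p (Γ s)‖ = Real.exp (-s) * ‖h x‖ := by
        rw [hΓl s hs, norm_mul, Complex.norm_real, Real.norm_of_nonneg (Real.exp_pos _).le]
      refine ⟨?_, ?_⟩
      · rw [mem_closedBall_zero_iff, hn]
        exact mul_le_of_le_one_left (norm_nonneg _) (Real.exp_le_one_iff.2 (by linarith [hs.1]))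
      · rw [mem_ball_zero_iff, hn, not_lt]
        gcongr
        exact hs.2.le
    obtain ⟨y, -, hy⟩ := hcomp.exists_mapClusterPt (tendsto_principal.2 hev)
    exact ⟨y, hy⟩
  have hglob : ∀ x : {x | h x ≠ 0}, ∃ Γ, ∀ T, 0 ≤ T →
      IsLiftOn p (fun s => Real.exp (-s) * p x) x T Γ := fun x => by
    obtain ⟨Γ, hΓ⟩ := exists_isLiftOn_glue hpl (J := Ici 0) (fun t ht s hs => hs.1)
      (fun T hT => hlift x T hT)
    exact ⟨Γ, fun T hT => hΓ T hT hT⟩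
  choose Γ hΓ using hglob
  refine ⟨fun s x => if hx : h x ≠ 0 then Γ ⟨x, hx⟩ s else x, fun x => ?_, fun s x hx => ?_,
    fun s x hs => ?_, ?_⟩
  · dsimp only
    split_ifs with hx
    · rw [(hΓ ⟨x, hx⟩ 0 le_rfl).zero]
    · rfl
  · simp [hx]
  · dsimp only
    split_ifs with hx
    · exact (hΓ ⟨x, hx⟩ s hs).lifts s (right_mem_Icc.2 hs)
    · rw [not_ne_iff.1 hx, mul_zero]
  · rintro ⟨s₀, x₀⟩ ⟨hs₀, hx₀⟩
    have hs₀' : 0 ≤ s₀ := hs₀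
    set T := s₀ + 1 with hT
    have hT0 : 0 < T := by linarith
    -- Joint continuity in time and starting point is the continuous dependence of lifts on a
    -- parameter, with the time interval `[0, T]` rescaled to `[0, 1]`.
    have hcont : Continuous fun y : unitInterval × {x | h x ≠ 0} => Γ y.2 (y.1 * T) := by
      refine hpl.continuous_lift (T2Space.isSeparatedMap p)
        ⟨fun y : unitInterval × {x | h x ≠ 0} => Real.exp (-(y.1 * T)) * p y.2, by
          have := hpl.continuous
          fun_prop⟩ ?_ ?_ ?_
      · ext y
        exact (hΓ y.2 T hT0.le).lifts _ ⟨mul_nonneg y.1.2.1 hT0.le,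
          mul_le_of_le_one_left hT0.le y.1.2.2⟩
      · have : (fun x : {x | h x ≠ 0} => Γ x (((0 : unitInterval) : ℝ) * T)) = id := by
          ext x
          rw [Icc.coe_zero, zero_mul, (hΓ x 0 le_rfl).zero]
          rfl
        exact this ▸ continuous_id
      · intro x
        exact (hΓ x T hT0.le).cont.comp_continuous (by fun_prop) fun t =>
          ⟨mul_nonneg t.2.1 hT0.le, mul_le_of_le_one_left hT0.le t.2.2⟩
    have hcont2 : ContinuousOn (fun y : ℝ × E => if hx : h y.2 ≠ 0 then
        ((Γ ⟨y.2, hx⟩ y.1 : {x | h x ≠ 0}) : E) else y.2) (Icc 0 T ×ˢ {x | h x ≠ 0}) := by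
      rw [continuousOn_iff_continuous_domRestrict]
      have h2 : Continuous fun y : (Icc 0 T ×ˢ {x | h x ≠ 0} : Set (ℝ × E)) =>
          ((⟨y.1.1 / T, div_nonneg y.2.1.1 hT0.le, (div_le_one hT0).2 y.2.1.2⟩,
            ⟨y.1.2, y.2.2⟩) : unitInterval × {x | h x ≠ 0}) := by fun_prop
      convert continuous_subtype_val.comp (hcont.comp h2) using 1
      ext y
      have hy : h y.1.2 ≠ 0 := y.2.2
      simp only [domRestrict_apply, Function.comp, dif_pos hy, div_mul_cancel₀ _ hT0.ne']
    refine (hcont2 _ ⟨⟨hs₀', by linarith⟩, hx₀⟩).mono_of_mem_nhdsWithin ?_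
    have hlt : s₀ < T := by linarith
    filter_upwards [self_mem_nhdsWithin, nhdsWithin_le_nhds
      (continuous_fst.continuousAt.eventually_mem (gt_mem_nhds hlt :
        ∀ᶠ s in 𝓝 (s₀, x₀).1, s < T))] with y hy hyT using ⟨⟨hy.1, le_of_lt hyT⟩, hy.2⟩

theorem exists_isOpen_pairwise_disjoint [T2Space E] (hfin : (h ⁻¹' {0}).Finite) {z : E}
    (hz : h z = 0) {W : Set E} (hW : W ∈ 𝓝 z) :
    ∃ O : E → Set E, (∀ z, h z = 0 → IsOpen (O z) ∧ z ∈ O z) ∧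
      (∀ z z', h z = 0 → h z' = 0 → z ≠ z' → Disjoint (O z) (O z')) ∧ O z ⊆ W := by
  classical
  obtain ⟨U, hU, hd⟩ := hfin.t2_separation
  refine ⟨fun y => if y = z then U y ∩ interior W else U y, fun y hy => ?_, fun y y' hy hy' hne => ?_,
    ?_⟩
  · simp only
    split_ifs with h1
    · subst h1
      exact ⟨(hU y).2.inter isOpen_interior, (hU y).1, mem_interior_iff_mem_nhds.2 hW⟩
    · exact ⟨(hU y).2, (hU y).1⟩
  · have hsub : ∀ y, (if y = z then U y ∩ interior W else U y) ⊆ U y := fun y => by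
      split_ifs
      · exact inter_subset_left
      · exact subset_rfl
    exact (hd hy hy' hne).mono (hsub y) (hsub y')
  · simp only [if_true]
    exact inter_subset_right.trans interior_subset

/-- A connected space that maps properly to the unit disk, by a local homeomorphism outside of the
finite fibre over `0`, is contractible. -/
theorem contractibleSpace_of_isLocalHomeomorphOn [T2Space E] [ConnectedSpace E]
    (hh : Continuous h) (hb : ∀ x, h x ∈ Metric.ball (0 : ℂ) 1)
    (hK : ∀ K ⊆ Metric.ball (0 : ℂ) 1, IsCompact K → IsCompact (h ⁻¹' K))
    (hfin : (h ⁻¹' {0}).Finite) (hloc : IsLocalHomeomorphOn h {x | h x ≠ 0}) :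
    ContractibleSpace E := by
  classical
  obtain ⟨Φ, hΦ0, hΦz, hΦh, hΦc⟩ := exists_radial_flow hh hb hK hloc
  have hopen : IsOpen {x | h x ≠ 0} := isOpen_ne_fun hh continuous_const
  have hΦn : ∀ s x, 0 ≤ s → ‖h (Φ s x)‖ = Real.exp (-s) * ‖h x‖ := fun s x hs => by
    rw [hΦh s x hs, norm_mul, Complex.norm_real, Real.norm_of_nonneg (Real.exp_pos _).le]
  have hΦt : ∀ x, ContinuousOn (fun s => Φ s x) (Ici 0) := fun x => by
    by_cases hx : h x = 0
    · simp only [hΦz _ x hx]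
      exact continuousOn_const
    · exact hΦc.comp (f := fun s => (s, x)) (by fun_prop) fun s hs => ⟨hs, hx⟩
  have hdecay : ∀ x, ∀ ε > 0, ∃ s₁, 0 ≤ s₁ ∧ Real.exp (-s₁) * ‖h x‖ < ε := fun x ε hε => by
    have h1 : Tendsto (fun s => Real.exp (-s) * ‖h x‖) atTop (𝓝 (0 * ‖h x‖)) :=
      (Real.tendsto_exp_neg_atTop_nhds_zero).mul_const _
    rw [zero_mul] at h1
    exact ((eventually_ge_atTop 0).and (h1.eventually_lt_const hε)).exists
  -- Once `|h| < ε`, a flow line runs inside the disjoint open sets `O z`. Being connected, it stays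
  -- in the one where it is.
  have htrap : ∀ O : E → Set E, (∀ z, h z = 0 → IsOpen (O z) ∧ z ∈ O z) →
      (∀ z z', h z = 0 → h z' = 0 → z ≠ z' → Disjoint (O z) (O z')) →
      ∀ ε, (∀ x, ‖h x‖ < ε → ∃ z, h z = 0 ∧ x ∈ O z) → ∀ x z s₁, h z = 0 → 0 ≤ s₁ →
      Real.exp (-s₁) * ‖h x‖ < ε → Φ s₁ x ∈ O z → ∀ s, s₁ ≤ s → Φ s x ∈ O z := by
    intro O hO hd ε hε x z s₁ hz hs₁ hx hxO s hs
    have hsub : (fun s => Φ s x) '' Icc s₁ s ⊆ O z ∪ ⋃ z' ∈ {z' | h z' = 0 ∧ z' ≠ z}, O z' := by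
      rintro _ ⟨t, ht, rfl⟩
      obtain ⟨z', hz', hxz'⟩ := hε (Φ t x) (by
        rw [hΦn t x (hs₁.trans ht.1)]
        refine lt_of_le_of_lt ?_ hx
        gcongr
        exact ht.1)
      by_cases hzz : z' = z
      · exact Or.inl (hzz ▸ hxz')
      · exact Or.inr (mem_biUnion (show z' ∈ {z' | h z' = 0 ∧ z' ≠ z} from ⟨hz', hzz⟩) hxz')
    have hpre : IsPreconnected ((fun s => Φ s x) '' Icc s₁ s) :=
      isPreconnected_Icc.image _ ((hΦt x).mono fun t ht => hs₁.trans ht.1)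
    refine hpre.subset_left_of_subset_union (hO z hz).1
      (isOpen_biUnion fun z' hz' => (hO z' hz'.1).1) ?_ hsub
      ⟨_, mem_image_of_mem _ (left_mem_Icc.2 hs), hxO⟩ (mem_image_of_mem _ (right_mem_Icc.2 hs))
    exact disjoint_iUnion₂_right.2 fun z' hz' => hd z z' hz hz'.1 hz'.2.symm
  -- A flow line stays in a compact set, so it has a cluster point, which lies over `0` because `h`
  -- decays along the flow. Trapping turns the cluster point into a limit.
  have hlim : ∀ x, ∃ z, h z = 0 ∧ Tendsto (fun s => Φ s x) atTop (𝓝 z) := fun x => by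
    have hcomp := hK (Metric.closedBall 0 ‖h x‖)
      (Metric.closedBall_subset_ball (mem_ball_zero_iff.1 (hb x))) (isCompact_closedBall _ _)
    have hev : ∀ᶠ s in atTop, Φ s x ∈ h ⁻¹' Metric.closedBall 0 ‖h x‖ := by
      filter_upwards [eventually_ge_atTop 0] with s hs
      rw [mem_preimage, mem_closedBall_zero_iff, hΦn s x hs]
      exact mul_le_of_le_one_left (norm_nonneg _) (Real.exp_le_one_iff.2 (by linarith))
    obtain ⟨z, -, hz⟩ := hcomp.exists_mapClusterPt (tendsto_principal.2 hev)
    have hz0 : h z = 0 := by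
      have h1 : MapClusterPt (h z) atTop (h ∘ fun s => Φ s x) := hz.continuousAt_comp hh.continuousAt
      have h2 : Tendsto (h ∘ fun s => Φ s x) atTop (𝓝 0) := by
        rw [tendsto_zero_iff_norm_tendsto_zero]
        have h3 : Tendsto (fun s => Real.exp (-s) * ‖h x‖) atTop (𝓝 (0 * ‖h x‖)) :=
          (Real.tendsto_exp_neg_atTop_nhds_zero).mul_const _
        rw [zero_mul] at h3
        refine h3.congr' ?_
        filter_upwards [eventually_ge_atTop 0] with s hs using (hΦn s x hs).symm
      exact eq_of_nhds_neBot (h1.neBot.mono (inf_le_inf_left _ h2))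
    refine ⟨z, hz0, fun W hW => ?_⟩
    obtain ⟨O, hO, hOd, hOW⟩ := exists_isOpen_pairwise_disjoint hfin hz0 hW
    obtain ⟨ε, hε, hεO⟩ := exists_subset_iUnion_of_norm_lt hh hK hO
    obtain ⟨s₀, hs₀, hs₀ε⟩ := hdecay x ε hε
    obtain ⟨s₁, hs₁O, hs₁⟩ := ((hz.frequently ((hO z hz0).1.eventually_mem
      (hO z hz0).2)).and_eventually (eventually_ge_atTop s₀)).exists
    rw [mem_map]
    filter_upwards [eventually_ge_atTop s₁] with s hs
    refine hOW (htrap O hO hOd ε hεO x z s₁ hz0 (hs₀.trans hs₁) (lt_of_le_of_lt ?_ hs₀ε) hs₁O s hs)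
    gcongr
  choose L hLz hL using hlim
  have hLtrap : ∀ O : E → Set E, (∀ z, h z = 0 → IsOpen (O z) ∧ z ∈ O z) →
      (∀ z z', h z = 0 → h z' = 0 → z ≠ z' → Disjoint (O z) (O z')) → ∀ x z s₁, h z = 0 →
      (∀ s, s₁ ≤ s → Φ s x ∈ O z) → L x = z := by
    intro O hO hd x z s₁ hz hs
    by_contra hne
    obtain ⟨s, hs1, hs2⟩ := ((eventually_ge_atTop s₁).and ((hL x).eventually
      ((hO _ (hLz x)).1.eventually_mem (hO _ (hLz x)).2))).exists
    exact disjoint_left.1 (hd _ _ (hLz x) hz hne) hs2 (hs s hs1)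
  have hLid : ∀ x, h x = 0 → L x = x := fun x hx =>
    tendsto_nhds_unique (hL x) (by simp only [hΦz _ x hx]; exact tendsto_const_nhds)
  -- The homotopy runs through the infinite flow time in the parameter `t / (1 - t)` and ends with
  -- the limit map `L`. Its continuity is nontrivial only over `0` and at `t = 1`, where it follows
  -- from trapping.
  set K : unitInterval × E → E := fun y =>
    if (y.1 : ℝ) < 1 then Φ (y.1 / (1 - y.1)) y.2 else L y.2 with hKdef
  have hKz : ∀ t x, h x = 0 → K (t, x) = x := fun t x hx => by
    simp only [hKdef]
    split_ifs
    · exact hΦz _ x hx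
    · exact hLid x hx
  have hKcont : Continuous K := by
    rw [continuous_iff_continuousAt]
    rintro ⟨t₀, x₀⟩
    by_cases hA : h x₀ ≠ 0 ∧ (t₀ : ℝ) < 1
    · have hN : {y : unitInterval × E | (y.1 : ℝ) < 1 ∧ h y.2 ≠ 0} ∈ 𝓝 (t₀, x₀) := by
        refine IsOpen.mem_nhds ?_ ⟨hA.2, hA.1⟩
        exact (isOpen_lt (continuous_subtype_val.comp continuous_fst) continuous_const).inter
          (hopen.preimage continuous_snd)
      refine ContinuousOn.continuousAt (s := {y | (y.1 : ℝ) < 1 ∧ h y.2 ≠ 0}) ?_ hN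
      refine (hΦc.comp (f := fun y : unitInterval × E => ((y.1 : ℝ) / (1 - y.1), y.2)) ?_ ?_).congr
        fun y hy => if_pos hy.1
      · refine ContinuousOn.prodMk (ContinuousOn.div (by fun_prop) (by fun_prop) ?_) (by fun_prop)
        exact fun y hy => (sub_pos.2 hy.1).ne'
      · exact fun y hy => ⟨div_nonneg y.1.2.1 (sub_pos.2 hy.1).le, hy.2⟩
    · intro W hW
      rw [mem_map]
      have hLK : L x₀ = K (t₀, x₀) := by
        by_cases hx : h x₀ = 0
        · rw [hKz _ _ hx, hLid _ hx]
        · exact (if_neg fun ht => hA ⟨hx, ht⟩).symm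
      rw [← hLK] at hW
      obtain ⟨O, hO, hOd, hOW⟩ := exists_isOpen_pairwise_disjoint hfin (hLz x₀) hW
      obtain ⟨ε, hε, hεO⟩ := exists_subset_iUnion_of_norm_lt hh hK hO
      have hgo : ∀ x s₁, 0 ≤ s₁ → Real.exp (-s₁) * ‖h x‖ < ε → Φ s₁ x ∈ O (L x₀) →
          ∀ t : unitInterval, ((t : ℝ) < 1 → s₁ ≤ t / (1 - t)) → K (t, x) ∈ W := by
        intro x s₁ hs₁ hx hxO t ht
        have h1 := htrap O hO hOd ε hεO x (L x₀) s₁ (hLz x₀) hs₁ hx hxO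
        simp only [hKdef]
        split_ifs with htt
        · exact hOW (h1 _ (ht htt))
        · rw [hLtrap O hO hOd x (L x₀) s₁ (hLz x₀) h1]
          exact hOW (hO _ (hLz x₀)).2
      by_cases hx : h x₀ = 0
      · have hN : {y : unitInterval × E | ‖h y.2‖ < ε ∧ y.2 ∈ O (L x₀)} ∈ 𝓝 (t₀, x₀) := by
          refine IsOpen.mem_nhds ?_ ⟨by simpa [hx] using hε, ?_⟩
          · exact (isOpen_lt (hh.comp continuous_snd).norm continuous_const).inter
              ((hO _ (hLz x₀)).1.preimage continuous_snd)
          · have := (hO _ (hLz x₀)).2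
            rwa [hLid x₀ hx] at this ⊢
        filter_upwards [hN] with y hy
        refine hgo y.2 0 le_rfl (by simpa using hy.1) (by rw [hΦ0]; exact hy.2) y.1 fun ht => ?_
        exact div_nonneg y.1.2.1 (sub_pos.2 ht).le
      · have ht₀ : (t₀ : ℝ) = 1 := le_antisymm t₀.2.2 (not_lt.1 fun ht => hA ⟨hx, ht⟩)
        obtain ⟨s₀, hs₀, hs₀ε⟩ := hdecay x₀ ε hε
        obtain ⟨s₁, hs₁, hs₁O⟩ := ((eventually_ge_atTop s₀).and ((hL x₀).eventually
          ((hO _ (hLz x₀)).1.eventually_mem (hO _ (hLz x₀)).2))).exists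
        have hs₁0 : 0 ≤ s₁ := hs₀.trans hs₁
        have hΦs : ContinuousAt (Φ s₁) x₀ := by
          have : ContinuousOn (Φ s₁) {x | h x ≠ 0} :=
            hΦc.comp (f := fun x => (s₁, x)) (by fun_prop) fun x hx => ⟨hs₁0, hx⟩
          exact this.continuousAt (hopen.mem_nhds hx)
        have hev1 : ∀ᶠ x in 𝓝 x₀, Real.exp (-s₁) * ‖h x‖ < ε := by
          refine ContinuousAt.eventually_lt (by fun_prop) continuousAt_const
            (lt_of_le_of_lt ?_ hs₀ε)
          gcongr
        have hev2 : ∀ᶠ x in 𝓝 x₀, Φ s₁ x ∈ O (L x₀) :=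
          hΦs.eventually_mem ((hO _ (hLz x₀)).1.mem_nhds hs₁O)
        have hev3 : ∀ᶠ t : unitInterval in 𝓝 t₀, s₁ / (1 + s₁) < t := by
          refine ContinuousAt.eventually_lt continuousAt_const (by fun_prop) ?_
          rw [ht₀, div_lt_one (by linarith)]
          linarith
        filter_upwards [hev3.prod_nhds (hev1.and hev2)] with y hy
        refine hgo y.2 s₁ hs₁0 hy.2.1 hy.2.2 y.1 fun ht => ?_
        have h2 := (div_lt_iff₀ (by linarith)).1 hy.1
        rw [le_div_iff₀ (sub_pos.2 ht)]
        linarith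
  -- The map `L` is continuous from a connected space to the finite fibre over `0`, so it is
  -- constant, and `K` contracts the space to this one point.
  have hconst : ∃ z, ∀ x, L x = z := by
    have hLc : Continuous L := by
      have : L = fun x => K (1, x) := by
        ext x
        simp [hKdef]
      rw [this]
      fun_prop
    obtain ⟨x₀⟩ := (inferInstance : Nonempty E)
    exact ⟨L x₀, fun x => isPreconnected_univ.constant_of_mapsTo hfin.isDiscrete
      hLc.continuousOn (fun y _ => hLz y) (mem_univ x) (mem_univ x₀)⟩
  obtain ⟨z, hz⟩ := hconst
  rw [contractible_iff_id_nullhomotopic]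
  refine ⟨z, ⟨⟨⟨K, hKcont⟩, fun x => ?_, fun x => ?_⟩⟩⟩
  · simp [hKdef, hΦ0]
  · simp [hKdef, hz]

end Contraction

/-! ### Coverings and branched coverings between plane domains -/

section Planar

/-- Where it is injective, a holomorphic map is not locally constant, hence open, hence an open
embedding. -/
theorem isLocalHomeomorphOn_of_injOn {U : Set ℂ} (hU : IsOpen U) {F : ℂ → ℂ}
    (hF : DifferentiableOn ℂ F U) {S : Set U} (hinj : ∀ x ∈ S, ∃ O ∈ 𝓝 (x : ℂ), InjOn F O) :
    IsLocalHomeomorphOn (fun z : U => F z) S := by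
  have key : IsLocalHomeomorphOn F ((↑) '' S) := by
    rw [isLocalHomeomorphOn_iff_isOpenEmbedding_restrict]
    rintro _ ⟨x, hx, rfl⟩
    obtain ⟨O, hO, hOi⟩ := hinj x hx
    have hN : IsOpen (interior O ∩ U) := isOpen_interior.inter hU
    refine ⟨interior O ∩ U, hN.mem_nhds ⟨mem_interior_iff_mem_nhds.2 hO, x.2⟩,
      Topology.IsOpenEmbedding.of_continuous_injective_isOpenMap ?_ ?_ ?_⟩
    · exact continuousOn_iff_continuous_domRestrict.1 (hF.continuousOn.mono inter_subset_right)
    · exact injOn_iff_injective.1 (hOi.mono (inter_subset_left.trans interior_subset))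
    · refine isOpenMap_iff_nhds_le.2 fun a => ?_
      have h1 : ¬ ∀ᶠ w in 𝓝 (a : ℂ), F w = F a := fun h => by
        have : ∀ᶠ w in 𝓝[≠] (a : ℂ), False := by
          filter_upwards [nhdsWithin_le_nhds h, nhdsWithin_le_nhds (hN.mem_nhds a.2),
            self_mem_nhdsWithin] with w hw hwN hne
          exact hne (hOi (interior_subset hwN.1) (interior_subset a.2.1) hw)
        exact this.exists.elim fun _ h => h
      have h2 := ((hF.analyticOnNhd hU a a.2.2).eventually_constant_or_nhds_le_map_nhds).resolve_left
        h1
      have h3 : map (domRestrict (interior O ∩ U) F) (𝓝 a) = map F (𝓝 (a : ℂ)) := by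
        rw [← map_nhds_subtype_coe_eq_nhds a.2 (hN.mem_nhds a.2), map_map]
        rfl
      rw [h3]
      exact h2
  exact key.comp (hU.isOpenEmbedding_subtypeVal.isLocalHomeomorph.isLocalHomeomorphOn)
    (mapsTo_image _ _)

/-- An unbranched map onto a simply connected domain whose partial path lifts do not escape is a
homeomorphism. -/
theorem isSimplyConnected_and_isProperOfDegreeLE_one {U V : Set ℂ} (hU : IsOpen U)
    (hUc : IsConnected U) (hV : IsSimplyConnected V) {F : ℂ → ℂ} (hF : DifferentiableOn ℂ F U)
    (hm : MapsTo F U V) (hinj : ∀ x ∈ U, ∃ O ∈ 𝓝 x, InjOn F O)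
    (hcl : ∀ γ : ℝ → ℂ, Continuous γ → (∀ t, γ t ∈ V) → ∀ τ : ℝ, 0 < τ → ∀ Γ : ℝ → ℂ,
      ContinuousOn Γ (Ico 0 τ) → (∀ s ∈ Ico 0 τ, Γ s ∈ U ∧ F (Γ s) = γ s) →
      ∃ x ∈ U, MapClusterPt x (𝓝[<] τ) Γ) :
    IsSimplyConnected U ∧ IsProperOfDegreeLE F U V 1 := by
  have hloc : IsLocalHomeomorph (fun z : U => F z) := by
    rw [isLocalHomeomorph_iff_isLocalHomeomorphOn_univ]
    exact isLocalHomeomorphOn_of_injOn hU hF fun x _ => hinj x x.2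
  have : PathConnectedSpace U := isPathConnected_iff_pathConnectedSpace.1
    (hU.isConnected_iff_isPathConnected.1 hUc)
  obtain ⟨hi, hr⟩ := injective_and_range_eq_of_isLiftOn hloc hV (fun x => hm x.2)
    fun γ hγ hγV e he => exists_isLiftOn hloc hγ he zero_le_one fun τ hτ Γ hΓ hΓl => by
      obtain ⟨x, hx, hxc⟩ := hcl γ hγ hγV τ hτ.1 (fun s => Γ s)
        (continuous_subtype_val.comp_continuousOn hΓ) fun s hs => ⟨(Γ s).2, hΓl s hs⟩
      refine ⟨⟨x, hx⟩, ?_⟩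
      rw [mapClusterPt_iff_frequently] at hxc ⊢
      intro s hs
      obtain ⟨t, ht, hts⟩ := mem_nhds_subtype _ _ _ |>.1 hs
      exact (hxc t ht).mono fun a ha => hts ha
  have hemb : Topology.IsOpenEmbedding (fun z : U => F z) := hloc.isOpenEmbedding_of_injective hi
  let e : U ≃ₜ V := hemb.isEmbedding.toHomeomorph.trans (Homeomorph.setCongr hr)
  have he : hm.restrict F U V = e := rfl
  refine ⟨e.toHomotopyEquiv.simplyConnectedSpace_iff.2 hV, ⟨hm, he ▸ e.isProperMap⟩,
    fun y _ => ?_⟩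
  rw [Nat.cast_one, encard_le_one_iff]
  rintro a b ⟨ha, hay⟩ ⟨hb, hby⟩
  have : F a = F b := by rw [mem_singleton_iff.1 hay, mem_singleton_iff.1 hby]
  exact congrArg Subtype.val (@hi ⟨a, ha⟩ ⟨b, hb⟩ this)

/-- Properness confines the partial lifts of a path to the compact preimage of its trace, so they
cannot escape. -/
theorem IsProperOfDegreeLE.isSimplyConnected_of_unbranched {U V : Set ℂ} (hU : IsOpen U)
    (hUc : IsConnected U) (hV : IsSimplyConnected V) {F : ℂ → ℂ} (hF : DifferentiableOn ℂ F U)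
    {d : ℕ} (hp : IsProperOfDegreeLE F U V d) (hinj : ∀ x ∈ U, ∃ O ∈ 𝓝 x, InjOn F O) :
    IsSimplyConnected U ∧ IsProperOfDegreeLE F U V 1 := by
  refine isSimplyConnected_and_isProperOfDegreeLE_one hU hUc hV hF hp.mapsTo hinj ?_
  intro γ hγ hγV τ hτ Γ hΓ hΓl
  have hK := hp.isCompact_inter_preimage (K := γ '' Icc 0 τ)
    (by rintro _ ⟨t, -, rfl⟩; exact hγV t) (isCompact_Icc.image hγ)
  have hev : ∀ᶠ s in 𝓝[<] τ, Γ s ∈ U ∩ F ⁻¹' (γ '' Icc 0 τ) := by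
    filter_upwards [Ico_mem_nhdsLT hτ] with s hs
    exact ⟨(hΓl s hs).1, s, ⟨hs.1, hs.2.le⟩, (hΓl s hs).2.symm⟩
  obtain ⟨x, hx, hxc⟩ := hK.exists_mapClusterPt (tendsto_principal.2 hev)
  exact ⟨x, hx.1, hxc⟩

/-- A branched covering of a simply connected domain with one branched value has simply connected
total space. -/
theorem IsProperOfDegreeLE.isSimplyConnected_of_branched {U V : Set ℂ} (hU : IsOpen U)
    (hUc : IsConnected U) (hVo : IsOpen V) (hV : IsSimplyConnected V) (hVne : V ≠ univ)
    {F : ℂ → ℂ} (hF : DifferentiableOn ℂ F U) {d : ℕ} (hp : IsProperOfDegreeLE F U V d) {s : ℂ}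
    (hs : s ∈ V) (hinj : ∀ x ∈ U, F x ≠ s → ∃ O ∈ 𝓝 x, InjOn F O) : IsSimplyConnected U := by
  -- A Riemann map of `V` that sends the branched value to `0` reduces the claim to the unit disk
  -- and its radial flow.
  obtain ⟨φ, ψ, hφd, hφm, hψd, hψm, hψφ, hφψ, hφs⟩ := exists_riemannMap hVo hV hVne hs
  have hφi : InjOn φ V := fun x hx y hy h => by rw [← hψφ x hx, h, hψφ y hy]
  have hφ0 : ∀ x ∈ U, φ (F x) = 0 ↔ F x = s := fun x hx =>
    ⟨fun h => hφi (hp.mapsTo hx) hs (h.trans hφs.symm), fun h => by rw [h, hφs]⟩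
  have hhd : DifferentiableOn ℂ (φ ∘ F) U := hφd.comp hF hp.mapsTo
  have : ConnectedSpace U := isConnected_iff_connectedSpace.1 hUc
  have hfib : ∀ K : Set ℂ, K ⊆ Metric.ball 0 1 →
      (fun z : U => (φ ∘ F) z) ⁻¹' K = (↑) ⁻¹' (U ∩ F ⁻¹' (ψ '' K)) := fun K hK => by
    ext x
    constructor
    · exact fun hx => ⟨x.2, _, hx, hψφ _ (hp.mapsTo x.2)⟩
    · rintro ⟨-, w, hw, hwx⟩
      change φ (F x) ∈ K
      rwa [← hwx, hφψ w (hK hw)]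
  have := contractibleSpace_of_isLocalHomeomorphOn (h := fun z : U => (φ ∘ F) z)
    (continuousOn_iff_continuous_domRestrict.1 hhd.continuousOn) (fun x => hφm (hp.mapsTo x.2))
    (fun K hK hKc => by
      rw [hfib K hK]
      refine Topology.IsInducing.subtypeVal.isCompact_preimage' ?_ (by simp)
      refine hp.isCompact_inter_preimage ?_ (hKc.image_of_continuousOn (hψd.continuousOn.mono hK))
      rintro _ ⟨w, hw, rfl⟩
      exact hψm (hK hw))
    (by
      rw [hfib {0} (by simp), image_singleton, ← hφs, hψφ s hs]
      exact (hp.finite_fiber hs).preimage Subtype.val_injective.injOn)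
    (isLocalHomeomorphOn_of_injOn hU hhd fun x hx => by
      obtain ⟨O, hO, hOi⟩ := hinj x x.2 fun h => hx ((hφ0 x x.2).2 h)
      refine ⟨O ∩ U, inter_mem hO (hU.mem_nhds x.2), fun a ha b hb hab => ?_⟩
      exact hOi ha.1 hb.1 (hφi (hp.mapsTo ha.2) (hp.mapsTo hb.2) hab))
  exact SimplyConnectedSpace.ofContractible _

/-- The degree bound is a bound on the number of points in fibres, so no multiplicities enter: a
fibre of `g ∘ f` is a union of at most `d'` fibres of `f`. -/
theorem IsProperOfDegreeLE.comp {Y : Type*} [TopologicalSpace Y] {f g : Y → Y} {U V W : Set Y}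
    {d d' : ℕ} (hg : IsProperOfDegreeLE g V W d') (hf : IsProperOfDegreeLE f U V d) :
    IsProperOfDegreeLE (g ∘ f) U W (d * d') := by
  obtain ⟨⟨hgm, hgp⟩, hgd⟩ := hg
  obtain ⟨⟨hfm, hfp⟩, hfd⟩ := hf
  refine ⟨⟨hgm.comp hfm, hgp.comp hfp⟩, fun y hy => ?_⟩
  have hfin := Set.finite_of_encard_le_coe (hgd y hy)
  have hsub : U ∩ (g ∘ f) ⁻¹' {y} ⊆ ⋃ v ∈ hfin.toFinset, U ∩ f ⁻¹' {v} := fun x hx =>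
    mem_biUnion (hfin.mem_toFinset.2 ⟨hfm hx.1, hx.2⟩) ⟨hx.1, rfl⟩
  refine (encard_le_encard hsub).trans ?_
  have hcard : hfin.toFinset.card ≤ d' := by
    have := hgd y hy
    rw [hfin.encard_eq_coe_toFinset_card] at this
    exact_mod_cast this
  have hle : ∀ s : Finset Y, (∀ v ∈ s, v ∈ V) →
      (⋃ v ∈ s, U ∩ f ⁻¹' {v}).encard ≤ s.card * d := by
    classical
    intro s
    induction s using Finset.induction_on with
    | empty => simp
    | insert a s ha ih =>
      intro hs
      rw [Finset.set_biUnion_insert, Finset.card_insert_of_notMem ha]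
      refine (encard_union_le _ _).trans ?_
      push_cast
      rw [add_mul, one_mul, add_comm]
      exact add_le_add (ih fun v hv => hs v (Finset.mem_insert_of_mem hv))
        (hfd a (hs a (Finset.mem_insert_self _ _)))
  refine (hle _ fun v hv => (hfin.mem_toFinset.1 hv).1).trans ?_
  rw [mul_comm]
  push_cast
  gcongr

end Planar

/-! ### The plane inside the sphere -/

section SphereTransfer

theorem coe_mem_toSphere {A : Set ℂ} {z : ℂ} : (z : Sphere) ∈ toSphere A ↔ z ∈ A :=
  OnePoint.coe_injective.mem_set_image

theorem infty_notMem_toSphere {A : Set ℂ} : OnePoint.infty ∉ toSphere A := by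
  rintro ⟨z, -, hz⟩
  exact OnePoint.coe_ne_infty z hz

theorem setOf_coe_mem_toSphere (A : Set ℂ) : {z : ℂ | (z : Sphere) ∈ toSphere A} = A :=
  ext fun _ => coe_mem_toSphere

theorem toSphere_mono {A B : Set ℂ} (h : A ⊆ B) : toSphere A ⊆ toSphere B := image_mono h

theorem connectedComponentIn_toSphere {B : Set ℂ} {x : ℂ} (hx : x ∈ B) :
    connectedComponentIn (toSphere B) (x : Sphere) = toSphere (connectedComponentIn B x) := by
  have hx' : (x : Sphere) ∈ toSphere B := coe_mem_toSphere.2 hx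
  refine Subset.antisymm ?_ ?_
  · have hsub := connectedComponentIn_subset (toSphere B) (x : Sphere)
    intro y hy
    obtain ⟨z, hz, rfl⟩ := hsub hy
    refine coe_mem_toSphere.2 ?_
    have hpre : IsPreconnected ((fun z : ℂ => (z : Sphere)) ⁻¹'
        connectedComponentIn (toSphere B) (x : Sphere)) := by
      rw [← OnePoint.isOpenEmbedding_coe.isEmbedding.isInducing.isPreconnected_image,
        image_preimage_eq_of_subset (hsub.trans (image_subset_range _ _))]
      exact isPreconnected_connectedComponentIn
    exact hpre.subset_connectedComponentIn (mem_connectedComponentIn hx')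
      (fun w hw => coe_mem_toSphere.1 (hsub hw)) hy
  · exact (isPreconnected_connectedComponentIn.image _
      OnePoint.continuous_coe.continuousOn).subset_connectedComponentIn
      (mem_image_of_mem _ (mem_connectedComponentIn hx))
      (toSphere_mono (connectedComponentIn_subset _ _))

theorem isComponentOf_toSphere_iff {U' : Set Sphere} {B : Set ℂ} :
    IsComponentOf U' (toSphere B) ↔ ∃ U, IsComponentOf U B ∧ U' = toSphere U := by
  constructor
  · rintro ⟨_, ⟨x, hx, rfl⟩, rfl⟩
    exact ⟨_, ⟨x, hx, rfl⟩, connectedComponentIn_toSphere hx⟩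
  · rintro ⟨_, ⟨x, hx, rfl⟩, rfl⟩
    exact ⟨x, coe_mem_toSphere.2 hx, (connectedComponentIn_toSphere hx).symm⟩

theorem isSimplyConnected_toSphere_iff {U : Set ℂ} :
    IsSimplyConnected (toSphere U) ↔ IsSimplyConnected U :=
  OnePoint.isOpenEmbedding_coe.isEmbedding.isSimplyConnected_image

theorem isProperOfDegreeLE_toSphere_iff {G : Sphere → Sphere} {g : ℂ → ℂ} {U V : Set ℂ} {d : ℕ}
    (h : ∀ z ∈ U, G z = (g z : Sphere)) :
    IsProperOfDegreeLE G (toSphere U) (toSphere V) d ↔ IsProperOfDegreeLE g U V d := by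
  have hm : MapsTo G (toSphere U) (toSphere V) ↔ MapsTo g U V := by
    constructor
    · intro hG z hz
      have := hG (coe_mem_toSphere.2 hz)
      rwa [h z hz, coe_mem_toSphere] at this
    · rintro hg _ ⟨z, hz, rfl⟩
      simp only [h z hz]
      exact coe_mem_toSphere.2 (hg hz)
  have hfib : ∀ y : ℂ, (toSphere U ∩ G ⁻¹' {(y : Sphere)}).encard = (U ∩ g ⁻¹' {y}).encard := by
    intro y
    rw [← (OnePoint.coe_injective (X := ℂ)).injOn.encard_image]
    congr 1
    ext x
    constructor
    · rintro ⟨⟨z, hz, rfl⟩, hx⟩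
      have hx' : (g z : Sphere) = y := (h z hz).symm.trans hx
      exact ⟨z, ⟨hz, OnePoint.coe_injective hx'⟩, rfl⟩
    · rintro ⟨z, ⟨hz, hgz⟩, rfl⟩
      exact ⟨mem_image_of_mem _ hz, (h z hz).trans (congrArg _ hgz)⟩
  let e : ∀ A : Set ℂ, A ≃ₜ toSphere A :=
    fun A => OnePoint.isOpenEmbedding_coe.isEmbedding.homeomorphImage A
  have hprop : ∀ (h1 : MapsTo G (toSphere U) (toSphere V)) (h2 : MapsTo g U V),
      IsProperMap (h1.restrict G _ _) ↔ IsProperMap (h2.restrict g U V) := by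
    intro h1 h2
    have hcomm : h1.restrict G _ _ ∘ e U = e V ∘ h2.restrict g U V := by
      ext z
      exact h z z.2
    constructor
    · intro hp
      have : h2.restrict g U V = (e V).symm ∘ (h1.restrict G _ _ ∘ e U) := by
        rw [hcomm]; ext z; simp
      rw [this]
      exact (e V).symm.isProperMap.comp (hp.comp (e U).isProperMap)
    · intro hp
      have : h1.restrict G _ _ = (e V ∘ h2.restrict g U V) ∘ (e U).symm := by
        rw [← hcomm]; ext z; simp
      rw [this]
      exact ((e V).isProperMap.comp hp).comp (e U).symm.isProperMap
  constructor
  · rintro ⟨⟨h1, h2⟩, h3⟩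
    exact ⟨⟨hm.1 h1, (hprop h1 (hm.1 h1)).1 h2⟩,
      fun y hy => (hfib y).symm.le.trans (h3 _ (coe_mem_toSphere.2 hy))⟩
  · rintro ⟨⟨h1, h2⟩, h3⟩
    refine ⟨⟨hm.2 h1, (hprop (hm.2 h1) h1).2 h2⟩, ?_⟩
    rintro _ ⟨y, hy, rfl⟩
    exact (hfib y).le.trans (h3 _ hy)

end SphereTransfer

/-! ### Connected components -/

section Components

variable {Y : Type*} [TopologicalSpace Y] {U A : Set Y}

theorem IsComponentOf.subset (h : IsComponentOf U A) : U ⊆ A := by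
  obtain ⟨x, -, rfl⟩ := h
  exact connectedComponentIn_subset _ _

theorem IsComponentOf.isConnected (h : IsComponentOf U A) : IsConnected U := by
  obtain ⟨x, hx, rfl⟩ := h
  exact isConnected_connectedComponentIn_iff.2 hx

theorem IsComponentOf.isOpen [LocallyConnectedSpace Y] (h : IsComponentOf U A) (hA : IsOpen A) :
    IsOpen U := by
  obtain ⟨x, hx, rfl⟩ := h
  exact hA.connectedComponentIn

theorem IsComponentOf.eq_connectedComponentIn (h : IsComponentOf U A) {x : Y} (hx : x ∈ U) :
    U = connectedComponentIn A x := by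
  obtain ⟨y, hy, rfl⟩ := h
  exact connectedComponentIn_eq hx

theorem IsComponentOf.subset_of_isPreconnected (h : IsComponentOf U A) {B : Set Y}
    (hB : IsPreconnected B) (hBA : B ⊆ A) (hUB : (U ∩ B).Nonempty) : B ⊆ U := by
  obtain ⟨x, hxU, hxB⟩ := hUB
  rw [h.eq_connectedComponentIn hxU]
  exact hB.subset_connectedComponentIn hxB hBA

theorem IsComponentOf.of_subset_of_subset (h : IsComponentOf U A) {B : Set Y} (hUB : U ⊆ B)
    (hBA : B ⊆ A) : IsComponentOf U B := by
  obtain ⟨x, hx⟩ := h.isConnected.nonempty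
  refine ⟨x, hUB hx, Subset.antisymm
    (h.isConnected.isPreconnected.subset_connectedComponentIn hx hUB) ?_⟩
  exact h.subset_of_isPreconnected isPreconnected_connectedComponentIn
    ((connectedComponentIn_subset _ _).trans hBA) ⟨x, hx, mem_connectedComponentIn (hUB hx)⟩

/-- Components are relatively closed. This keeps limits of lifted paths, and limits of points in
fibres, inside the component. -/
theorem IsComponentOf.mem_of_mem_closure (h : IsComponentOf U A) {x : Y} (hx : x ∈ closure U)
    (hxA : x ∈ A) : x ∈ U := by
  have hc : IsPreconnected (insert x U) :=
    h.isConnected.isPreconnected.subset_closure (subset_insert _ _)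
      (insert_subset hx subset_closure)
  obtain ⟨y, hy⟩ := h.isConnected.nonempty
  exact h.subset_of_isPreconnected hc (insert_subset hxA h.subset)
    ⟨y, hy, mem_insert_of_mem _ hy⟩ (mem_insert _ _)

end Components

/-! ### The finite part of a meromorphic function -/

section FinitePart

/-- The finite part of a point of the sphere, with the junk value `0` at `∞`. -/
def finPart : Sphere → ℂ
  | OnePoint.infty => 0
  | OnePoint.some z => z

/-- A function with values in the sphere, as a function with values in the plane. -/
def planeMap (f : ℂ → Sphere) (z : ℂ) : ℂ := finPart (f z)

/-- The preimage of a set of the plane, as a set of the plane. -/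
def planePreimage (f : ℂ → Sphere) (A : Set ℂ) : Set ℂ := {z | f z ∈ toSphere A}

/-- The iterated preimage of a set of the plane, along orbits that stay in the plane. -/
def planeIterPreimage (f : ℂ → Sphere) : ℕ → Set ℂ → Set ℂ
  | 0, A => A
  | n + 1, A => planePreimage f (planeIterPreimage f n A)

variable {f : ℂ → Sphere} {X : Set Sphere} {Ω A B : Set ℂ}

@[simp] theorem finPart_coe (z : ℂ) : finPart (z : Sphere) = z := rfl

@[simp] theorem sphereMap_coe (z : ℂ) : sphereMap f (z : Sphere) = f z := rfl

theorem coe_planeMap {z : ℂ} (h : f z ≠ OnePoint.infty) : (planeMap f z : Sphere) = f z := by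
  obtain ⟨w, hw⟩ := OnePoint.ne_infty_iff_exists.1 h
  rw [planeMap, ← hw, finPart_coe]

theorem ne_infty_of_mem_planePreimage {z : ℂ} (hz : z ∈ planePreimage f A) :
    f z ≠ OnePoint.infty := fun h => by
  rw [planePreimage, mem_ofPred_eq, h] at hz
  exact infty_notMem_toSphere hz

theorem mapsTo_planeMap : MapsTo (planeMap f) (planePreimage f A) A := fun z hz => by
  have h : f z ∈ toSphere A := hz
  rwa [← coe_planeMap (ne_infty_of_mem_planePreimage hz), coe_mem_toSphere] at h

theorem mem_planePreimage_iff {z : ℂ} :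
    z ∈ planePreimage f A ↔ f z ≠ OnePoint.infty ∧ planeMap f z ∈ A := by
  refine ⟨fun h => ⟨ne_infty_of_mem_planePreimage h, mapsTo_planeMap h⟩, fun h => ?_⟩
  change f z ∈ toSphere A
  rw [← coe_planeMap h.1]
  exact coe_mem_toSphere.2 h.2

theorem planePreimage_mono (h : A ⊆ B) : planePreimage f A ⊆ planePreimage f B :=
  fun _ hz => toSphere_mono h hz

theorem planeIterPreimage_mono (n : ℕ) (h : A ⊆ B) :
    planeIterPreimage f n A ⊆ planeIterPreimage f n B := by
  induction n with
  | zero => exact h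
  | succ n ih => exact planePreimage_mono ih

/-! ### Continuity and holomorphy of the finite part -/

theorem continuous_sphereInv : Continuous sphereInv := by
  rw [continuous_iff_continuousAt]
  intro w
  by_cases hw : w = 0
  · subst hw
    have h0 : sphereInv 0 = OnePoint.infty := by simp [sphereInv]
    rw [ContinuousAt, h0, ← nhdsNE_sup_pure, tendsto_sup]
    constructor
    · have h1 : Tendsto (fun w : ℂ => ((w⁻¹ : ℂ) : Sphere)) (𝓝[≠] 0) (𝓝 OnePoint.infty) := by
        refine OnePoint.tendsto_coe_infty.comp ?_
        rw [coclosedCompact_eq_cocompact, ← Metric.cobounded_eq_cocompact]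
        exact tendsto_inv₀_nhdsNE_zero
      refine h1.congr' ?_
      filter_upwards [self_mem_nhdsWithin] with w hw
      simp only [mem_compl_iff, mem_singleton_iff] at hw
      simp [sphereInv, hw]
    · rw [tendsto_pure_left]
      intro s hs
      rw [h0]
      exact mem_of_mem_nhds hs
  · have h1 : ContinuousAt (fun w : ℂ => ((w⁻¹ : ℂ) : Sphere)) w :=
      OnePoint.continuous_coe.continuousAt.comp (continuousAt_inv₀ hw)
    refine h1.congr ?_
    filter_upwards [isOpen_ne.mem_nhds hw] with z hz
    simp [sphereInv, hz]

theorem finPart_sphereInv (w : ℂ) : finPart (sphereInv w) = w⁻¹ := by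
  by_cases hw : w = 0
  · simp only [sphereInv, hw, if_true, inv_zero]
    rfl
  · simp [sphereInv, hw]

theorem IsMeromorphicToSphere.continuous (hf : IsMeromorphicToSphere f) : Continuous f := by
  rw [continuous_iff_continuousAt]
  intro z
  obtain ⟨g, hg, h | h⟩ := hf z
  · exact (OnePoint.continuous_coe.continuousAt.comp hg.continuousAt).congr (h.mono fun _ => Eq.symm)
  · exact (continuous_sphereInv.continuousAt.comp hg.continuousAt).congr (h.mono fun _ => Eq.symm)

theorem IsMeromorphicToSphere.differentiableAt_planeMap (hf : IsMeromorphicToSphere f) {z : ℂ}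
    (hz : f z ≠ OnePoint.infty) : DifferentiableAt ℂ (planeMap f) z := by
  obtain ⟨g, hg, h | h⟩ := hf z
  · exact hg.differentiableAt.congr_of_eventuallyEq
      (h.mono fun w hw => by rw [planeMap, hw, finPart_coe])
  · have h0 : g z ≠ 0 := fun h0 => hz (by rw [h.self_of_nhds, h0]; simp [sphereInv])
    exact (hg.differentiableAt.inv h0).congr_of_eventuallyEq
      (h.mono fun w hw => by rw [planeMap, hw, finPart_sphereInv]; rfl)

theorem IsMeromorphicToSphere.differentiableOn_planeMap (hf : IsMeromorphicToSphere f) (A : Set ℂ) :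
    DifferentiableOn ℂ (planeMap f) (planePreimage f A) := fun _ hz =>
  (hf.differentiableAt_planeMap (ne_infty_of_mem_planePreimage hz)).differentiableWithinAt

theorem IsMeromorphicToSphere.isOpen_planePreimage (hf : IsMeromorphicToSphere f) (hA : IsOpen A) :
    IsOpen (planePreimage f A) :=
  (OnePoint.isOpenEmbedding_coe.isOpenMap A hA).preimage hf.continuous

theorem IsMeromorphicToSphere.isOpen_planeIterPreimage (hf : IsMeromorphicToSphere f)
    (hA : IsOpen A) (n : ℕ) : IsOpen (planeIterPreimage f n A) := by
  induction n with
  | zero => exact hA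
  | succ n ih => exact hf.isOpen_planePreimage ih

theorem mapsTo_planeMap_iterate (n : ℕ) :
    MapsTo (planeMap f)^[n] (planeIterPreimage f n A) A := by
  induction n with
  | zero => exact fun z hz => hz
  | succ n ih => exact fun z hz => ih (mapsTo_planeMap hz)

theorem IsMeromorphicToSphere.differentiableOn_iterate (hf : IsMeromorphicToSphere f) (A : Set ℂ)
    (n : ℕ) : DifferentiableOn ℂ (planeMap f)^[n] (planeIterPreimage f n A) := by
  induction n with
  | zero => exact differentiableOn_id
  | succ n ih =>
    rw [Function.iterate_succ]
    exact ih.comp (hf.differentiableOn_planeMap _) mapsTo_planeMap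

theorem sphereMap_iterate_coe (n : ℕ) {z : ℂ} (hz : z ∈ planeIterPreimage f n A) :
    (sphereMap f)^[n] (z : Sphere) = ((planeMap f)^[n] z : Sphere) := by
  induction n generalizing z with
  | zero => rfl
  | succ n ih =>
    rw [Function.iterate_succ_apply, Function.iterate_succ_apply, sphereMap_coe,
      ← coe_planeMap (ne_infty_of_mem_planePreimage hz), ih (mapsTo_planeMap hz)]

/-! ### Orbits on the sphere and reduction to the plane -/

theorem IsDomainOfDefinition.coe_mem (hX : IsDomainOfDefinition f X) (z : ℂ) : (z : Sphere) ∈ X := by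
  obtain rfl | ⟨rfl, -⟩ := hX
  · exact OnePoint.coe_ne_infty z
  · exact mem_univ _

theorem iterDefined_succ {n : ℕ} {x : Sphere} :
    IterDefined f X (n + 1) x ↔ x ∈ X ∧ IterDefined f X n (sphereMap f x) := by
  constructor
  · exact fun h => ⟨h 0 n.succ_pos, fun k hk => h (k + 1) (Nat.succ_lt_succ hk)⟩
  · rintro ⟨h0, h⟩ k hk
    cases k with
    | zero => exact h0
    | succ k => exact h k (Nat.lt_of_succ_lt_succ hk)

theorem iterDefined_succ' {n : ℕ} {x : Sphere} :
    IterDefined f X (n + 1) x ↔ IterDefined f X n x ∧ (sphereMap f)^[n] x ∈ X :=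
  ⟨fun h => ⟨fun k hk => h k (hk.trans n.lt_succ_self), h n n.lt_succ_self⟩, fun h k hk =>
    (Nat.lt_succ_iff_lt_or_eq.1 hk).elim (h.1 k) fun e => e ▸ h.2⟩

theorem mem_iterPreimage_succ {n : ℕ} {E : Set Sphere} {x : Sphere} :
    x ∈ iterPreimage f X (n + 1) E ↔ x ∈ X ∧ sphereMap f x ∈ iterPreimage f X n E := by
  simp only [iterPreimage, mem_ofPred_eq, iterDefined_succ, Function.iterate_succ_apply, and_assoc]

theorem mem_iterPreimage_one {E : Set Sphere} {x : Sphere} :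
    x ∈ iterPreimage f X 1 E ↔ x ∈ X ∧ sphereMap f x ∈ E := by
  rw [mem_iterPreimage_succ]
  simp [iterPreimage, IterDefined]

/-- Otherwise `∞` would belong to `f⁻¹(Ω) ⊆ Ω ⊆ ℂ`. This confines all pullbacks to the plane even if
`X` is the sphere. -/
theorem sphereMap_infty_notMem (hb : iterPreimage f X 1 (toSphere Ω) ⊆ toSphere Ω)
    (hX : OnePoint.infty ∈ X) : sphereMap f OnePoint.infty ∉ toSphere Ω := fun h =>
  infty_notMem_toSphere (hb (mem_iterPreimage_one.2 ⟨hX, h⟩))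

theorem planePreimage_subset (hX : IsDomainOfDefinition f X)
    (hb : iterPreimage f X 1 (toSphere Ω) ⊆ toSphere Ω) : planePreimage f Ω ⊆ Ω := fun z hz =>
  coe_mem_toSphere.1 (hb (mem_iterPreimage_one.2 ⟨hX.coe_mem z, hz⟩))

theorem planeIterPreimage_subset (hX : IsDomainOfDefinition f X)
    (hb : iterPreimage f X 1 (toSphere Ω) ⊆ toSphere Ω) (hA : A ⊆ Ω) (n : ℕ) :
    planeIterPreimage f n A ⊆ Ω := by
  induction n with
  | zero => exact hA
  | succ n ih => exact (planePreimage_mono ih).trans (planePreimage_subset hX hb)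

theorem iterPreimage_toSphere (hX : IsDomainOfDefinition f X)
    (hb : iterPreimage f X 1 (toSphere Ω) ⊆ toSphere Ω) (hA : A ⊆ Ω) (n : ℕ) :
    iterPreimage f X n (toSphere A) = toSphere (planeIterPreimage f n A) := by
  induction n with
  | zero => ext x; simp [iterPreimage, IterDefined, planeIterPreimage]
  | succ n ih =>
    ext x
    rw [mem_iterPreimage_succ, ih]
    induction x using OnePoint.rec with
    | infty =>
      refine ⟨fun h => ?_, fun h => absurd h infty_notMem_toSphere⟩
      exact absurd (toSphere_mono (planeIterPreimage_subset hX hb hA n) h.2)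
        (sphereMap_infty_notMem hb h.1)
    | coe z =>
      rw [coe_mem_toSphere]
      exact ⟨fun h => h.2, fun h => ⟨hX.coe_mem z, h⟩⟩

theorem iterPreimage_one_toSphere (hX : IsDomainOfDefinition f X)
    (hb : iterPreimage f X 1 (toSphere Ω) ⊆ toSphere Ω) (hA : A ⊆ Ω) :
    iterPreimage f X 1 (toSphere A) = toSphere (planePreimage f A) :=
  iterPreimage_toSphere hX hb hA 1

/-- A component of the preimage is a component of the preimage of a component. -/
theorem IsComponentOf.exists_planePreimage (hf : IsMeromorphicToSphere f) {U : Set ℂ}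
    (hU : IsComponentOf U (planePreimage f A)) :
    ∃ V, IsComponentOf V A ∧ IsComponentOf U (planePreimage f V) := by
  obtain ⟨y, hy⟩ := hU.isConnected.nonempty
  have hyA := mapsTo_planeMap (hU.subset hy)
  refine ⟨connectedComponentIn A (planeMap f y), ⟨_, hyA, rfl⟩,
    hU.of_subset_of_subset (fun x hx => ?_) (planePreimage_mono (connectedComponentIn_subset _ _))⟩
  rw [mem_planePreimage_iff]
  refine ⟨ne_infty_of_mem_planePreimage (hU.subset hx), ?_⟩
  exact (hU.isConnected.isPreconnected.image _
    ((hf.differentiableOn_planeMap A).continuousOn.mono hU.subset)).subset_connectedComponentIn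
    (mem_image_of_mem _ hy) (image_subset_iff.2 fun z hz => mapsTo_planeMap (hU.subset hz))
    (mem_image_of_mem _ hx)

/-! ### Critical points and the postsingular set -/

theorem exists_injOn_planeMap (hf : IsMeromorphicToSphere f) (hX : IsDomainOfDefinition f X) {z : ℂ}
    (hz : f z ≠ OnePoint.infty) (hc : ¬ IsCriticalPoint f X z) :
    ∃ O ∈ 𝓝 z, InjOn (planeMap f) O := by
  have h1 : ∃ O ∈ 𝓝 (z : Sphere), InjOn (sphereMap f) O := by
    by_contra h
    exact hc ⟨hX.coe_mem z, h⟩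
  obtain ⟨O, hO, hi⟩ := h1
  refine ⟨(fun w : ℂ => (w : Sphere)) ⁻¹' O ∩ {w | f w ≠ OnePoint.infty}, inter_mem
    (OnePoint.continuous_coe.continuousAt.preimage_mem_nhds hO)
    (hf.continuous.continuousAt.preimage_mem_nhds (isOpen_ne.mem_nhds hz)), ?_⟩
  intro a ha b hb hab
  refine OnePoint.coe_injective (hi ha.1 hb.1 ?_)
  rw [sphereMap_coe, sphereMap_coe, ← coe_planeMap ha.2, ← coe_planeMap hb.2, hab]

theorem singularValues_subset_postsingularSet : singularValues f X ⊆ postsingularSet f X :=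
  fun s hs => subset_closure ⟨s, hs, 0, fun _ hk => absurd hk (Nat.not_lt_zero _), rfl⟩

theorem IsCriticalPoint.mem_postsingularSet {c : Sphere} (h : IsCriticalPoint f X c) :
    sphereMap f c ∈ postsingularSet f X :=
  singularValues_subset_postsingularSet (subset_closure (Or.inl ⟨c, mem_univ _, h, rfl⟩))

/-- Forward invariance of `P(f)` at finite points. Since `X` is a neighbourhood of `z`, the singular
orbits that accumulate at `z` can be continued by one step, and continuity of `f` passes to the
closure. -/
theorem mem_postsingularSet_of_coe_mem (hf : IsMeromorphicToSphere f)
    (hX : IsDomainOfDefinition f X) {z : ℂ} (hz : (z : Sphere) ∈ postsingularSet f X) :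
    f z ∈ postsingularSet f X := by
  have hXn : X ∈ 𝓝 (z : Sphere) := by
    rw [OnePoint.nhds_coe_eq]
    exact mem_map.2 (univ_mem' hX.coe_mem)
  have hcont : Tendsto (sphereMap f) (𝓝 (z : Sphere)) (𝓝 (f z)) := by
    rw [OnePoint.nhds_coe_eq, tendsto_map'_iff]
    exact hf.continuous.continuousAt
  rw [postsingularSet, mem_closure_iff_frequently] at hz ⊢
  refine hcont.frequently ((hz.and_eventually hXn).mono ?_)
  rintro y ⟨⟨s, hs, n, hn, rfl⟩, hy⟩
  exact ⟨s, hs, n + 1, iterDefined_succ'.2 ⟨hn, hy⟩, Function.iterate_succ_apply' _ _ _⟩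

end FinitePart

/-! ### One step of the pullback of simply connected domains -/

section Pullback

variable {f : ℂ → Sphere} {X : Set Sphere} {Ω : Set ℂ} {U V A : Set ℂ}

theorem tendsto_cocompact_of_forall_not_mapClusterPt {α Y : Type*} [TopologicalSpace Y]
    {l : Filter α} {u : α → Y} (h : ∀ x, ¬ MapClusterPt x l u) : Tendsto u l (cocompact Y) := by
  rw [(hasBasis_cocompact (X := Y)).tendsto_right_iff]
  intro K hK
  by_contra hev
  obtain ⟨x, -, hx⟩ := hK.exists_mapClusterPt_of_frequently
    ((not_eventually.1 hev).mono fun _ => not_notMem.1)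
  exact h x hx

/-- The limit of `f` along a curve on `[0, τ)` that leaves the plane is postsingular, if the
domain of definition is the plane. -/
theorem mem_postsingularSet_of_tendsto_cocompact (hX : OnePoint.infty ∉ X) {Γ : ℝ → ℂ} {τ : ℝ}
    (hτ : 0 < τ) (hΓ : ContinuousOn Γ (Ico 0 τ)) (hΓc : Tendsto Γ (𝓝[<] τ) (cocompact ℂ))
    {a : Sphere} (ha : Tendsto (fun t => f (Γ t)) (𝓝[<] τ) (𝓝 a)) :
    a ∈ postsingularSet f X := by
  -- An increasing reparametrisation of `[0, ∞)` by `[0, τ)`, frozen at `0` for negative times,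
  -- turns the curve into one that defines an asymptotic value.
  set c : ℝ → ℝ := fun t => τ - τ / (1 + max t 0) with hc
  have hpos : ∀ t : ℝ, 0 < 1 + max t 0 := fun t => by positivity
  have hcc : Continuous c := by
    refine continuous_const.sub (continuous_const.div (by fun_prop) fun t => (hpos t).ne')
  have hmem : ∀ t, c t ∈ Ico 0 τ := fun t => by
    have h1 : τ / (1 + max t 0) ≤ τ := div_le_self hτ.le (by simp)
    have h2 : 0 < τ / (1 + max t 0) := div_pos hτ (hpos t)
    exact ⟨by simp only [hc]; linarith, by simp only [hc]; linarith⟩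
  have hlim : Tendsto c atTop (𝓝[<] τ) := by
    refine tendsto_nhdsWithin_iff.2 ⟨?_, Eventually.of_forall fun t => (hmem t).2⟩
    have h1 : Tendsto (fun t : ℝ => 1 + max t 0) atTop atTop :=
      tendsto_atTop_mono (fun t => (le_max_left t 0).trans (by linarith)) tendsto_id
    simpa using tendsto_const_nhds.sub (h1.const_div_atTop τ)
  exact singularValues_subset_postsingularSet (subset_closure (Or.inr ⟨hX, fun t => Γ (c t),
    hΓ.comp_continuous hcc hmem, hΓc.comp hlim, ha.comp hlim⟩))

/-- A simply connected domain disjoint from the postsingular set pulls back univalently. -/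
theorem isSimplyConnected_of_disjoint_postsingularSet (hf : IsMeromorphicToSphere f)
    (hX : IsDomainOfDefinition f X) (hb : iterPreimage f X 1 (toSphere Ω) ⊆ toSphere Ω)
    (hVo : IsOpen V) (hV : IsSimplyConnected V) (hVΩ : V ⊆ Ω)
    (hVP : ∀ z ∈ V, (z : Sphere) ∉ postsingularSet f X)
    (hU : IsComponentOf U (planePreimage f V)) :
    IsSimplyConnected U ∧ IsProperOfDegreeLE (planeMap f) U V 1 := by
  have hfne : ∀ x ∈ U, f x ≠ OnePoint.infty := fun x hx =>
    ne_infty_of_mem_planePreimage (hU.subset hx)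
  refine isSimplyConnected_and_isProperOfDegreeLE_one
    (hU.isOpen (hf.isOpen_planePreimage hVo)) hU.isConnected hV
    ((hf.differentiableOn_planeMap V).mono hU.subset)
    (fun x hx => mapsTo_planeMap (hU.subset hx)) ?_ ?_
  · intro x hx
    refine exists_injOn_planeMap hf hX (hfne x hx) fun hc => ?_
    refine hVP _ (mapsTo_planeMap (hU.subset hx)) ?_
    rw [coe_planeMap (hfne x hx)]
    exact hc.mem_postsingularSet
  · intro γ hγ hγV τ hτ Γ hΓ hΓl
    have hIco : Ico 0 τ ∈ 𝓝[<] τ := Ico_mem_nhdsLT hτ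
    have hlim : Tendsto (fun t => f (Γ t)) (𝓝[<] τ) (𝓝 (γ τ : Sphere)) := by
      have h1 : Tendsto (fun t => (γ t : Sphere)) (𝓝[<] τ) (𝓝 (γ τ : Sphere)) :=
        ((OnePoint.continuous_coe.comp hγ).tendsto τ).mono_left nhdsWithin_le_nhds
      refine h1.congr' ?_
      filter_upwards [hIco] with s hs
      rw [← coe_planeMap (hfne _ (hΓl s hs).1), (hΓl s hs).2]
    -- A finite cluster point of the lift lies over `γ τ`, hence in the component. Otherwise the
    -- lift tends to `∞`. Then `γ τ` is an asymptotic value in `V` if `X` is the plane, and `∞` is a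
    -- preimage of a point of `Ω` if `X` is the sphere; both are impossible.
    by_cases hcl : ∃ x, MapClusterPt x (𝓝[<] τ) Γ
    · obtain ⟨x, hx⟩ := hcl
      refine ⟨x, hU.mem_of_mem_closure ?_ ?_, hx⟩
      · refine mem_closure_iff_frequently.2 ?_
        rw [mapClusterPt_iff_frequently] at hx
        refine frequently_iff.2 fun {s} hs => ?_
        obtain ⟨t, hts, ht⟩ := ((hx s hs).and_eventually hIco).exists
        exact ⟨Γ t, hts, (hΓl t ht).1⟩
      · have h1 : MapClusterPt (f x) (𝓝[<] τ) (fun t => f (Γ t)) :=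
          hx.continuousAt_comp hf.continuous.continuousAt
        have h2 : f x = (γ τ : Sphere) :=
          eq_of_nhds_neBot (NeBot.mono h1 (inf_le_inf_left _ hlim))
        change f x ∈ toSphere V
        rw [h2]
        exact coe_mem_toSphere.2 (hγV τ)
    · exfalso
      have hΓc := tendsto_cocompact_of_forall_not_mapClusterPt (not_exists.1 hcl)
      obtain rfl | ⟨rfl, y, hy⟩ := hX
      · exact hVP _ (hγV τ) (mem_postsingularSet_of_tendsto_cocompact (by simp) hτ hΓ hΓc hlim)
      · refine sphereMap_infty_notMem hb (mem_univ _) ?_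
        have h1 : sphereMap f OnePoint.infty = y := hy.limUnder_eq
        rw [h1, tendsto_nhds_unique (hy.comp hΓc) hlim]
        exact coe_mem_toSphere.2 (hVΩ (hγV τ))

/-- `V` is simply connected, `f^n : V → A` is proper, and its branching is controlled by critical
values in `S₀` whose orbits avoid `V`. -/
structure IsControlledPreimage (f : ℂ → Sphere) (X : Set Sphere) (S₀ : Finset Sphere) (D n : ℕ)
    (V A : Set ℂ) : Prop where
  isSimplyConnected : IsSimplyConnected V
  exists_finset : ∃ T ⊆ S₀, IsProperOfDegreeLE (planeMap f)^[n] V A (D ^ T.card) ∧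
    ∀ s ∈ T, ∀ j, IterDefined f X j s → (sphereMap f)^[j] s ∉ toSphere V

variable {S₀ : Finset Sphere} {D n : ℕ} {C : ℝ≥0}

theorem IsControlledPreimage.isProperOfDegreeLE (hD : 1 ≤ D)
    (h : IsControlledPreimage f X S₀ D n V A) :
    IsProperOfDegreeLE (planeMap f)^[n] V A (D ^ S₀.card) := by
  obtain ⟨T, hT, hp, -⟩ := h.exists_finset
  refine ⟨hp.1, fun y hy => (hp.2 y hy).trans ?_⟩
  exact_mod_cast Nat.pow_le_pow_right hD (Finset.card_le_card hT)

/-- A visit of the orbit to `U` at time `j` would be a visit to `V` at time `j + 1`. -/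
theorem notMem_toSphere_of_planePreimage (hX : IsDomainOfDefinition f X)
    (hU : U ⊆ planePreimage f V) {s : Sphere}
    (hs : ∀ j, IterDefined f X j s → (sphereMap f)^[j] s ∉ toSphere V) (j : ℕ)
    (hj : IterDefined f X j s) : (sphereMap f)^[j] s ∉ toSphere U := by
  rintro ⟨u, hu, hus⟩
  refine hs (j + 1) (iterDefined_succ'.2 ⟨hj, hus ▸ hX.coe_mem u⟩) ?_
  rw [Function.iterate_succ_apply', ← hus]
  exact hU hu

/-- A univalent pullback uses up no critical value, so `T` does not change. -/
theorem IsControlledPreimage.of_isProperOfDegreeLE_one (hX : IsDomainOfDefinition f X)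
    (hV : IsControlledPreimage f X S₀ D n V A) (hU : U ⊆ planePreimage f V)
    (h : IsSimplyConnected U ∧ IsProperOfDegreeLE (planeMap f) U V 1) :
    IsControlledPreimage f X S₀ D (n + 1) U A := by
  obtain ⟨T, hT, hp, hav⟩ := hV.exists_finset
  refine ⟨h.1, T, hT, ?_, fun s hs => notMem_toSphere_of_planePreimage hX hU (hav s hs)⟩
  rw [Function.iterate_succ]
  simpa using hp.comp h.2

/-- The pullback of a controlled preimage that is small enough and close to the postsingular set. -/
theorem IsRegularSet.isControlledPreimage_succ (hf : IsMeromorphicToSphere f)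
    (hX : IsDomainOfDefinition f X) (hΩ : IsRegularSet f X S₀ D C Ω) (hA : Bornology.IsBounded A)
    (hVo : IsOpen V) (hVΩ : V ⊆ Ω) (hVd : DifferentiableOn ℂ (planeMap f)^[n] V)
    (hV : IsControlledPreimage f X S₀ D n V A) (hU : IsComponentOf U (planePreimage f V))
    {W E : Set ℂ} (hWΩ : W ⊆ Ω) (hVW : V ⊆ W)
    (hW : hypDiam Ω W ≤ ↑(2 * maneConst (D ^ S₀.card) C))
    (hE : IsComponentOf E (planePreimage f W)) (hUE : U ⊆ E)
    (hEP : ∃ z ∈ E, (z : Sphere) ∈ postsingularSet f X) :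
    IsControlledPreimage f X S₀ D (n + 1) U A := by
  classical
  obtain ⟨hp', hsub, hbr⟩ := hΩ.controlled V hVo hV.isSimplyConnected hVΩ (toSphere U)
    (by
      rw [iterPreimage_one_toSphere hX hΩ.backward_invariant hVΩ]
      exact isComponentOf_toSphere_iff.2 ⟨U, hU, rfl⟩)
    ⟨W, hWΩ, hVW, hW, toSphere E, by
      rw [iterPreimage_one_toSphere hX hΩ.backward_invariant hWΩ]
      exact isComponentOf_toSphere_iff.2 ⟨E, hE, rfl⟩, toSphere_mono hUE, by
      obtain ⟨z, hz, hzP⟩ := hEP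
      exact ⟨z, coe_mem_toSphere.2 hz, hzP⟩⟩
  have hfne : ∀ x ∈ U, f x ≠ OnePoint.infty := fun x hx =>
    ne_infty_of_mem_planePreimage (hU.subset hx)
  have hp : IsProperOfDegreeLE (planeMap f) U V D :=
    (isProperOfDegreeLE_toSphere_iff fun z hz => (coe_planeMap (hfne z hz)).symm).1 hp'
  have hUo := hU.isOpen (hf.isOpen_planePreimage hVo)
  have hFd := (hf.differentiableOn_planeMap V).mono hU.subset
  -- Without branched values the map is univalent, because `V` is simply connected, so the bound `D`
  -- improves to `1`. Only a genuine branched value costs a factor `D`.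
  obtain hem | ⟨s, c, hcU, hc, hcs⟩ := (branchedValues f X (toSphere U)).eq_empty_or_nonempty
  · refine hV.of_isProperOfDegreeLE_one hX hU.subset
      (hp.isSimplyConnected_of_unbranched hUo hU.isConnected hV.isSimplyConnected hFd ?_)
    intro x hx
    refine exists_injOn_planeMap hf hX (hfne x hx) fun hcr => ?_
    have : f x ∈ branchedValues f X (toSphere U) := ⟨x, coe_mem_toSphere.2 hx, hcr, rfl⟩
    rw [hem] at this
    exact this
  · obtain ⟨u, hu, rfl⟩ := hcU
    have hsB : s ∈ branchedValues f X (toSphere U) := ⟨_, coe_mem_toSphere.2 hu, hc, hcs⟩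
    obtain ⟨T, hT, hpT, hav⟩ := hV.exists_finset
    have hfu : f u = s := hcs
    have hsV : s ∈ toSphere V := hfu ▸ hU.subset hu
    -- The orbits of the elements of `T` avoid `V` from time `0` on, whereas `s` lies in `V`. So `s`
    -- is new, and the extra factor `D` is matched by an extra element of `T`.
    have hsT : s ∉ T := fun h => hav s h 0 (fun _ hk => absurd hk (Nat.not_lt_zero _)) hsV
    have hne : V ≠ univ := hpT.ne_univ ⟨_, mapsTo_planeMap (hU.subset hu)⟩ hVd hA
    refine ⟨hp.isSimplyConnected_of_branched hUo hU.isConnected hVo hV.isSimplyConnected hne hFd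
      (mapsTo_planeMap (hU.subset hu)) fun x hx hxs => ?_, insert s T,
      Finset.insert_subset (hbr s hsB).1 hT, ?_, ?_⟩
    · refine exists_injOn_planeMap hf hX (hfne x hx) fun hcr => hxs ?_
      have h1 : f x = f u := hsub ⟨x, coe_mem_toSphere.2 hx, hcr, rfl⟩ (hfu ▸ hsB)
      rw [planeMap, planeMap, h1]
    · rw [Function.iterate_succ, Finset.card_insert_of_notMem hsT, pow_succ']
      exact hpT.comp hp
    · intro t ht
      obtain rfl | ht := Finset.mem_insert.1 ht
      · exact (hbr _ hsB).2
      · exact notMem_toSphere_of_planePreimage hX hU.subset (hav t ht)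

/-- Proper holomorphic maps send components of preimages of domains onto these domains. -/
theorem IsProperOfDegreeLE.subset_image_of_isComponentOf {g : ℂ → ℂ} {B Q : Set ℂ} {d : ℕ}
    (hV : IsOpen V) (hg : DifferentiableOn ℂ g V) (hp : IsProperOfDegreeLE g V B d)
    (hQ : IsOpen Q) (hQc : IsPreconnected Q) (hQB : Q ⊆ B) (hA : IsComponentOf A (V ∩ g ⁻¹' Q)) :
    Q ⊆ g '' A := by
  have hAo : IsOpen A := hA.isOpen (hg.continuousOn.isOpen_inter_preimage hV hQ)
  have hAV : A ⊆ V := hA.subset.trans inter_subset_left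
  have hopen : IsOpen (g '' A) := by
    rw [isOpen_iff_mem_nhds]
    rintro _ ⟨a, ha, rfl⟩
    exact nhds_le_map_of_finite_fiber hV hg (hAV ha)
      (hp.finite_fiber (hp.mapsTo (hAV ha))) (image_mem_map (hAo.mem_nhds ha))
  -- The image of `A` is open, and properness makes it relatively closed in the connected set `Q`.
  refine hQc.subset_of_closure_inter_subset hopen ?_ ?_
  · obtain ⟨a, ha⟩ := hA.isConnected.nonempty
    exact ⟨g a, (hA.subset ha).2, a, ha, rfl⟩
  · rintro q ⟨hq, hqQ⟩
    obtain ⟨K, hK, hKQ, hKc⟩ := local_compact_nhds (hQ.mem_nhds hqQ)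
    have hS := hp.isCompact_inter_preimage (hKQ.trans hQB) hKc
    have hcl : IsClosed (g '' ((V ∩ g ⁻¹' K) ∩ closure A)) :=
      ((hS.inter_right isClosed_closure).image_of_continuousOn
        (hg.continuousOn.mono (inter_subset_left.trans inter_subset_left))).isClosed
    have hq' : q ∈ closure (g '' A ∩ K) := by
      rw [mem_closure_iff_frequently] at hq ⊢
      exact hq.and_eventually hK
    have hsub : g '' A ∩ K ⊆ g '' ((V ∩ g ⁻¹' K) ∩ closure A) := by
      rintro _ ⟨⟨a, ha, rfl⟩, haK⟩
      exact ⟨a, ⟨⟨hAV ha, haK⟩, subset_closure ha⟩, rfl⟩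
    obtain ⟨a, ⟨⟨haV, -⟩, hacl⟩, rfl⟩ := closure_minimal hsub hcl hq'
    exact ⟨a, hA.mem_of_mem_closure hacl ⟨haV, hqQ⟩, rfl⟩

theorem mem_planeIterPreimage_of_iterate_mem {B B' : Set ℂ} (n : ℕ) {z : ℂ}
    (hz : z ∈ planeIterPreimage f n B) (h : (planeMap f)^[n] z ∈ B') :
    z ∈ planeIterPreimage f n B' := by
  induction n generalizing z with
  | zero => exact h
  | succ n ih =>
    exact mem_planePreimage_iff.2 ⟨ne_infty_of_mem_planePreimage hz, ih (mapsTo_planeMap hz) h⟩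

end Pullback

/-! ### The induction on the number of pullbacks -/

section Mane

variable {f : ℂ → Sphere} {X : Set Sphere} {Ω : Set ℂ} {S₀ : Finset Sphere} {D : ℕ} {C : ℝ≥0}

theorem IsComponentOf.eq_ball {z : ℂ} {r : ℝ} {V : Set ℂ}
    (h : IsComponentOf V (Metric.ball z r)) : V = Metric.ball z r := by
  obtain ⟨x, hx⟩ := h.isConnected.nonempty
  exact Subset.antisymm h.subset (h.subset_of_isPreconnected
    (convex_ball z r).isPreconnected Subset.rfl ⟨x, hx, h.subset hx⟩)

theorem isControlledPreimage_zero (z : ℂ) {r : ℝ} (hr : 0 < r) :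
    IsControlledPreimage f X S₀ D 0 (Metric.ball z r) (Metric.ball z r) :=
  ⟨isSimplyConnected_ball z hr, ∅, Finset.empty_subset _, by
    simpa using isProperOfDegreeLE_id (Metric.ball z r) le_rfl, by simp⟩

/-- By forward invariance of `P(f)`, the hypothesis that a pullback meets it descends to all earlier
pullbacks. -/
theorem exists_mem_postsingularSet_of_planePreimage (hf : IsMeromorphicToSphere f)
    (hX : IsDomainOfDefinition f X) {U V : Set ℂ} (hU : U ⊆ planePreimage f V)
    (h : ∃ z ∈ U, (z : Sphere) ∈ postsingularSet f X) :
    ∃ z ∈ V, (z : Sphere) ∈ postsingularSet f X := by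
  obtain ⟨z, hz, hzP⟩ := h
  refine ⟨planeMap f z, mapsTo_planeMap (hU hz), ?_⟩
  rw [coe_planeMap (ne_infty_of_mem_planePreimage (hU hz))]
  exact mem_postsingularSet_of_coe_mem hf hX hzP

/-- The components of `f^{-k}(D_δ(z₀))` that meet the postsingular set are controlled preimages of
hyperbolic diameter at most `C₀`, for all disks `D_δ(z₀)` such that `D_{2δ}(z₀)` is small. -/
def HasSmallPullbacks (f : ℂ → Sphere) (X : Set Sphere) (S₀ : Finset Sphere) (D : ℕ) (C : ℝ≥0)
    (Ω : Set ℂ) (k : ℕ) : Prop :=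
  ∀ (z₀ : ℂ) (δ : ℝ), 0 < δ → Metric.ball z₀ (2 * δ) ⊆ Ω →
    hypDiam Ω (Metric.ball z₀ (2 * δ)) ≤ ↑(maneConst (D ^ S₀.card) C) →
    ∀ V : Set ℂ, IsComponentOf V (planeIterPreimage f k (Metric.ball z₀ δ)) →
      (∃ z ∈ V, (z : Sphere) ∈ postsingularSet f X) →
      IsControlledPreimage f X S₀ D k V (Metric.ball z₀ δ) ∧
        hypDiam Ω V ≤ ↑(maneConst (D ^ S₀.card) C)

/-- Pullbacks of disks of half the radius are controlled if they meet a pullback of the whole disk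
that is controlled. -/
theorem IsRegularSet.isControlledPreimage_half (hf : IsMeromorphicToSphere f)
    (hX : IsDomainOfDefinition f X) (hΩ : IsRegularSet f X S₀ D C Ω) {n : ℕ}
    (ih : ∀ k ≤ n, HasSmallPullbacks f X S₀ D C Ω k) {z₀ w : ℂ} {δ : ℝ} (hδ : 0 < δ)
    (hball : Metric.ball z₀ (2 * δ) ⊆ Ω)
    (hdiam : hypDiam Ω (Metric.ball z₀ (2 * δ)) ≤ ↑(maneConst (D ^ S₀.card) C))
    (hw : w ∈ Metric.ball z₀ δ) (k : ℕ) (hk : k ≤ n + 1) {V V' : Set ℂ}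
    (hV : IsComponentOf V (planeIterPreimage f k (Metric.ball z₀ δ)))
    (hVP : ∃ z ∈ V, (z : Sphere) ∈ postsingularSet f X)
    (hV' : IsComponentOf V' (planeIterPreimage f k (Metric.ball w (δ / 2))))
    (hVV' : (V' ∩ V).Nonempty) :
    IsControlledPreimage f X S₀ D k V' (Metric.ball w (δ / 2)) := by
  induction k generalizing V V' with
  | zero =>
    obtain rfl := hV'.eq_ball
    exact isControlledPreimage_zero w (half_pos hδ)
  | succ k ihk =>
    obtain ⟨V₁, hV₁, hVV₁⟩ := IsComponentOf.exists_planePreimage hf hV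
    obtain ⟨V₁', hV₁', hVV₁'⟩ := IsComponentOf.exists_planePreimage hf hV'
    have hV₁P := exists_mem_postsingularSet_of_planePreimage hf hX hVV₁.subset hVP
    obtain ⟨x, hxV', hxV⟩ := hVV'
    have hmeet : (V₁' ∩ V₁).Nonempty :=
      ⟨planeMap f x, mapsTo_planeMap (hVV₁'.subset hxV'), mapsTo_planeMap (hVV₁.subset hxV)⟩
    have hc := ihk (by omega) hV₁ hV₁P hV₁' hmeet
    -- Twice the half-size disk still lies in `D_{2δ}(z₀)`, so the induction hypothesis also applies
    -- to `D_{δ/2}(w)`.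
    have hballw : Metric.ball w (2 * (δ / 2)) ⊆ Metric.ball z₀ (2 * δ) := by
      rw [Metric.mem_ball] at hw
      exact Metric.ball_subset_ball' (by linarith)
    have hsub : ∀ {z : ℂ} {r : ℝ}, Metric.ball z r ⊆ Ω → ∀ {B : Set ℂ},
        IsComponentOf B (planeIterPreimage f k (Metric.ball z r)) → B ⊆ Ω := fun h _ hB =>
      hB.subset.trans (planeIterPreimage_subset hX hΩ.backward_invariant h k)
    have hV₁Ω : V₁ ⊆ Ω :=
      hsub ((Metric.ball_subset_ball (by linarith)).trans hball) hV₁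
    have hV₁'Ω : V₁' ⊆ Ω :=
      hsub ((Metric.ball_subset_ball (by linarith)).trans (hballw.trans hball)) hV₁'
    have hV₁'o : IsOpen V₁' := hV₁'.isOpen (hf.isOpen_planeIterPreimage Metric.isOpen_ball k)
    -- If `V₁'` meets `P(f)`, both `V₁'` and `V₁` have diameter at most `C₀` by induction, and they
    -- intersect; this is the source of `2C₀`. The set `V'` itself may miss `P(f)`, but the
    -- component of the preimage of `V₁' ∪ V₁` through `x` contains `V`, which does not.
    by_cases hP : ∃ z ∈ V₁', (z : Sphere) ∈ postsingularSet f X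
    · have h1 := (ih k (by omega) w (δ / 2) (half_pos hδ) (hballw.trans hball)
        ((hypDiam_mono hballw).trans hdiam) V₁' hV₁' hP).2
      have h2 := (ih k (by omega) z₀ δ hδ hball hdiam V₁ hV₁ hV₁P).2
      have hxW : x ∈ planePreimage f (V₁' ∪ V₁) :=
        planePreimage_mono subset_union_left (hVV₁'.subset hxV')
      have hE : IsComponentOf (connectedComponentIn (planePreimage f (V₁' ∪ V₁)) x)
        (planePreimage f (V₁' ∪ V₁)) := ⟨x, hxW, rfl⟩
      refine hΩ.isControlledPreimage_succ hf hX Metric.isBounded_ball hV₁'o hV₁'Ω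
        ((hf.differentiableOn_iterate _ k).mono hV₁'.subset) hc hVV₁'
        (union_subset hV₁'Ω hV₁Ω) subset_union_left ?_ hE ?_ ?_
      · refine (hypDiam_union_le hmeet).trans ((add_le_add h1 h2).trans_eq ?_)
        rw [ENNReal.coe_mul, ENNReal.coe_ofNat, two_mul]
      · exact hVV₁'.isConnected.isPreconnected.subset_connectedComponentIn hxV'
          (hVV₁'.subset.trans (planePreimage_mono subset_union_left))
      · obtain ⟨z, hz, hzP⟩ := hVP
        exact ⟨z, hVV₁.isConnected.isPreconnected.subset_connectedComponentIn hxV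
          (hVV₁.subset.trans (planePreimage_mono subset_union_right)) hz, hzP⟩
    · push Not at hP
      exact hc.of_isProperOfDegreeLE_one hX hVV₁'.subset
        (isSimplyConnected_of_disjoint_postsingularSet hf hX hΩ.backward_invariant hV₁'o
          hc.isSimplyConnected hV₁'Ω hP hVV₁')

/-- If pullbacks of disks of half the radius are controlled, then a controlled pullback of the
whole disk has hyperbolic diameter at most `C₀`. -/
theorem hypDiam_le_maneConst (hf : IsMeromorphicToSphere f) (hX : IsDomainOfDefinition f X)
    (hD : 1 ≤ D) (hC : IsPreimageDiamBound (D ^ S₀.card) (2 / 3) C)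
    (hb : iterPreimage f X 1 (toSphere Ω) ⊆ toSphere Ω) {n : ℕ} {z₀ : ℂ} {δ : ℝ} (hδ : 0 < δ)
    (hball : Metric.ball z₀ (2 * δ) ⊆ Ω) {V : Set ℂ}
    (hV : IsComponentOf V (planeIterPreimage f n (Metric.ball z₀ δ)))
    (hVc : IsControlledPreimage f X S₀ D n V (Metric.ball z₀ δ))
    (hhalf : ∀ w ∈ Metric.ball z₀ δ, ∀ V' : Set ℂ,
      IsComponentOf V' (planeIterPreimage f n (Metric.ball w (δ / 2))) → (V' ∩ V).Nonempty →
      IsControlledPreimage f X S₀ D n V' (Metric.ball w (δ / 2))) :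
    hypDiam Ω V ≤ ↑(maneConst (D ^ S₀.card) C) := by
  set g := (planeMap f)^[n] with hg
  set N := D ^ S₀.card with hN
  have hp : IsProperOfDegreeLE g V (Metric.ball z₀ δ) N := hVc.isProperOfDegreeLE hD
  obtain ⟨s, hscard, hs1, hs2⟩ := exists_diskCover
  have hcen : ∀ c ∈ s, z₀ + δ * c ∈ Metric.ball z₀ δ := fun c hc => by
    have h1 : ‖c‖ < 1 := by simpa using hs1 hc
    rw [mem_ball_iff_norm, add_sub_cancel_left, norm_mul, Complex.norm_real, Real.norm_eq_abs,
      abs_of_pos hδ]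
    exact mul_lt_of_lt_one_right hδ h1
  have hfib : ∀ c : ℂ, (V ∩ g ⁻¹' {z₀ + δ * c}).Finite := fun c => by
    by_cases hc : z₀ + δ * c ∈ Metric.ball z₀ δ
    · exact hp.finite_fiber hc
    · refine finite_empty.subset ?_
      rintro x ⟨hx, hxc⟩
      exact hc (hxc ▸ hp.mapsTo hx)
  -- These are the preimages in `V` of the centres of the `N₀` covering disks, at most `N` for each.
  set T : Finset ℂ := s.biUnion fun c => (hfib c).toFinset with hT
  have hTcard : T.card ≤ diskCoverNumber * N := by
    rw [← hscard]
    refine Finset.card_biUnion_le_card_mul _ _ _ fun c hc => ?_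
    have := hp.2 _ (hcen c hc)
    rw [(hfib c).encard_eq_coe_toFinset_card] at this
    exact_mod_cast this
  have hTV : ∀ x ∈ T, x ∈ V := fun x hx => by
    obtain ⟨c, -, hxc⟩ := Finset.mem_biUnion.1 hx
    exact ((hfib c).mem_toFinset.1 hxc).1
  let O : T → Set ℂ := fun x =>
    connectedComponentIn (planeIterPreimage f n (Metric.ball (g x) (δ / 3))) x
  have hself : ∀ r : ℝ, 0 < r → ∀ x : T, (x : ℂ) ∈ planeIterPreimage f n (Metric.ball (g x) r) :=
    fun r hr x => mem_planeIterPreimage_of_iterate_mem n (hV.subset (hTV x x.2))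
      (Metric.mem_ball_self hr)
  have hOo : ∀ x, IsOpen (O x) := fun x =>
    (hf.isOpen_planeIterPreimage Metric.isOpen_ball n).connectedComponentIn
  have hOd : ∀ x, hypDiam Ω (O x) ≤ C := fun x => by
    have hgx : g x ∈ Metric.ball z₀ δ := hp.mapsTo (hTV x x.2)
    set V' := connectedComponentIn (planeIterPreimage f n (Metric.ball (g x) (δ / 2))) x with hV'
    have hV'c : IsComponentOf V' (planeIterPreimage f n (Metric.ball (g x) (δ / 2))) :=
      ⟨x, hself _ (half_pos hδ) x, rfl⟩
    have hxV' : (x : ℂ) ∈ V' := mem_connectedComponentIn (hself _ (half_pos hδ) x)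
    have hgood := hhalf _ hgx V' hV'c ⟨x, hxV', hTV x x.2⟩
    have hOc : IsComponentOf (O x) (planeIterPreimage f n (Metric.ball (g x) (δ / 3))) :=
      ⟨x, hself _ (by positivity) x, rfl⟩
    have hOV' : O x ⊆ V' := isPreconnected_connectedComponentIn.subset_connectedComponentIn
      (mem_connectedComponentIn (hself _ (by positivity) x))
      (hOc.subset.trans (planeIterPreimage_mono n (Metric.ball_subset_ball (by linarith))))
    have hV'Ω : V' ⊆ Ω := by
      refine hV'c.subset.trans (planeIterPreimage_subset hX hb (Subset.trans ?_ hball) n)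
      rw [Metric.mem_ball] at hgx
      exact Metric.ball_subset_ball' (by linarith)
    -- Since `δ / 3 = 2/3 · δ / 2`, the constant `C(N, 2/3)` bounds the diameter of `O x` in `V'`.
    -- Passing from `V'` to the larger set `Ω` only decreases distances.
    refine (hypDiam_anti hV'Ω _).trans (hC (g x) (δ / 2) V' g (half_pos hδ)
      (hV'c.isOpen (hf.isOpen_planeIterPreimage Metric.isOpen_ball n)) hgood.isSimplyConnected
      ((hf.differentiableOn_iterate _ n).mono hV'c.subset) (hgood.isProperOfDegreeLE hD) _ ?_)
    rw [show (2 / 3 * (δ / 2) : ℝ) = δ / 3 by ring]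
    exact hOc.of_subset_of_subset
      (fun y hy => ⟨hOV' hy, mapsTo_planeMap_iterate n (hOc.subset hy)⟩)
      (fun y hy => mem_planeIterPreimage_of_iterate_mem n (hV'c.subset hy.1) hy.2)
  have hcov : V ⊆ ⋃ x, O x := by
    intro y hy
    have hgy := hp.mapsTo hy
    have hy1 : (δ : ℂ)⁻¹ * (g y - z₀) ∈ Metric.ball (0 : ℂ) 1 := by
      rw [mem_ball_iff_norm] at hgy
      rw [mem_ball_zero_iff, norm_mul, norm_inv, Complex.norm_real, Real.norm_eq_abs,
        abs_of_pos hδ, inv_mul_lt_one₀ hδ]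
      exact hgy
    obtain ⟨c, hc, hyc⟩ := mem_iUnion₂.1 (hs2 hy1)
    set w := z₀ + δ * c with hw
    have hyw : g y ∈ Metric.ball w (δ / 3) := by
      rw [mem_ball_iff_norm] at hyc ⊢
      have hδ0 : (δ : ℂ) ≠ 0 := by exact_mod_cast hδ.ne'
      have : g y - w = δ * ((δ : ℂ)⁻¹ * (g y - z₀) - c) := by rw [hw]; field_simp; ring
      rw [this, norm_mul, Complex.norm_real, Real.norm_eq_abs, abs_of_pos hδ]
      linarith [mul_lt_mul_of_pos_left hyc hδ]
    -- The small disk may leave `D_δ(z₀)`, but `Q` is convex and contains the centre `w`. So the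
    -- component `A` of its preimage through `y` maps onto `Q` and contains a preimage of `w`, a
    -- point of `T`.
    set Q := Metric.ball z₀ δ ∩ Metric.ball w (δ / 3) with hQ
    set A := connectedComponentIn (V ∩ g ⁻¹' Q) y with hA
    have hyQ : y ∈ V ∩ g ⁻¹' Q := ⟨hy, hgy, hyw⟩
    have hAc : IsComponentOf A (V ∩ g ⁻¹' Q) := ⟨y, hyQ, rfl⟩
    obtain ⟨x, hxA, hxw⟩ := hp.subset_image_of_isComponentOf
      (hV.isOpen (hf.isOpen_planeIterPreimage Metric.isOpen_ball n))
      ((hf.differentiableOn_iterate _ n).mono hV.subset)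
      (Metric.isOpen_ball.inter Metric.isOpen_ball)
      ((convex_ball _ _).inter (convex_ball _ _)).isPreconnected inter_subset_left hAc
      ⟨hcen c hc, Metric.mem_ball_self (by positivity)⟩
    have hxT : x ∈ T := Finset.mem_biUnion.2
      ⟨c, hc, (hfib c).mem_toFinset.2 ⟨(hAc.subset hxA).1, hxw⟩⟩
    refine mem_iUnion.2 ⟨⟨x, hxT⟩, ?_⟩
    refine hAc.isConnected.isPreconnected.subset_connectedComponentIn hxA (fun a ha => ?_)
      (mem_connectedComponentIn hyQ)
    have ha' := hAc.subset ha
    exact mem_planeIterPreimage_of_iterate_mem n (hV.subset ha'.1) (by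
      rw [show g x = w from hxw]
      exact ha'.2.2)
  refine (hypDiam_le_card_mul hV.isConnected.isPreconnected O hOo hOd hcov).trans ?_
  rw [Fintype.card_coe, maneConst, ENNReal.coe_mul, ← Nat.cast_mul, ENNReal.coe_natCast]
  gcongr

theorem IsRegularSet.hasSmallPullbacks (hf : IsMeromorphicToSphere f)
    (hX : IsDomainOfDefinition f X) (hD : 1 ≤ D)
    (hC : IsPreimageDiamBound (D ^ S₀.card) (2 / 3) C) (hΩ : IsRegularSet f X S₀ D C Ω) (n : ℕ) :
    HasSmallPullbacks f X S₀ D C Ω n := by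
  induction n using Nat.strong_induction_on with
  | _ n ih =>
    intro z₀ δ hδ hball hdiam V hV hVP
    cases n with
    | zero =>
      obtain rfl := hV.eq_ball
      exact ⟨isControlledPreimage_zero z₀ hδ,
        (hypDiam_mono (Metric.ball_subset_ball (by linarith))).trans hdiam⟩
    | succ n =>
      obtain ⟨V₁, hV₁, hVV₁⟩ := IsComponentOf.exists_planePreimage hf hV
      obtain ⟨hc, hd⟩ := ih n n.lt_succ_self z₀ δ hδ hball hdiam V₁ hV₁
        (exists_mem_postsingularSet_of_planePreimage hf hX hVV₁.subset hVP)
      have hV₁Ω : V₁ ⊆ Ω := hV₁.subset.trans (planeIterPreimage_subset hX hΩ.backward_invariant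
        ((Metric.ball_subset_ball (by linarith)).trans hball) n)
      -- Here `W` is `V₁` itself, of diameter at most `C₀ ≤ 2C₀`, and `V` is the preimage component
      -- that meets `P(f)`.
      have hVc : IsControlledPreimage f X S₀ D (n + 1) V (Metric.ball z₀ δ) :=
        hΩ.isControlledPreimage_succ hf hX Metric.isBounded_ball
          (hV₁.isOpen (hf.isOpen_planeIterPreimage Metric.isOpen_ball n)) hV₁Ω
          ((hf.differentiableOn_iterate _ n).mono hV₁.subset) hc hVV₁ hV₁Ω Subset.rfl
          (hd.trans (ENNReal.coe_le_coe.2 (le_mul_of_one_le_left' one_le_two)))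
          hVV₁ Subset.rfl hVP
      refine ⟨hVc, hypDiam_le_maneConst hf hX hD hC hΩ.backward_invariant hδ hball hV hVc ?_⟩
      intro w hw V' hV' hVV'
      exact hΩ.isControlledPreimage_half hf hX (fun k hk => ih k (Nat.lt_succ_of_le hk)) hδ hball
        hdiam hw (n + 1) le_rfl hV hVP hV' hVV'

/-- The pullbacks of small disks along components that meet the postsingular set. -/
theorem IsRegularSet.pullback_ball (hf : IsMeromorphicToSphere f)
    (hX : IsDomainOfDefinition f X) (hD : 1 ≤ D)
    (hC : IsPreimageDiamBound (D ^ S₀.card) (2 / 3) C) (hΩ : IsRegularSet f X S₀ D C Ω)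
    {z₀ : ℂ} {δ : ℝ} (hδ : 0 < δ) (hball : Metric.ball z₀ (2 * δ) ⊆ Ω)
    (hdiam : hypDiam Ω (Metric.ball z₀ (2 * δ)) ≤ ↑(maneConst (D ^ S₀.card) C))
    {n : ℕ} {V : Set Sphere} (hV : IsComponentOf V (iterPreimage f X n (toSphere (Metric.ball z₀ δ))))
    (hVP : (V ∩ postsingularSet f X).Nonempty) :
    (IsSimplyConnected V ∧
      IsProperOfDegreeLE ((sphereMap f)^[n]) V (toSphere (Metric.ball z₀ δ)) (D ^ S₀.card)) ∧
    (V ⊆ toSphere Ω ∧ hypDiam Ω {z : ℂ | (z : Sphere) ∈ V} ≤ ↑(maneConst (D ^ S₀.card) C)) := by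
  have hball' : Metric.ball z₀ δ ⊆ Ω := (Metric.ball_subset_ball (by linarith)).trans hball
  rw [iterPreimage_toSphere hX hΩ.backward_invariant hball'] at hV
  obtain ⟨U, hU, rfl⟩ := isComponentOf_toSphere_iff.1 hV
  obtain ⟨_, ⟨z, hz, rfl⟩, hzP⟩ := hVP
  obtain ⟨hc, hd⟩ := hΩ.hasSmallPullbacks hf hX hD hC n z₀ δ hδ hball hdiam U hU ⟨z, hz, hzP⟩
  refine ⟨⟨isSimplyConnected_toSphere_iff.2 hc.isSimplyConnected, ?_⟩, toSphere_mono
    (hU.subset.trans (planeIterPreimage_subset hX hΩ.backward_invariant hball' n)), ?_⟩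
  · exact (isProperOfDegreeLE_toSphere_iff fun z hz => sphereMap_iterate_coe n (hU.subset hz)).2
      (hc.isProperOfDegreeLE hD)
  · rwa [setOf_coe_mem_toSphere]

theorem IsRegularSet.eventually_hypDiam_le (hD : 1 ≤ D)
    (hC : IsPreimageDiamBound (D ^ S₀.card) (2 / 3) C) (hΩ : IsRegularSet f X S₀ D C Ω)
    {z₀ : ℂ} (hz₀ : z₀ ∈ Ω) :
    ∀ᶠ δ : ℝ in 𝓝[>] 0, Metric.ball z₀ (2 * δ) ⊆ Ω ∧
      hypDiam Ω (Metric.ball z₀ (2 * δ)) ≤ ↑(maneConst (D ^ S₀.card) C) := by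
  have hN : 1 ≤ D ^ S₀.card := Nat.one_le_pow _ _ hD
  have hpos : 0 < maneConst (D ^ S₀.card) C := by
    have h1 : (0 : ℝ≥0) < diskCoverNumber := Nat.cast_pos.2 diskCoverNumber_pos
    have h2 : (0 : ℝ≥0) < (D ^ S₀.card : ℕ) := Nat.cast_pos.2 hN
    exact mul_pos (mul_pos h1 h2) (hC.pos hN)
  have htend : Tendsto (fun δ : ℝ => 2 * δ) (𝓝[>] 0) (𝓝[>] 0) := by
    refine tendsto_nhdsWithin_iff.2 ⟨?_, ?_⟩
    · have : Continuous fun δ : ℝ => 2 * δ := by fun_prop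
      simpa using (this.tendsto 0).mono_left nhdsWithin_le_nhds
    · filter_upwards [self_mem_nhdsWithin] with δ hδ
      exact mul_pos two_pos (mem_Ioi.1 hδ)
  exact htend.eventually (eventually_hypDiam_ball_le hΩ.isOpen hz₀ (ENNReal.coe_ne_zero.2 hpos.ne'))

end Mane

theorem mainTheorem4 (f : ℂ → Sphere) (hf : IsMeromorphicToSphere f)
    (hf_nonconst : ¬ ∃ c : Sphere, ∀ z : ℂ, f z = c)
    (hf_nonlin : ¬ ∃ a b : ℂ, ∀ z : ℂ, f z = ((a * z + b : ℂ) : Sphere))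
    (X : Set Sphere) (hX : IsDomainOfDefinition f X)
    (S₀ : Finset Sphere) (D : ℕ) (hD : 1 ≤ D) :
    (∃ C : ℝ≥0, IsPreimageDiamBound (D ^ S₀.card) (2 / 3) C) ∧
    ∀ C : ℝ≥0, IsPreimageDiamBound (D ^ S₀.card) (2 / 3) C →
    ∀ Ω : Set ℂ, IsRegularSet f X S₀ D C Ω →
      (∀ z₀ ∈ Ω, IsRegularPoint f X (D ^ S₀.card) z₀) ∧
      ∀ z₀ ∈ Ω,
        (∀ᶠ δ : ℝ in 𝓝[>] 0, Metric.ball z₀ (2 * δ) ⊆ Ω ∧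
          hypDiam Ω (Metric.ball z₀ (2 * δ)) ≤ ↑(maneConst (D ^ S₀.card) C)) ∧
        ∀ δ : ℝ, 0 < δ → Metric.ball z₀ (2 * δ) ⊆ Ω →
          hypDiam Ω (Metric.ball z₀ (2 * δ)) ≤ ↑(maneConst (D ^ S₀.card) C) →
          ∀ (n : ℕ) (V : Set Sphere),
            IsComponentOf V (iterPreimage f X n (toSphere (Metric.ball z₀ δ))) →
            (V ∩ postsingularSet f X).Nonempty →
            (IsSimplyConnected V ∧
              IsProperOfDegreeLE ((sphereMap f)^[n]) V (toSphere (Metric.ball z₀ δ))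
                (D ^ S₀.card)) ∧
            (V ⊆ toSphere Ω ∧
              hypDiam Ω {z : ℂ | (z : Sphere) ∈ V} ≤ ↑(maneConst (D ^ S₀.card) C)) := by
  refine ⟨exists_isPreimageDiamBound (Nat.one_le_pow _ _ hD), fun C hC Ω hΩ => ⟨?_, ?_⟩⟩
  · intro z₀ hz₀
    obtain ⟨δ, ⟨hball, hdiam⟩, hδ⟩ :=
      ((hΩ.eventually_hypDiam_le hD hC hz₀).and self_mem_nhdsWithin).exists
    exact ⟨δ, hδ, fun n U hU hUP => (hΩ.pullback_ball hf hX hD hC hδ hball hdiam hU hUP).1⟩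
  · exact fun z₀ hz₀ => ⟨hΩ.eventually_hypDiam_le hD hC hz₀, fun δ hδ hball hdiam n V hV hVP =>
      hΩ.pullback_ball hf hX hD hC hδ hball hdiam hV hVP⟩
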